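/- **Game.** A CE (catcher-evader) game has players $N=\{0,1,\dots,n\}$ ($0$ is the catcher, $N^+=\{1,\dots,n\}$ are the evaders), a finite set $\Psi$ of sites, resources $r_i\ge 0$, limits $\ell_{i,\psi}\ge 0$ with $r_i\le\sum_{\psi}\ell_{i,\psi}$, and real utility parameters $a_{i,\psi},b_{i,\psi},c_{i,\psi},d_{i,\psi}$ with $d_{0,\psi}>0$ and $d_{i,\psi}<0$ for $i\in N^+$. A strategy of player $i$ is $(x_{i,\psi})_\psi$ with $0\le x_{i,\psi}\le \ell_{i,\psi}$ and $\sum_\psi x_{i,\psi}=r_i$. Put $x_{-0,\psi}=\sum_{i\in N^+}x_{i,\psi}$, $x_{-i,\psi}=x_{0,\psi}$ for $i\in N^+$, and $\mu_{i,\psi}=b_{i,\psi}+d_{i,\psi}x_{-i,\psi}$. The utility of player $i$ is $\sum_\psi(\mu_{i,\psi}x_{i,\psi}+a_{i,\psi}x_{-i,\psi}+c_{i,\psi})$. A Nash equilibrium (NE) is a profile of strategies in which no player can gain by a unilateral change of strategy. For a profile $x$ let $\theta_0=\max\{\mu_{0,\psi}: x_{0,\psi}<\ell_{0,\psi}\}$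 and $\theta_i=\min\{\mu_{i,\psi}:x_{i,\psi}>0\}$ for $i\in N^+$. Let $\hat B_0=\{\psi:\mu_{0,\psi}=\theta_0,\ x_{0,\psi}<\ell_{0,\psi}\}$ be the open boundary sites and $A=\{(i,\psi):i\in N^+,\ \mu_{i,\psi}=\theta_i\}$ the active edges (an evader with $r_i=0$ has no $\theta_i$ and no active edges). The residual graph of $x$ has, for each $(i,\psi)\in A$, an edge $i\to\psi$ of length $\log(-d_{i,\psi})$ and capacity $\ell_{i,\psi}-x_{i,\psi}$ if this is positive, and an edge $\psi\to i$ of length $-\log(-d_{i,\psi})$ and capacity $x_{i,\psi}$ if this is positive. **Algorithm** (exact real arithmetic; a linear order of $\Psi$ is fixed). *Initialization:* $x_{0,\psi}=0$ for all $\psi$; each evader $i$ goes through the sites once, in an order of non-increasing $b_{i,\psi}$, ties broken arbitrarily, and sets $x_{i,\psi}\gets\min(\ell_{i,\psi},\,r_i-\sum_{\phi}x_{i,\phi})$. *While* $\sum_\psi x_{0,\psi}<r_0$, perform one iteration: 1. *Reallocation.* Take any minimum-cost maximum $\sigma$–$\tau$ flow $f$ in the network with edges $\sigma\to i$ of capacity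 $\sum_{\psi:(i,\psi)\in A}x_{i,\psi}$, $i\to\psi$ for $(i,\psi)\in A$ of capacity $\ell_{i,\psi}$ and cost $\log(-d_{i,\psi})$, and $\psi\to\tau$ of capacity $\sum_{i:(i,\psi)\in A}x_{i,\psi}$ (other costs are $0$), and set $x_{i,\psi}\gets f(i,\psi)$ for $(i,\psi)\in A$. 2. *Increase.* Let $\psi^*$ be the first site of $\hat B_0$, in the fixed order, from which every site reachable in the residual graph lies in $\hat B_0$. If there is none, this step fails. Otherwise let $\mathrm{dist}$ be the shortest-path distance from $\psi^*$ in the residual graph, $\gamma_v=e^{-\mathrm{dist}(v)}$ ($0$ if $v$ is unreachable), and let $\Delta$ be the minimum of $(r_0-\sum_\psi x_{0,\psi})/\sum_\psi\gamma_\psi$, of $(\ell_{0,\psi}-x_{0,\psi})/\gamma_\psi$ over the $\psi$ with $\gamma_\psi>0$, and of those numbers $(\mu_{i,\psi}-\theta_i)/(\gamma_\psi(-d_{i,\psi})-\gamma_i)$ with $i\in N^+$, $\mu_{i,\psi}\ne\theta_i$ and nonzero denominator that are positive. Set $x_{0,\psi}\gets x_{0,\psi}+\Delta\gamma_\psi$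 for all $\psi$. 3. *Rerouting, only if step 2 failed.* For $\Delta\ge0$ with $\Delta\le\theta_0-\mu_{0,\psi}$ for all $\psi$ with $\mu_{0,\psi}<\theta_0$, let $G_\Delta$ be the residual graph together with edges $\sigma\to\psi$ of capacity $\Delta/d_{0,\psi}$ for $\psi\in\hat B_0$ and edges $\psi\to\tau$ for $\psi\notin\hat B_0$, of capacity $\infty$ if $\mu_{0,\psi}\ge\theta_0$ and $(\theta_0-\Delta-\mu_{0,\psi})/d_{0,\psi}$ otherwise. Take the greatest such $\Delta$ for which a maximum $\sigma$–$\tau$ flow of $G_\Delta$ saturates all edges from $\sigma$, take any maximum flow of $G_\Delta$ for it, and add to each $x_{i,\psi}$ the net flow from $i$ to $\psi$. **Theorem.** For every CE game and every fixed order of $\Psi$, whatever choices are made in the initialization and in the flow subroutines, the algorithm never gets stuck, performs at most $$2|\Psi|+4|\Psi|\cdot 3^{\,n|\Psi|}$$ iterations, and ends with a Nash equilibrium of the game. Throughout (at the start and the end of each iteration, and between its steps) the current profile is a Nash equilibrium of the game in which the catcher's resource $r_0$ is replaced by the amount $\sum_\psi x_{0,\psi}$ allocated so far. In particular, every CE game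 has a Nash equilibrium. -/

import Mathlib

open scoped BigOperators

/-- The data of a catcher-evader game with player set `{0, 1, …, n}` and sites `Ψ`.
Player `0` is the catcher, the players `i.succ` with `i : Fin n` are the evaders. -/
structure CEGame (n : ℕ) (Ψ : Type*) where
  /-- resources `r_i` -/
  r : Fin (n + 1) → ℝ
  /-- limits `ℓ_{i,ψ}` -/
  lim : Fin (n + 1) → Ψ → ℝ
  /-- alternating utilities `a_{i,ψ}` -/
  a : Fin (n + 1) → Ψ → ℝ
  /-- base utilities `b_{i,ψ}` -/
  b : Fin (n + 1) → Ψ → ℝ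
  /-- constant utilities `c_{i,ψ}` -/
  c : Fin (n + 1) → Ψ → ℝ
  /-- utility changes `d_{i,ψ}` -/
  d : Fin (n + 1) → Ψ → ℝ

namespace CEGame

/-- A strategy profile: `x i ψ` is the amount of resource that player `i` puts on site `ψ`. -/
abbrev Profile (n : ℕ) (Ψ : Type*) : Type _ := Fin (n + 1) → Ψ → ℝ

/-- The standing assumptions on a game: nonnegative resources and limits, every player is able
to place all of its resource, the catcher wants to catch and the evaders want to evade. -/
structure Valid {n : ℕ} {Ψ : Type*} [Fintype Ψ] (G : CEGame n Ψ) : Prop where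
  r_nonneg : ∀ i, 0 ≤ G.r i
  lim_nonneg : ∀ i ψ, 0 ≤ G.lim i ψ
  r_le : ∀ i, G.r i ≤ ∑ ψ, G.lim i ψ
  d_catcher : ∀ ψ, 0 < G.d 0 ψ
  d_evader : ∀ (i : Fin n) (ψ : Ψ), G.d i.succ ψ < 0

/-- `x_{-i,ψ}`: the opponents' resource on `ψ` (all the evaders' together if `i = 0`). -/
def opp {n : ℕ} {Ψ : Type*} (x : Profile n Ψ) (i : Fin (n + 1)) (ψ : Ψ) : ℝ :=
  if i = 0 then ∑ j : Fin n, x j.succ ψ else x 0 ψ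

/-- The per-resource utility `μ_{i,ψ} = b_{i,ψ} + d_{i,ψ} x_{-i,ψ}`. -/
def mu {n : ℕ} {Ψ : Type*} (G : CEGame n Ψ) (x : Profile n Ψ) (i : Fin (n + 1)) (ψ : Ψ) : ℝ :=
  G.b i ψ + G.d i ψ * opp x i ψ

/-- The utility of player `i`. -/
def utility {n : ℕ} {Ψ : Type*} [Fintype Ψ] (G : CEGame n Ψ) (x : Profile n Ψ)
    (i : Fin (n + 1)) : ℝ :=
  ∑ ψ, ((G.b i ψ + G.d i ψ * opp x i ψ) * x i ψ + G.a i ψ * opp x i ψ + G.c i ψ)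

/-- The feasible strategies of player `i`. -/
def Feasible {n : ℕ} {Ψ : Type*} [Fintype Ψ] (G : CEGame n Ψ) (i : Fin (n + 1))
    (s : Ψ → ℝ) : Prop :=
  (∀ ψ, 0 ≤ s ψ ∧ s ψ ≤ G.lim i ψ) ∧ ∑ ψ, s ψ = G.r i

/-- Nash equilibrium: all strategies are feasible, and no player gains by switching to another
feasible strategy. -/
def IsNash {n : ℕ} {Ψ : Type*} [Fintype Ψ] (G : CEGame n Ψ) (x : Profile n Ψ) : Prop :=
  ∀ i, G.Feasible i (x i) ∧
    ∀ s : Ψ → ℝ, G.Feasible i s → G.utility (Function.update x i s) i ≤ G.utility x i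

/-- The same game in which the catcher has resource `ρ`. -/
def withCatcherResource {n : ℕ} {Ψ : Type*} (G : CEGame n Ψ) (ρ : ℝ) : CEGame n Ψ :=
  { G with r := Function.update G.r 0 ρ }

/-- `x` is a Nash equilibrium of the game in which the catcher has exactly the resource that it
has allocated in `x`. -/
def IsCurrentNash {n : ℕ} {Ψ : Type*} [Fintype Ψ] (G : CEGame n Ψ) (x : Profile n Ψ) : Prop :=
  (G.withCatcherResource (∑ ψ, x 0 ψ)).IsNash x

/-! ### Thresholds, boundary sites and active edges -/

/-- `t` is the catcher's threshold `θ_0 = max {μ_{0,ψ} : x_{0,ψ} < ℓ_{0,ψ}}`. -/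
def IsCatcherThreshold {n : ℕ} {Ψ : Type*} (G : CEGame n Ψ) (x : Profile n Ψ) (t : ℝ) : Prop :=
  IsGreatest {m : ℝ | ∃ ψ, x 0 ψ < G.lim 0 ψ ∧ m = G.mu x 0 ψ} t

/-- `t` is the threshold `θ_i = min {μ_{i,ψ} : x_{i,ψ} > 0}` of the evader `i.succ`.
(An evader without any resource has no threshold, hence no active edges.) -/
def IsEvaderThreshold {n : ℕ} {Ψ : Type*} (G : CEGame n Ψ) (x : Profile n Ψ) (i : Fin n)
    (t : ℝ) : Prop :=
  IsLeast {m : ℝ | ∃ ψ, 0 < x i.succ ψ ∧ m = G.mu x i.succ ψ} t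

/-- The open boundary sites of the catcher: `μ_{0,ψ} = θ_0` and `x_{0,ψ} < ℓ_{0,ψ}`. -/
def OpenBoundary {n : ℕ} {Ψ : Type*} (G : CEGame n Ψ) (x : Profile n Ψ) (ψ : Ψ) : Prop :=
  G.IsCatcherThreshold x (G.mu x 0 ψ) ∧ x 0 ψ < G.lim 0 ψ

/-- The active edges: `μ_{i,ψ} = θ_i`. -/
def Active {n : ℕ} {Ψ : Type*} (G : CEGame n Ψ) (x : Profile n Ψ) (i : Fin n) (ψ : Ψ) : Prop :=
  G.IsEvaderThreshold x i (G.mu x i.succ ψ)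

/-! ### Flow networks -/

/-- A flow network: a capacity for every ordered pair of vertices (`0` for a pair that is not an
edge, `⊤` for an unlimited capacity). -/
structure FlowNetwork (V : Type*) where
  source : V
  sink : V
  cap : V → V → EReal

/-- A flow: nonnegative, within the capacities, conserved at all inner vertices. -/
def FlowNetwork.IsFlow {V : Type*} [Fintype V] (N : FlowNetwork V) (f : V → V → ℝ) : Prop :=
  (∀ u v, 0 ≤ f u v ∧ (f u v : EReal) ≤ N.cap u v) ∧
    ∀ v, v ≠ N.source → v ≠ N.sink → ∑ u, f u v = ∑ u, f v u

/-- The value of a flow: net flow out of the source. -/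
def FlowNetwork.value {V : Type*} [Fintype V] (N : FlowNetwork V) (f : V → V → ℝ) : ℝ :=
  ∑ v, f N.source v - ∑ v, f v N.source

/-- Maximum flows. -/
def FlowNetwork.IsMaxFlow {V : Type*} [Fintype V] (N : FlowNetwork V) (f : V → V → ℝ) : Prop :=
  N.IsFlow f ∧ ∀ g, N.IsFlow g → N.value g ≤ N.value f

/-- Minimum-cost (maximum) flows for the edge costs `w`. -/
def FlowNetwork.IsMinCostMaxFlow {V : Type*} [Fintype V] (N : FlowNetwork V) (w : V → V → ℝ)
    (f : V → V → ℝ) : Prop :=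
  N.IsMaxFlow f ∧ ∀ g, N.IsMaxFlow g →
    ∑ u, ∑ v, w u v * f u v ≤ ∑ u, ∑ v, w u v * g u v

/-- `f` saturates all edges leaving the source. -/
def FlowNetwork.SaturatesSource {V : Type*} (N : FlowNetwork V) (f : V → V → ℝ) : Prop :=
  ∀ v, (f N.source v : EReal) = N.cap N.source v

/-- The vertices `σ`, the evaders, the sites, and `τ`. -/
inductive Node (n : ℕ) (Ψ : Type*) where
  | source : Node n Ψ
  | evader (i : Fin n) : Node n Ψ
  | site (ψ : Ψ) : Node n Ψ
  | sink : Node n Ψ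
  deriving Fintype

/-! ### The initial profile -/

/-- Go through the sites of a list and give each of them `min (ℓ_ψ) (r - ∑ x)`. -/
def greedyFill {Ψ : Type*} [Fintype Ψ] [DecidableEq Ψ] (lim : Ψ → ℝ) (r : ℝ) :
    List Ψ → (Ψ → ℝ) → (Ψ → ℝ)
  | [], s => s
  | ψ :: L, s => greedyFill lim r L (Function.update s ψ (min (lim ψ) (r - ∑ φ, s φ)))

/-- The initial profiles: the catcher allocates nothing; each evader fills the sites in an order
of non-increasing base utility (ties in any order). -/
def IsInitial {n : ℕ} {Ψ : Type*} [Fintype Ψ] [DecidableEq Ψ] (G : CEGame n Ψ)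
    (x : Profile n Ψ) : Prop :=
  (∀ ψ, x 0 ψ = 0) ∧
    ∀ i : Fin n, ∃ L : List Ψ, L.Nodup ∧ (∀ ψ, ψ ∈ L) ∧
      L.Pairwise (fun ψ φ => G.b i.succ φ ≤ G.b i.succ ψ) ∧
      x i.succ = greedyFill (G.lim i.succ) (G.r i.succ) L (fun _ => 0)

/-! ### Reallocation by a minimum-cost flow -/

open Classical in
/-- Capacities of the network on the active edges:
`κ(σ,i) = ∑_{ψ active for i} x_{i,ψ}`, `κ(i,ψ) = ℓ_{i,ψ}` for active `(i,ψ)`,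
`κ(ψ,τ) = ∑_{i active at ψ} x_{i,ψ}`. -/
noncomputable def activeCap {n : ℕ} {Ψ : Type*} [Fintype Ψ] (G : CEGame n Ψ) (x : Profile n Ψ) :
    Node n Ψ → Node n Ψ → ℝ
  | .source, .evader i => ∑ ψ, if G.Active x i ψ then x i.succ ψ else 0
  | .evader i, .site ψ => if G.Active x i ψ then G.lim i.succ ψ else 0
  | .site ψ, .sink => ∑ i : Fin n, if G.Active x i ψ then x i.succ ψ else 0
  | _, _ => 0

/-- The network on the active edges. -/
noncomputable def activeNetwork {n : ℕ} {Ψ : Type*} [Fintype Ψ] (G : CEGame n Ψ)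
    (x : Profile n Ψ) : FlowNetwork (Node n Ψ) where
  source := .source
  sink := .sink
  cap u v := (G.activeCap x u v : EReal)

/-- Costs: `w(i,ψ) = log (-d_{i,ψ})` on evader-site edges, and `0` on the other edges.
(Flow vanishes on inactive edges, so their cost plays no role.) -/
noncomputable def edgeCost {n : ℕ} {Ψ : Type*} (G : CEGame n Ψ) : Node n Ψ → Node n Ψ → ℝ
  | .evader i, .site ψ => Real.log (-G.d i.succ ψ)
  | _, _ => 0

/-- `y` is an outcome of the min-cost-flow reallocation of `x`. -/
def Reallocates {n : ℕ} {Ψ : Type*} [Fintype Ψ] (G : CEGame n Ψ) (x y : Profile n Ψ) : Prop :=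
  ∃ f, (G.activeNetwork x).IsMinCostMaxFlow G.edgeCost f ∧ y 0 = x 0 ∧
    ∀ (i : Fin n) (ψ : Ψ),
      (G.Active x i ψ → y i.succ ψ = f (.evader i) (.site ψ)) ∧
      (¬ G.Active x i ψ → y i.succ ψ = x i.succ ψ)

/-! ### Residual graph and shortest paths -/

open Classical in
/-- Residual capacities of the flow `x` on the active edges, between evaders and sites.
(The edges at `σ` and `τ` are saturated by that flow; what they leave in the residual graph lies
on no path that joins sites and evaders.) -/
noncomputable def resCap {n : ℕ} {Ψ : Type*} (G : CEGame n Ψ) (x : Profile n Ψ) :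
    Node n Ψ → Node n Ψ → ℝ
  | .evader i, .site ψ => if G.Active x i ψ then G.lim i.succ ψ - x i.succ ψ else 0
  | .site ψ, .evader i => if G.Active x i ψ then x i.succ ψ else 0
  | _, _ => 0

/-- Lengths of the residual edges: `w(i,ψ)` forward and `-w(i,ψ)` backward. -/
noncomputable def resLength {n : ℕ} {Ψ : Type*} (G : CEGame n Ψ) : Node n Ψ → Node n Ψ → ℝ
  | .evader i, .site ψ => Real.log (-G.d i.succ ψ)
  | .site ψ, .evader i => -Real.log (-G.d i.succ ψ)
  | _, _ => 0

/-- `ResWalk G x u v t`: the residual graph of `x` has a walk of length `t` from `u` to `v`. -/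
inductive ResWalk {n : ℕ} {Ψ : Type*} (G : CEGame n Ψ) (x : Profile n Ψ) (u : Node n Ψ) :
    Node n Ψ → ℝ → Prop where
  | nil : ResWalk G x u u 0
  | step {v w : Node n Ψ} {t : ℝ} : ResWalk G x u v t → 0 < G.resCap x v w →
      ResWalk G x u w (t + G.resLength v w)

/-- Shortest-path distance in the residual graph; `⊤` if there is no path. -/
noncomputable def dist {n : ℕ} {Ψ : Type*} (G : CEGame n Ψ) (x : Profile n Ψ)
    (u v : Node n Ψ) : EReal :=
  sInf {e : EReal | ∃ t : ℝ, ResWalk G x u v t ∧ e = (t : EReal)}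

/-- The rate `γ_v = e^{-dist(v)}` for distances from the site `ψ₀` (so `0` if unreachable). -/
noncomputable def rate {n : ℕ} {Ψ : Type*} (G : CEGame n Ψ) (x : Profile n Ψ) (ψ₀ : Ψ)
    (v : Node n Ψ) : ℝ :=
  (EReal.exp (-G.dist x (.site ψ₀) v)).toReal

/-! ### Increasing the catcher's allocation -/

/-- An open boundary site from which only open boundary sites are reachable. -/
def GoodSite {n : ℕ} {Ψ : Type*} (G : CEGame n Ψ) (x : Profile n Ψ) (ψ : Ψ) : Prop :=
  G.OpenBoundary x ψ ∧
    ∀ φ, G.dist x (.site ψ) (.site φ) < ⊤ → G.OpenBoundary x φ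

/-- The bounds whose minimum is the step length: the remaining resource of the catcher, the
limits of the catcher, and the inactive edges that would become active. -/
inductive StepBound {n : ℕ} {Ψ : Type*} [Fintype Ψ] (G : CEGame n Ψ) (x : Profile n Ψ)
    (ψ₀ : Ψ) : ℝ → Prop where
  | resource : StepBound G x ψ₀
      ((G.r 0 - ∑ ψ, x 0 ψ) / ∑ ψ, G.rate x ψ₀ (.site ψ))
  | limit (ψ : Ψ) : 0 < G.rate x ψ₀ (.site ψ) →
      StepBound G x ψ₀ ((G.lim 0 ψ - x 0 ψ) / G.rate x ψ₀ (.site ψ))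
  | inactive (i : Fin n) (ψ : Ψ) (t : ℝ) : G.IsEvaderThreshold x i t → G.mu x i.succ ψ ≠ t →
      0 < (G.mu x i.succ ψ - t) /
        (G.rate x ψ₀ (.site ψ) * (-G.d i.succ ψ) - G.rate x ψ₀ (.evader i)) →
      StepBound G x ψ₀ ((G.mu x i.succ ψ - t) /
        (G.rate x ψ₀ (.site ψ) * (-G.d i.succ ψ) - G.rate x ψ₀ (.evader i)))

/-- `y` is the outcome of a successful increase: the open boundary sites are scanned in the order
of `Ψ`, the first good site `ψ₀` is the starting point, the step length `Δ` is the least of all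
bounds, and each `x_{0,ψ}` grows by `Δ γ_ψ`. -/
def Increases {n : ℕ} {Ψ : Type*} [Fintype Ψ] [LinearOrder Ψ] (G : CEGame n Ψ)
    (x y : Profile n Ψ) : Prop :=
  ∃ (ψ₀ : Ψ) (Δ : ℝ), (G.GoodSite x ψ₀ ∧ ∀ φ < ψ₀, ¬ G.GoodSite x φ) ∧
    IsLeast {t : ℝ | StepBound G x ψ₀ t} Δ ∧
    (∀ ψ, y 0 ψ = x 0 ψ + Δ * G.rate x ψ₀ (.site ψ)) ∧
    ∀ i : Fin n, y i.succ = x i.succ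

/-- The attempt to increase the catcher's allocation fails. -/
def IncreaseFails {n : ℕ} {Ψ : Type*} (G : CEGame n Ψ) (x : Profile n Ψ) : Prop :=
  ∀ ψ, ¬ G.GoodSite x ψ

/-! ### Rerouting by a maximum flow -/

open Classical in
/-- Capacities of the rerouting network for the catcher's threshold `t` and its decrease `Δ`. -/
noncomputable def rerouteCap {n : ℕ} {Ψ : Type*} (G : CEGame n Ψ) (x : Profile n Ψ) (t Δ : ℝ) :
    Node n Ψ → Node n Ψ → EReal
  | .source, .site ψ => if G.OpenBoundary x ψ then ((Δ / G.d 0 ψ : ℝ) : EReal) else 0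
  | .site ψ, .sink =>
      if G.OpenBoundary x ψ then 0
      else if t ≤ G.mu x 0 ψ then ⊤
      else (((t - Δ - G.mu x 0 ψ) / G.d 0 ψ : ℝ) : EReal)
  | u, v => (G.resCap x u v : EReal)

/-- The rerouting network. -/
noncomputable def rerouteNetwork {n : ℕ} {Ψ : Type*} (G : CEGame n Ψ) (x : Profile n Ψ)
    (t Δ : ℝ) : FlowNetwork (Node n Ψ) where
  source := .source
  sink := .sink
  cap := G.rerouteCap x t Δ

/-- The values of `Δ` that are admitted in the search: `0 ≤ Δ ≤ min_{μ_{0,ψ} < θ_0} (θ_0 - μ_{0,ψ})`,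
and some maximum flow of the rerouting network saturates all edges leaving the source. -/
def rerouteSet {n : ℕ} {Ψ : Type*} [Fintype Ψ] (G : CEGame n Ψ) (x : Profile n Ψ) (t : ℝ) :
    Set ℝ :=
  {Δ | 0 ≤ Δ ∧ (∀ ψ, G.mu x 0 ψ < t → Δ ≤ t - G.mu x 0 ψ) ∧
    ∃ f, (G.rerouteNetwork x t Δ).IsMaxFlow f ∧ (G.rerouteNetwork x t Δ).SaturatesSource f}

/-- `y` is an outcome of the max-flow rerouting of `x`: a maximum flow for the greatest admitted
`Δ` is added to the evaders' allocation (net flow along each evader-site edge). -/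
def Reroutes {n : ℕ} {Ψ : Type*} [Fintype Ψ] (G : CEGame n Ψ) (x y : Profile n Ψ) : Prop :=
  ∃ (t Δ : ℝ) (f : Node n Ψ → Node n Ψ → ℝ), G.IsCatcherThreshold x t ∧
    IsGreatest (G.rerouteSet x t) Δ ∧ (G.rerouteNetwork x t Δ).IsMaxFlow f ∧ y 0 = x 0 ∧
    ∀ (i : Fin n) (ψ : Ψ),
      y i.succ ψ = x i.succ ψ + (f (.evader i) (.site ψ) - f (.site ψ) (.evader i))

/-! ### The main loop -/

/-- One pass through the body of the main loop: reallocation, then an increase of the catcher's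
allocation, or, if that fails, rerouting. -/
def Iteration {n : ℕ} {Ψ : Type*} [Fintype Ψ] [LinearOrder Ψ] (G : CEGame n Ψ)
    (x z : Profile n Ψ) : Prop :=
  ∃ y, G.Reallocates x y ∧ (G.Increases y z ∨ (G.IncreaseFails y ∧ G.Reroutes y z))

/-- The loop condition: the catcher has resource left. -/
def LoopCondition {n : ℕ} {Ψ : Type*} [Fintype Ψ] (G : CEGame n Ψ) (x : Profile n Ψ) : Prop :=
  ∑ ψ, x 0 ψ < G.r 0

/-- `X 0, …, X k` are the profiles at the loop head in a (partial) run of the algorithm with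
`k` iterations. The outcomes of the two flow subroutines are arbitrary optimal ones. -/
def IsRun {n : ℕ} {Ψ : Type*} [Fintype Ψ] [LinearOrder Ψ] (G : CEGame n Ψ)
    (X : ℕ → Profile n Ψ) (k : ℕ) : Prop :=
  G.IsInitial (X 0) ∧ ∀ j < k, G.LoopCondition (X j) ∧ G.Iteration (X j) (X (j + 1))

end CEGame

/-!
Write `γ_v` for the rates, `D = -d > 0` for the negated utility changes of the evaders, and call
the sign of `μ_{i,ψ} - θ_i` the *state* of the edge `(i, ψ)` (`edgeState`). All profiles are kept
in `Invariant`: no player gains by exchanging resource between two sites, which implies optimality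
since the utility is linear in the player's own strategy.

*One iteration.* A minimum-cost flow leaves no negative closed walk in the residual graph
(`Reallocates.realloc`), because a little flow could be pushed along such a walk, even one that
repeats edges. So distances are attained along tight edges (`reflTransGen_tight`), the rates of
active edges satisfy `γ_i ≤ D γ_ψ` where `x_{i,ψ} < ℓ` and `D γ_ψ ≤ γ_i` where `x_{i,ψ} > 0`, and
during an increase each `θ_i` falls with speed exactly `γ_i` (`IncreaseStep.thr_eq`), at most
until an inactive edge becomes active. Rerouting moves resource along active edges only, so edge
states stay the same; the largest `Δ` exists by compactness and is positive if the increase has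
failed (`exists_mem_rerouteSet_of_increaseFails`).

*Length of a run.* The set of sites with `μ_0 ≥ θ_0` and the set of sites filled by the catcher
only grow, so the sum of their cardinalities takes fewer than `2|Ψ|` values at loop heads. While
it is constant, the open boundary is constant, a rerouting is followed by an increase
(`Trace.not_increaseFails_succ`), and no two increases have the same edge states
(`Trace.edgeState_ne`). Together these give an injective labelling of the iterations
(`Trace.iterationLabel_ne`) and the bound.

*No repetition of edge states.* The set `R` that is reachable from a good site is closed under
residual edges, so its load is the least that the edge states permit (`sum_load_le_of_resClosed`).
Rerouting lowers the load of open boundary sites; hence none happens between two increases with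
the same states, and all loads stay constant. Reachability depends on states and loads only
(`reach_subset`). In the meantime good sites can only get lost (`Trace.goodSite_of_succ`), so all
increases start at the same site, and tight paths survive an increase, so `R` only grows
(`IncreaseStep.reach_subset`) and is constant. Outside `R` nothing has moved; on `R` the total
change of the `x_{0,ψ}` and `θ_i` respects the active edges and is therefore a multiple of the
first rates. But along this direction the edge that ended the first increase cannot return to its
previous side of the threshold.
-/

/-! ### Shortest walks -/

namespace CEGame

/-- A positive function on a finite type has a positive lower bound. -/
theorem exists_pos_forall_le {ι : Type*} [Finite ι] (f : ι → ℝ) (hf : ∀ i, 0 < f i) :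
    ∃ ε > 0, ∀ i, ε ≤ f i := by
  cases isEmpty_or_nonempty ι with
  | inl h => exact ⟨1, one_pos, fun i => h.elim i⟩
  | inr h =>
    obtain ⟨i, hi⟩ := Finite.exists_min f
    exact ⟨f i, hf i, hi⟩

/-- `Walk E len u v t`: the graph `E` has a walk of length `t` from `u` to `v`. -/
inductive Walk {V : Type*} (E : V → V → Prop) (len : V → V → ℝ) (u : V) : V → ℝ → Prop where
  | nil : Walk E len u u 0
  | step {v w : V} {t : ℝ} : Walk E len u v t → E v w → Walk E len u w (t + len v w)

namespace Walk

variable {V : Type*} {E : V → V → Prop} {len : V → V → ℝ} {u : V}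

theorem mono {E' : V → V → Prop} (h : ∀ v w, E v w → E' v w) {v : V} {t : ℝ}
    (hw : Walk E len u v t) : Walk E' len u v t := by
  induction hw with
  | nil => exact .nil
  | step _ e ih => exact ih.step (h _ _ e)

/-- A walk inside `S` consists of a closed walk at its start `u`, followed, unless it ends there,
by an edge and a walk that avoids `u`. -/
theorem split_last_visit [DecidableEq V] {S : Finset V} {L : ℝ}
    (hneg : ∀ u t, Walk E len u u t → 0 ≤ t) (hL : ∀ v w, -L ≤ len v w) {v : V} {t : ℝ}
    (hw : Walk (fun a b => E a b ∧ b ∈ S) len u v t) :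
    (v = u ∧ 0 ≤ t) ∨ ∃ w ∈ S.erase u, ∃ t',
      Walk (fun a b => E a b ∧ b ∈ S.erase u) len w v t' ∧ -L + t' ≤ t := by
  induction hw with
  | nil => exact .inl ⟨rfl, le_rfl⟩
  | @step v w t h e ih =>
    by_cases hwu : w = u
    · subst hwu
      exact .inl ⟨rfl, hneg _ _ ((h.step e).mono fun _ _ => And.left)⟩
    right
    have hmem : w ∈ S.erase u := Finset.mem_erase.2 ⟨hwu, e.2⟩
    rcases ih with ⟨rfl, ht⟩ | ⟨w', hw', t', hwalk, ht⟩
    · exact ⟨w, hmem, 0, .nil, by linarith [hL v w]⟩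
    · exact ⟨w', hw', t' + len v w, hwalk.step ⟨e.1, hmem⟩, by linarith⟩

/-- Each vertex of `S` is left for the last time at most once, and between these departures the
walk only makes closed walks, which have nonnegative length. -/
theorem lower_bound_aux [DecidableEq V] {L : ℝ} (hL0 : 0 ≤ L)
    (hneg : ∀ u t, Walk E len u u t → 0 ≤ t) (hL : ∀ v w, -L ≤ len v w) (m : ℕ) :
    ∀ (S : Finset V), S.card = m → ∀ u ∈ S, ∀ v t,
      Walk (fun a b => E a b ∧ b ∈ S) len u v t → -(m * L) ≤ t := by
  induction m with
  | zero =>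
    intro S hS u hu
    rw [Finset.card_eq_zero.1 hS] at hu
    simp at hu
  | succ m ih =>
    intro S hS u hu v t hw
    push_cast
    rcases split_last_visit hneg hL hw with ⟨_, ht⟩ | ⟨w, hwS, t', hw', ht⟩
    · nlinarith [mul_nonneg (Nat.cast_nonneg (α := ℝ) m) hL0]
    · have := ih (S.erase u) (by rw [Finset.card_erase_of_mem hu, hS]; rfl) w hwS v t' hw'
      linarith

/-- Without negative closed walks, the lengths of all walks are bounded below. -/
theorem exists_lower_bound [Finite V] (hneg : ∀ u t, Walk E len u u t → 0 ≤ t) :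
    ∃ M, ∀ u v t, Walk E len u v t → M ≤ t := by
  classical
  cases nonempty_fintype V
  obtain ⟨L, hL⟩ := (Set.finite_range fun p : V × V => -len p.1 p.2).bddAbove
  refine ⟨-(Fintype.card V * max L 0), fun u v t hw => ?_⟩
  refine lower_bound_aux (E := E) (le_max_right _ _) hneg (fun v w => ?_) _ Finset.univ rfl u
    (Finset.mem_univ _) v t (hw.mono fun _ _ h => ⟨h, Finset.mem_univ _⟩)
  have := hL (Set.mem_range_self (v, w))
  have := le_max_left L 0
  simp only at *
  linarith

end Walk

/-- The length of a shortest walk from `u` to `v` (a junk value if there is none). -/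
noncomputable def minLength {V : Type*} (E : V → V → Prop) (len : V → V → ℝ) (u v : V) : ℝ :=
  sInf {t | Walk E len u v t}

section MinLength

variable {V : Type*} [Finite V] {E : V → V → Prop} {len : V → V → ℝ} {u : V}

theorem minLength_le (hneg : ∀ u t, Walk E len u u t → 0 ≤ t) {v : V} {t : ℝ}
    (h : Walk E len u v t) : minLength E len u v ≤ t := by
  obtain ⟨M, hM⟩ := Walk.exists_lower_bound hneg
  exact csInf_le ⟨M, fun t ht => hM _ _ _ ht⟩ h

theorem minLength_self (hneg : ∀ u t, Walk E len u u t → 0 ≤ t) : minLength E len u u = 0 :=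
  le_antisymm (minLength_le hneg .nil) (le_csInf ⟨0, .nil⟩ fun _ ht => hneg _ _ ht)

theorem minLength_le_add (hneg : ∀ u t, Walk E len u u t → 0 ≤ t) {v w : V}
    (hv : ∃ t, Walk E len u v t) (e : E v w) :
    minLength E len u w ≤ minLength E len u v + len v w := by
  have : minLength E len u w - len v w ≤ minLength E len u v :=
    le_csInf hv fun t ht => by linarith [minLength_le hneg (Walk.step ht e)]
  linarith

/-- Every reachable vertex is reachable by tight edges only. Otherwise the finitely many edges
that leave the set of these vertices would have a common positive slack `ε`, and all walks that
end outside the set would be longer than the distance by at least `ε`. -/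
theorem reflTransGen_tight (hneg : ∀ u t, Walk E len u u t → 0 ≤ t) {v : V} {t : ℝ}
    (hv : Walk E len u v t) :
    Relation.ReflTransGen
      (fun a b => E a b ∧ minLength E len u b = minLength E len u a + len a b) u v := by
  classical
  set d := minLength E len u with hd
  set T : V → Prop := Relation.ReflTransGen (fun a b => E a b ∧ d b = d a + len a b) u with hT
  have hTreach : ∀ a, T a → ∃ t, Walk E len u a t := by
    intro a ha
    induction ha with
    | refl => exact ⟨0, .nil⟩
    | tail _ e ih => exact ⟨_, ih.choose_spec.step e.1⟩
  obtain ⟨ε, hε, hslack⟩ := exists_pos_forall_le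
    (fun p : V × V => if T p.1 ∧ ¬ T p.2 ∧ E p.1 p.2 then d p.1 + len p.1 p.2 - d p.2 else 1)
    (by
      rintro ⟨a, b⟩
      dsimp only
      split_ifs with h
      · have h1 := minLength_le_add hneg (hTreach a h.1) h.2.2
        have h2 : d b ≠ d a + len a b := fun hab => h.2.1 (h.1.tail ⟨h.2.2, hab⟩)
        have := lt_of_le_of_ne h1 h2
        linarith
      · exact one_pos)
  have key : ∀ w s, Walk E len u w s → ¬ T w → d w + ε ≤ s := by
    intro w s hw
    induction hw with
    | nil => exact fun h => (h .refl).elim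
    | @step a b s h e ih =>
      intro hb
      by_cases ha : T a
      · have := hslack (a, b)
        simp only [ha, hb, e, not_false_eq_true, and_self, if_true] at this
        linarith [minLength_le hneg h]
      · linarith [ih ha, minLength_le_add hneg ⟨_, h⟩ e]
  by_contra hvT
  have : d v + ε ≤ d v := le_csInf ⟨t, hv⟩ fun s hs => key v s hs hvT
  linarith

/-- The minimum in `minLength` is attained. -/
theorem walk_minLength (hneg : ∀ u t, Walk E len u u t → 0 ≤ t) {v : V} {t : ℝ}
    (hv : Walk E len u v t) : Walk E len u v (minLength E len u v) := by
  have h := reflTransGen_tight hneg hv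
  clear hv
  induction h with
  | refl => rw [minLength_self hneg]; exact .nil
  | tail _ e ih => rw [e.2]; exact ih.step e.1

end MinLength

/-! ### Rates -/

variable {n : ℕ} {Ψ : Type*} {G : CEGame n Ψ} {x : Profile n Ψ}

/-- The residual graph of `x` has no closed walk of negative length. -/
def NoNegativeCycle (G : CEGame n Ψ) (x : Profile n Ψ) : Prop :=
  ∀ u t, ResWalk G x u u t → 0 ≤ t

/-- The vertices that can be reached from the site `ψ₀` in the residual graph. -/
def Reach (G : CEGame n Ψ) (x : Profile n Ψ) (ψ₀ : Ψ) : Set (Node n Ψ) :=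
  {v | ∃ t, ResWalk G x (.site ψ₀) v t}

theorem resWalk_iff_walk {u v : Node n Ψ} {t : ℝ} :
    ResWalk G x u v t ↔ Walk (fun a b => 0 < G.resCap x a b) G.resLength u v t := by
  constructor
  · intro h
    induction h with
    | nil => exact .nil
    | step _ e ih => exact ih.step e
  · intro h
    induction h with
    | nil => exact .nil
    | step _ e ih => exact ih.step e

theorem mem_reach_self (ψ₀ : Ψ) : Node.site ψ₀ ∈ Reach G x ψ₀ := ⟨0, .nil⟩

theorem reach_step {ψ₀ : Ψ} {v w : Node n Ψ} (hv : v ∈ Reach G x ψ₀) (e : 0 < G.resCap x v w) :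
    w ∈ Reach G x ψ₀ :=
  ⟨_, hv.choose_spec.step e⟩

theorem dist_lt_top_iff {ψ₀ : Ψ} {v : Node n Ψ} :
    G.dist x (.site ψ₀) v < ⊤ ↔ v ∈ Reach G x ψ₀ := by
  unfold dist
  rw [sInf_lt_iff]
  constructor
  · rintro ⟨_, ⟨t, ht, _⟩, _⟩
    exact ⟨t, ht⟩
  · rintro ⟨t, ht⟩
    exact ⟨_, ⟨t, ht, rfl⟩, EReal.coe_lt_top t⟩

theorem rate_of_notMem {ψ₀ : Ψ} {v : Node n Ψ} (hv : v ∉ Reach G x ψ₀) : G.rate x ψ₀ v = 0 := by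
  have : G.dist x (.site ψ₀) v = ⊤ := by
    by_contra h
    exact hv (dist_lt_top_iff.1 (lt_top_iff_ne_top.2 h))
  simp [rate, this]

theorem rate_of_mem [Finite Ψ] (hx : NoNegativeCycle G x) {ψ₀ : Ψ} {v : Node n Ψ}
    (hv : v ∈ Reach G x ψ₀) :
    G.rate x ψ₀ v = Real.exp
      (-minLength (fun a b => 0 < G.resCap x a b) G.resLength (.site ψ₀) v) := by
  cases nonempty_fintype Ψ
  obtain ⟨t, ht⟩ := hv
  have hneg : ∀ u t, Walk (fun a b => 0 < G.resCap x a b) G.resLength u u t → 0 ≤ t :=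
    fun u t h => hx u t (resWalk_iff_walk.2 h)
  have : G.dist x (.site ψ₀) v =
      (minLength (fun a b => 0 < G.resCap x a b) G.resLength (.site ψ₀) v : ℝ) := by
    refine IsLeast.csInf_eq ⟨⟨_, resWalk_iff_walk.2
      (walk_minLength hneg (resWalk_iff_walk.1 ht)), rfl⟩, ?_⟩
    rintro _ ⟨s, hs, rfl⟩
    exact EReal.coe_le_coe_iff.2 (minLength_le hneg (resWalk_iff_walk.1 hs))
  rw [rate, this, ← EReal.coe_neg, EReal.exp_coe, ENNReal.toReal_ofReal (Real.exp_pos _).le]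

theorem rate_nonneg {ψ₀ : Ψ} {v : Node n Ψ} : 0 ≤ G.rate x ψ₀ v := ENNReal.toReal_nonneg

theorem rate_pos_iff [Finite Ψ] (hx : NoNegativeCycle G x) {ψ₀ : Ψ} {v : Node n Ψ} :
    0 < G.rate x ψ₀ v ↔ v ∈ Reach G x ψ₀ := by
  constructor
  · intro h
    by_contra hv
    rw [rate_of_notMem hv] at h
    exact lt_irrefl _ h
  · intro h
    rw [rate_of_mem hx h]
    exact Real.exp_pos _

theorem rate_self [Finite Ψ] (hx : NoNegativeCycle G x) {ψ₀ : Ψ} :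
    G.rate x ψ₀ (.site ψ₀) = 1 := by
  cases nonempty_fintype Ψ
  rw [rate_of_mem hx (mem_reach_self ψ₀),
    minLength_self fun u t h => hx u t (resWalk_iff_walk.2 h), neg_zero, Real.exp_zero]

/-- Along a residual edge the rate drops at most by the factor `e^{-length}`. -/
theorem rate_mul_exp_le [Finite Ψ] (hx : NoNegativeCycle G x) {ψ₀ : Ψ} {v w : Node n Ψ}
    (e : 0 < G.resCap x v w) :
    G.rate x ψ₀ v * Real.exp (-G.resLength v w) ≤ G.rate x ψ₀ w := by
  cases nonempty_fintype Ψ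
  by_cases hv : v ∈ Reach G x ψ₀
  · rw [rate_of_mem hx hv, rate_of_mem hx (reach_step hv e), ← Real.exp_add, Real.exp_le_exp]
    have hneg : ∀ u t, Walk (fun a b => 0 < G.resCap x a b) G.resLength u u t → 0 ≤ t :=
      fun u t h => hx u t (resWalk_iff_walk.2 h)
    have := minLength_le_add hneg ⟨_, resWalk_iff_walk.1 hv.choose_spec⟩ e
    linarith
  · rw [rate_of_notMem hv, zero_mul]
    exact rate_nonneg

/-- The residual edges along which the rate drops exactly by the factor `e^{-length}`. -/
def TightEdge (G : CEGame n Ψ) (x : Profile n Ψ) (ψ₀ : Ψ) (v w : Node n Ψ) : Prop :=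
  0 < G.resCap x v w ∧ G.rate x ψ₀ v * Real.exp (-G.resLength v w) = G.rate x ψ₀ w

theorem reach_reflTransGen_tightEdge [Finite Ψ] (hx : NoNegativeCycle G x) {ψ₀ : Ψ}
    {v : Node n Ψ} (hv : v ∈ Reach G x ψ₀) :
    Relation.ReflTransGen (TightEdge G x ψ₀) (.site ψ₀) v := by
  cases nonempty_fintype Ψ
  have hneg : ∀ u t, Walk (fun a b => 0 < G.resCap x a b) G.resLength u u t → 0 ≤ t :=
    fun u t h => hx u t (resWalk_iff_walk.2 h)
  have h := reflTransGen_tight hneg (resWalk_iff_walk.1 hv.choose_spec)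
  suffices v ∈ Reach G x ψ₀ ∧ Relation.ReflTransGen (TightEdge G x ψ₀) (.site ψ₀) v from this.2
  clear hv
  induction h with
  | refl => exact ⟨mem_reach_self ψ₀, .refl⟩
  | tail _ e ih =>
    have hw := reach_step ih.1 e.1
    refine ⟨hw, ih.2.tail ⟨e.1, ?_⟩⟩
    rw [rate_of_mem hx ih.1, rate_of_mem hx hw, e.2, ← Real.exp_add]
    congr 1
    ring

end CEGame

/-! ### Exchange conditions and equilibria -/

namespace CEGame

variable {n : ℕ} {Ψ : Type*} {G : CEGame n Ψ} {x y : Profile n Ψ}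

/-- The total resource of the evaders on the site `ψ`. -/
def load (x : Profile n Ψ) (ψ : Ψ) : ℝ := ∑ j : Fin n, x j.succ ψ

theorem sum_sub_eq_load_sub (x y : Profile n Ψ) (ψ : Ψ) :
    ∑ i : Fin n, (y i.succ ψ - x i.succ ψ) = load y ψ - load x ψ := by
  rw [Finset.sum_sub_distrib, load, load]

theorem mu_zero (ψ : Ψ) : G.mu x 0 ψ = G.b 0 ψ + G.d 0 ψ * load x ψ := by
  simp [mu, opp, load]

theorem mu_succ (i : Fin n) (ψ : Ψ) :
    G.mu x i.succ ψ = G.b i.succ ψ + G.d i.succ ψ * x 0 ψ := by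
  simp [mu, opp, Fin.succ_ne_zero]

/-- A linear function is maximal at a feasible point of a box with prescribed coordinate sum if
no exchange between two coordinates increases it. -/
theorem sum_mul_le_of_exchange [Fintype Ψ] {m s z l : Ψ → ℝ} (hs0 : ∀ ψ, 0 ≤ s ψ)
    (hsl : ∀ ψ, s ψ ≤ l ψ) (hz0 : ∀ ψ, 0 ≤ z ψ) (hzl : ∀ ψ, z ψ ≤ l ψ)
    (hsum : ∑ ψ, s ψ = ∑ ψ, z ψ)
    (hex : ∀ ψ φ, 0 < z ψ → z φ < l φ → m φ ≤ m ψ) :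
    ∑ ψ, m ψ * s ψ ≤ ∑ ψ, m ψ * z ψ := by
  obtain ⟨t, ht1, ht2⟩ : ∃ t, (∀ ψ, 0 < z ψ → t ≤ m ψ) ∧ ∀ ψ, z ψ < l ψ → m ψ ≤ t := by
    by_cases h : ∃ ψ, 0 < z ψ
    · obtain ⟨ψ, hψ⟩ := h
      obtain ⟨φ, hφ, hmin⟩ := Set.exists_min_image {ψ | 0 < z ψ} m (Set.toFinite _) ⟨ψ, hψ⟩
      exact ⟨m φ, hmin, fun ψ hlt => hex _ _ hφ hlt⟩
    · obtain ⟨t, ht⟩ := (Set.finite_range m).bddAbove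
      exact ⟨t, fun ψ hψ => (h ⟨ψ, hψ⟩).elim, fun ψ _ => ht ⟨ψ, rfl⟩⟩
  have key : ∑ ψ, (m ψ - t) * (s ψ - z ψ) ≤ 0 := by
    refine Finset.sum_nonpos fun ψ _ => ?_
    rcases lt_trichotomy (m ψ) t with h | h | h
    · have : z ψ = 0 := le_antisymm
        (not_lt.1 fun h' => (lt_of_lt_of_le h (ht1 ψ h')).false) (hz0 ψ)
      nlinarith [hs0 ψ]
    · simp [h]
    · have : z ψ = l ψ := le_antisymm (hzl ψ)
        (not_lt.1 fun h' => (lt_of_lt_of_le h (ht2 ψ h')).false)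
      nlinarith [hsl ψ]
  have : ∑ ψ, (m ψ - t) * (s ψ - z ψ)
      = ∑ ψ, m ψ * s ψ - ∑ ψ, m ψ * z ψ - t * (∑ ψ, s ψ - ∑ ψ, z ψ) := by
    simp only [Finset.mul_sum, ← Finset.sum_sub_distrib]
    exact Finset.sum_congr rfl fun ψ _ => by ring
  rw [this, hsum] at key
  linarith

/-- The invariant of the algorithm: strategies are feasible, except that the catcher may have
resource left, and no player gains by an exchange between two sites. -/
structure Invariant [Fintype Ψ] (G : CEGame n Ψ) (x : Profile n Ψ) : Prop where
  nonneg : ∀ i ψ, 0 ≤ x i ψ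
  le_lim : ∀ i ψ, x i ψ ≤ G.lim i ψ
  sum_evader : ∀ i : Fin n, ∑ ψ, x i.succ ψ = G.r i.succ
  sum_catcher : ∑ ψ, x 0 ψ ≤ G.r 0
  exchange : ∀ i ψ φ, 0 < x i ψ → x i φ < G.lim i φ → G.mu x i φ ≤ G.mu x i ψ

theorem Invariant.utility_le [Fintype Ψ] (hx : Invariant G x) (i : Fin (n + 1)) {s : Ψ → ℝ}
    (hs : ∀ ψ, 0 ≤ s ψ ∧ s ψ ≤ G.lim i ψ) (hsum : ∑ ψ, s ψ = ∑ ψ, x i ψ) :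
    G.utility (Function.update x i s) i ≤ G.utility x i := by
  have hopp : ∀ ψ, opp (Function.update x i s) i ψ = opp x i ψ := by
    intro ψ
    unfold opp
    split_ifs with h
    · subst h
      exact Finset.sum_congr rfl fun j _ => by
        rw [Function.update_of_ne (Fin.succ_ne_zero j)]
    · rw [Function.update_of_ne (Ne.symm h)]
  unfold utility
  simp only [hopp, Function.update_self, Finset.sum_add_distrib]
  gcongr ?_ + _ + _
  exact sum_mul_le_of_exchange (fun ψ => (hs ψ).1) (fun ψ => (hs ψ).2) (hx.nonneg i)
    (hx.le_lim i) hsum (hx.exchange i)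

theorem Invariant.isCurrentNash [Fintype Ψ] (hx : Invariant G x) : G.IsCurrentNash x := by
  intro i
  have hr : (G.withCatcherResource (∑ ψ, x 0 ψ)).r i = ∑ ψ, x i ψ := by
    refine Fin.cases ?_ (fun j => ?_) i
    · simp [withCatcherResource]
    · simp [withCatcherResource, hx.sum_evader j]
  refine ⟨⟨fun ψ => ⟨hx.nonneg i ψ, hx.le_lim i ψ⟩, hr.symm⟩, fun s hs => ?_⟩
  exact hx.utility_le i hs.1 (hs.2.trans hr)

theorem Invariant.isNash [Fintype Ψ] (hx : Invariant G x) (h : ¬ G.LoopCondition x) :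
    G.IsNash x := by
  intro i
  have hr : ∑ ψ, x i ψ = G.r i := by
    refine Fin.cases ?_ (fun j => hx.sum_evader j) i
    exact le_antisymm hx.sum_catcher (not_lt.1 h)
  exact ⟨⟨fun ψ => ⟨hx.nonneg i ψ, hx.le_lim i ψ⟩, hr⟩,
    fun s hs => hx.utility_le i hs.1 (hs.2.trans hr.symm)⟩

/-! ### Thresholds and edge states -/

/-- The threshold `θ_i` of the evader `i`, defined as an infimum (`0` if the evader has no
resource). -/
noncomputable def thr (G : CEGame n Ψ) (x : Profile n Ψ) (i : Fin n) : ℝ :=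
  sInf {m : ℝ | ∃ ψ, 0 < x i.succ ψ ∧ m = G.mu x i.succ ψ}

theorem isEvaderThreshold_thr [Finite Ψ] {i : Fin n} (h : ∃ ψ, 0 < x i.succ ψ) :
    G.IsEvaderThreshold x i (G.thr x i) := by
  obtain ⟨ψ, hψ⟩ := h
  obtain ⟨φ, hφ, hmin⟩ := Set.exists_min_image {ψ | 0 < x i.succ ψ} (G.mu x i.succ)
    (Set.toFinite _) ⟨ψ, hψ⟩
  have : IsLeast {m : ℝ | ∃ ψ, 0 < x i.succ ψ ∧ m = G.mu x i.succ ψ} (G.mu x i.succ φ) := by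
    refine ⟨⟨φ, hφ, rfl⟩, ?_⟩
    rintro _ ⟨ψ, hψ, rfl⟩
    exact hmin ψ hψ
  rw [thr, this.csInf_eq]
  exact this

theorem isEvaderThreshold_iff [Finite Ψ] {i : Fin n} {t : ℝ} :
    G.IsEvaderThreshold x i t ↔ (∃ ψ, 0 < x i.succ ψ) ∧ t = G.thr x i := by
  constructor
  · intro h
    obtain ⟨ψ, hψ, _⟩ := h.1
    exact ⟨⟨ψ, hψ⟩, h.unique (isEvaderThreshold_thr ⟨ψ, hψ⟩)⟩
  · rintro ⟨h, rfl⟩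
    exact isEvaderThreshold_thr h

theorem active_iff [Finite Ψ] {i : Fin n} {ψ : Ψ} :
    G.Active x i ψ ↔ (∃ ψ, 0 < x i.succ ψ) ∧ G.mu x i.succ ψ = G.thr x i :=
  isEvaderThreshold_iff

theorem exists_mu_eq_thr [Finite Ψ] {i : Fin n} (h : ∃ ψ, 0 < x i.succ ψ) :
    ∃ ψ, 0 < x i.succ ψ ∧ G.mu x i.succ ψ = G.thr x i := by
  obtain ⟨ψ, hψ, h⟩ := (isEvaderThreshold_thr (G := G) h).1
  exact ⟨ψ, hψ, h.symm⟩

theorem thr_le_mu [Finite Ψ] {i : Fin n} {ψ : Ψ} (h : 0 < x i.succ ψ) :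
    G.thr x i ≤ G.mu x i.succ ψ :=
  (isEvaderThreshold_thr ⟨ψ, h⟩).2 ⟨ψ, h, rfl⟩

theorem Invariant.mu_le_thr [Fintype Ψ] (hx : Invariant G x) {i : Fin n} {ψ : Ψ}
    (hpos : ∃ ψ, 0 < x i.succ ψ) (h : x i.succ ψ < G.lim i.succ ψ) :
    G.mu x i.succ ψ ≤ G.thr x i := by
  obtain ⟨φ, hφ, he⟩ := exists_mu_eq_thr (G := G) hpos
  exact he ▸ hx.exchange _ _ _ hφ h

theorem Invariant.exists_pos_iff [Fintype Ψ] (hx : Invariant G x) (i : Fin n) :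
    (∃ ψ, 0 < x i.succ ψ) ↔ 0 < G.r i.succ := by
  rw [← hx.sum_evader i, Finset.sum_pos_iff_of_nonneg fun ψ _ => hx.nonneg _ ψ]
  simp

open Classical in
/-- The position of `μ_{i,ψ}` relative to the threshold of the evader `i`: `0` on active edges,
`1` above and `-1` below the threshold (and `-1` for an evader without resource). -/
noncomputable def edgeState (G : CEGame n Ψ) (x : Profile n Ψ) (i : Fin n) (ψ : Ψ) : SignType :=
  if ∃ ψ, 0 < x i.succ ψ then SignType.sign (G.mu x i.succ ψ - G.thr x i) else -1

theorem active_iff_edgeState [Finite Ψ] {i : Fin n} {ψ : Ψ} :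
    G.Active x i ψ ↔ G.edgeState x i ψ = 0 := by
  rw [active_iff, edgeState]
  split_ifs with h
  · rw [sign_eq_zero_iff, sub_eq_zero]
    exact and_iff_right h
  · simp [h]

/-- On inactive edges the allocation is determined by the edge state: it is the limit above the
threshold and `0` below. -/
theorem Invariant.eq_of_edgeState [Fintype Ψ] (hx : Invariant G x) (hy : Invariant G y)
    (hS : G.edgeState x = G.edgeState y) {i : Fin n} {ψ : Ψ} (h : ¬ G.Active x i ψ) :
    x i.succ ψ = y i.succ ψ := by
  have key : ∀ {z : Profile n Ψ}, Invariant G z →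
      (G.edgeState z i ψ = 1 → z i.succ ψ = G.lim i.succ ψ) ∧
      (G.edgeState z i ψ = -1 → z i.succ ψ = 0) := by
    intro z hz
    unfold edgeState
    split_ifs with hp
    · rw [sign_eq_one_iff, sign_eq_neg_one_iff]
      refine ⟨fun h => le_antisymm (hz.le_lim _ _) (not_lt.1 fun hlt => ?_),
        fun h => le_antisymm (not_lt.1 fun hlt => ?_) (hz.nonneg _ _)⟩
      · linarith [hz.mu_le_thr hp hlt]
      · linarith [thr_le_mu (G := G) hlt]
    · refine ⟨fun h => by simp at h, fun _ => le_antisymm (not_lt.1 fun hlt => ?_)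
        (hz.nonneg _ _)⟩
      exact hp ⟨ψ, hlt⟩
  rw [active_iff_edgeState] at h
  have hS' := congrFun (congrFun hS i) ψ
  rcases hs : G.edgeState x i ψ with _ | _ | _
  · exact (h hs).elim
  · rw [(key hx).2 hs, (key hy).2 (hS' ▸ hs)]
  · rw [(key hx).1 hs, (key hy).1 (hS' ▸ hs)]

/-- A change of the evaders' allocation along active edges within the limits. -/
structure ActiveMove [Fintype Ψ] (G : CEGame n Ψ) (x y : Profile n Ψ) : Prop where
  catcher : y 0 = x 0
  nonneg : ∀ (i : Fin n) ψ, 0 ≤ y i.succ ψ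
  le_lim : ∀ (i : Fin n) ψ, y i.succ ψ ≤ G.lim i.succ ψ
  inactive : ∀ (i : Fin n) ψ, ¬ G.Active x i ψ → y i.succ ψ = x i.succ ψ
  sum_eq : ∀ i : Fin n, ∑ ψ, y i.succ ψ = ∑ ψ, x i.succ ψ

namespace ActiveMove

variable [Fintype Ψ]

theorem mu_succ_eq (h : ActiveMove G x y) (i : Fin n) (ψ : Ψ) :
    G.mu y i.succ ψ = G.mu x i.succ ψ := by
  rw [mu_succ, mu_succ, h.catcher]

theorem exists_pos_iff (h : ActiveMove G x y) (hx : Invariant G x) (i : Fin n) :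
    (∃ ψ, 0 < y i.succ ψ) ↔ ∃ ψ, 0 < x i.succ ψ := by
  rw [hx.exists_pos_iff, ← hx.sum_evader i, ← h.sum_eq i,
    Finset.sum_pos_iff_of_nonneg fun ψ _ => h.nonneg _ ψ]
  simp

/-- The threshold survives because each evader keeps its total on the active edges, which is
positive. -/
theorem thr_eq (h : ActiveMove G x y) (hx : Invariant G x) (i : Fin n) :
    G.thr y i = G.thr x i := by
  by_cases hp : ∃ ψ, 0 < x i.succ ψ
  · have hact : ∃ ψ, G.Active x i ψ ∧ 0 < y i.succ ψ := by
      by_contra! hno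
      obtain ⟨φ, hφ, hmu⟩ := exists_mu_eq_thr (G := G) hp
      have hle : ∀ ψ, y i.succ ψ ≤ x i.succ ψ := fun ψ => by
        by_cases ha : G.Active x i ψ
        · exact (hno ψ ha).trans (hx.nonneg _ _)
        · exact (h.inactive i ψ ha).le
      have : ∑ ψ, y i.succ ψ < ∑ ψ, x i.succ ψ :=
        Finset.sum_lt_sum (fun ψ _ => hle ψ)
          ⟨φ, Finset.mem_univ _, (hno φ (active_iff.2 ⟨hp, hmu⟩)).trans_lt hφ⟩
      exact this.ne (h.sum_eq i)
    have : G.IsEvaderThreshold y i (G.thr x i) := by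
      obtain ⟨ψ, ha, hy⟩ := hact
      refine ⟨⟨ψ, hy, ?_⟩, ?_⟩
      · rw [h.mu_succ_eq, (active_iff.1 ha).2]
      · rintro _ ⟨φ, hφ, rfl⟩
        rw [h.mu_succ_eq]
        by_cases ha : G.Active x i φ
        · exact (active_iff.1 ha).2.ge
        · rw [h.inactive i φ ha] at hφ
          exact thr_le_mu hφ
    exact (isEvaderThreshold_iff.1 this).2.symm
  · have hp' := mt (h.exists_pos_iff hx i).1 hp
    rw [not_exists] at hp hp'
    simp [thr, hp, hp']

theorem edgeState_eq (h : ActiveMove G x y) (hx : Invariant G x) :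
    G.edgeState y = G.edgeState x := by
  funext i ψ
  unfold edgeState
  rw [h.thr_eq hx, h.mu_succ_eq]
  have hiff := h.exists_pos_iff hx i
  split_ifs with h1 h2 h2
  · rfl
  · exact (h2 (hiff.1 h1)).elim
  · exact (h1 (hiff.2 h2)).elim
  · rfl

theorem exchange (h : ActiveMove G x y) (hx : Invariant G x) (i : Fin n) (ψ φ : Ψ)
    (hψ : 0 < y i.succ ψ) (hφ : y i.succ φ < G.lim i.succ φ) :
    G.mu y i.succ φ ≤ G.mu y i.succ ψ := by
  have hp := (h.exists_pos_iff hx i).1 ⟨ψ, hψ⟩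
  refine le_trans (b := G.thr x i) ?_ ((h.thr_eq hx i).symm.trans_le (thr_le_mu hψ))
  rw [h.mu_succ_eq]
  by_cases ha : G.Active x i φ
  · exact (active_iff.1 ha).2.le
  · rw [h.inactive i φ ha] at hφ
    exact hx.mu_le_thr hp hφ

/-- The evaders' exchange conditions are kept automatically; those of the catcher depend on how
the loads have changed. -/
theorem invariant (h : ActiveMove G x y) (hx : Invariant G x)
    (hex : ∀ ψ φ, 0 < x 0 ψ → x 0 φ < G.lim 0 φ → G.mu y 0 φ ≤ G.mu y 0 ψ) :
    Invariant G y where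
  nonneg i ψ := Fin.cases (h.catcher ▸ hx.nonneg 0 ψ) (fun j => h.nonneg j ψ) i
  le_lim i ψ := Fin.cases (h.catcher ▸ hx.le_lim 0 ψ) (fun j => h.le_lim j ψ) i
  sum_evader i := (h.sum_eq i).trans (hx.sum_evader i)
  sum_catcher := by rw [h.catcher]; exact hx.sum_catcher
  exchange i := by
    refine Fin.cases ?_ (fun j => h.exchange hx j) i
    rw [h.catcher]
    exact hex

end ActiveMove

/-! ### The initial profile -/

section Greedy

variable [Fintype Ψ] [DecidableEq Ψ]

theorem sum_update_of_eq_zero {s : Ψ → ℝ} {ψ : Ψ} (hs : s ψ = 0) (a : ℝ) :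
    ∑ φ, Function.update s ψ a φ = ∑ φ, s φ + a := by
  rw [Finset.sum_update_of_mem (Finset.mem_univ ψ),
    ← Finset.add_sum_erase _ s (Finset.mem_univ ψ), hs, Finset.sdiff_singleton_eq_erase]
  ring

theorem greedyFill_of_notMem {l : Ψ → ℝ} {r : ℝ} (L : List Ψ) (s : Ψ → ℝ) {ψ : Ψ}
    (h : ψ ∉ L) : greedyFill l r L s ψ = s ψ := by
  induction L generalizing s with
  | nil => rfl
  | cons φ L ih =>
    rw [List.mem_cons, not_or] at h
    rw [greedyFill, ih _ h.2, Function.update_of_ne h.1]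

/-- The properties of greedy filling, in a form that can be proved by induction on the list: limits
and resource are respected, all resource is used unless every site of the list is full, and
a site gets something only if all earlier ones are full. -/
theorem greedyFill_spec {l : Ψ → ℝ} {r : ℝ} (hl : ∀ ψ, 0 ≤ l ψ) (L : List Ψ) (s : Ψ → ℝ)
    (hnd : L.Nodup) (hs : ∀ ψ ∈ L, s ψ = 0) (hsr : ∑ ψ, s ψ ≤ r) :
    (∀ ψ ∈ L, 0 ≤ greedyFill l r L s ψ ∧ greedyFill l r L s ψ ≤ l ψ) ∧
      ∑ ψ, greedyFill l r L s ψ ≤ r ∧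
      ((∃ ψ ∈ L, greedyFill l r L s ψ < l ψ) → ∑ ψ, greedyFill l r L s ψ = r) ∧
      (∑ ψ, s ψ = r → ∀ ψ ∈ L, greedyFill l r L s ψ = 0) ∧
      L.Pairwise fun ψ φ => 0 < greedyFill l r L s φ → greedyFill l r L s ψ = l ψ := by
  induction L generalizing s with
  | nil => simpa [greedyFill] using hsr
  | cons ψ L ih =>
    rw [List.nodup_cons] at hnd
    have h0 : s ψ = 0 := hs ψ (by simp)
    set a := min (l ψ) (r - ∑ φ, s φ) with ha
    have ha0 : 0 ≤ a := le_min (hl ψ) (by linarith)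
    have hal : a ≤ l ψ := min_le_left _ _
    have har : a ≤ r - ∑ φ, s φ := min_le_right _ _
    have hsum := sum_update_of_eq_zero h0 a
    obtain ⟨h1, h2, h3, h4, h5⟩ := ih (Function.update s ψ a) hnd.2
      (fun φ hφ => by
        rw [Function.update_of_ne (ne_of_mem_of_not_mem hφ hnd.1)]
        exact hs φ (List.mem_cons_of_mem _ hφ))
      (by rw [hsum]; linarith)
    have hval : greedyFill l r (ψ :: L) s = greedyFill l r L (Function.update s ψ a) := rfl
    have hψ : greedyFill l r L (Function.update s ψ a) ψ = a := by
      rw [greedyFill_of_notMem L _ hnd.1, Function.update_self]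
    rw [hval]
    have hfull : a < l ψ → ∑ φ, Function.update s ψ a φ = r := by
      intro hlt
      rw [hsum]
      rcases min_choice (l ψ) (r - ∑ φ, s φ) with h | h
      · exact absurd (ha.trans h) hlt.ne
      · rw [ha, h]; ring
    have hsum' : ∑ φ, Function.update s ψ a φ = r →
        ∑ φ, greedyFill l r L (Function.update s ψ a) φ = r := by
      intro h
      refine Eq.trans ?_ h
      refine Finset.sum_congr rfl fun φ _ => ?_
      by_cases hφ : φ ∈ L
      · rw [h4 h φ hφ, Function.update_of_ne (ne_of_mem_of_not_mem hφ hnd.1),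
          hs φ (List.mem_cons_of_mem _ hφ)]
      · exact greedyFill_of_notMem L _ hφ
    refine ⟨?_, h2, ?_, ?_, ?_⟩
    · intro φ hφ
      rcases List.mem_cons.1 hφ with rfl | hφ
      · rw [hψ]; exact ⟨ha0, hal⟩
      · exact h1 φ hφ
    · rintro ⟨φ, hφ, hlt⟩
      rcases List.mem_cons.1 hφ with rfl | hφ
      · rw [hψ] at hlt
        exact hsum' (hfull hlt)
      · exact h3 ⟨φ, hφ, hlt⟩
    · intro hr φ hφ
      have ha' : a = 0 := le_antisymm (by linarith) ha0
      rcases List.mem_cons.1 hφ with rfl | hφ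
      · rw [hψ, ha']
      · exact h4 (by rw [hsum, ha', hr, add_zero]) φ hφ
    · refine List.pairwise_cons.2 ⟨fun φ hφ hpos => ?_, h5⟩
      rw [hψ]
      by_contra hne
      rw [h4 (hfull (lt_of_le_of_ne hal hne)) φ hφ] at hpos
      exact lt_irrefl _ hpos

theorem exists_isInitial (G : CEGame n Ψ) : ∃ x, G.IsInitial x := by
  classical
  have hL : ∀ i : Fin n, ∃ L : List Ψ, L.Nodup ∧ (∀ ψ, ψ ∈ L) ∧
      L.Pairwise (fun ψ φ => G.b i.succ φ ≤ G.b i.succ ψ) := by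
    intro i
    let R : Ψ → Ψ → Prop := fun ψ φ => G.b i.succ φ ≤ G.b i.succ ψ
    have : Std.Total R := ⟨fun ψ φ => le_total _ _⟩
    have : IsTrans Ψ R := ⟨fun _ _ _ h1 h2 => le_trans (b := G.b i.succ _) h2 h1⟩
    have hp := List.perm_insertionSort R (Finset.univ : Finset Ψ).toList
    refine ⟨List.insertionSort R (Finset.univ : Finset Ψ).toList,
      hp.nodup_iff.2 (Finset.nodup_toList _), fun ψ => hp.mem_iff.2 (by simp), ?_⟩
    exact List.pairwise_insertionSort R _
  choose L h1 h2 h3 using hL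
  exact ⟨Fin.cons (fun _ => 0) fun i => greedyFill (G.lim i.succ) (G.r i.succ) (L i) fun _ => 0,
    fun ψ => rfl, fun i => ⟨L i, h1 i, h2 i, h3 i, rfl⟩⟩

theorem IsInitial.invariant (hG : G.Valid) (hx : G.IsInitial x) : Invariant G x := by
  have hev : ∀ i : Fin n, (∀ ψ, 0 ≤ x i.succ ψ ∧ x i.succ ψ ≤ G.lim i.succ ψ) ∧
      ∑ ψ, x i.succ ψ = G.r i.succ ∧
      ∀ ψ φ, 0 < x i.succ ψ → x i.succ φ < G.lim i.succ φ → G.b i.succ φ ≤ G.b i.succ ψ := by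
    intro i
    obtain ⟨L, hnd, hmem, hsort, he⟩ := hx.2 i
    obtain ⟨h1, h2, h3, -, h5⟩ := greedyFill_spec (r := G.r i.succ) (hG.lim_nonneg i.succ) L
      (fun _ => 0) hnd (fun _ _ => rfl) (by simpa using hG.r_nonneg i.succ)
    rw [← he] at h1 h2 h3 h5
    refine ⟨fun ψ => h1 ψ (hmem ψ), ?_, fun ψ φ hψ hφ => ?_⟩
    · by_cases hlt : ∃ ψ ∈ L, x i.succ ψ < G.lim i.succ ψ
      · exact h3 hlt
      · push Not at hlt
        exact le_antisymm h2 ((hG.r_le i.succ).trans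
          (Finset.sum_le_sum fun ψ _ => hlt ψ (hmem ψ)))
    · have hpair := hsort.and h5
      refine List.Pairwise.forall_of_forall_of_flip
        (R := fun ψ φ => 0 < x i.succ ψ → x i.succ φ < G.lim i.succ φ →
          G.b i.succ φ ≤ G.b i.succ ψ) (fun _ _ _ _ => le_rfl)
        (hpair.imp fun h _ _ => h.1) (hpair.imp fun h h1 h2 => ?_) (hmem ψ) (hmem φ) hψ hφ
      exact absurd (h.2 h1) h2.ne
  refine ⟨fun i ψ => ?_, fun i ψ => ?_, fun i => (hev i).2.1, ?_, fun i => ?_⟩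
  · exact Fin.cases (hx.1 ψ).ge (fun j => ((hev j).1 ψ).1) i
  · exact Fin.cases ((hx.1 ψ).trans_le (hG.lim_nonneg 0 ψ)) (fun j => ((hev j).1 ψ).2) i
  · simpa [hx.1] using hG.r_nonneg 0
  · refine Fin.cases (fun ψ φ h => ?_) (fun j ψ φ h1 h2 => ?_) i
    · rw [hx.1 ψ] at h
      exact (lt_irrefl _ h).elim
    · simpa [mu_succ, hx.1] using (hev j).2.2 ψ φ h1 h2

end Greedy

end CEGame

/-! ### Flow matrices -/

namespace CEGame

variable {n : ℕ} {Ψ : Type*} {G : CEGame n Ψ} {x y : Profile n Ψ}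

/-- The vertices as a disjoint union. -/
def nodeEquiv (n : ℕ) (Ψ : Type*) : Node n Ψ ≃ (Unit ⊕ Fin n) ⊕ (Ψ ⊕ Unit) where
  toFun
    | .source => .inl (.inl ())
    | .evader i => .inl (.inr i)
    | .site ψ => .inr (.inl ψ)
    | .sink => .inr (.inr ())
  invFun
    | .inl (.inl ()) => .source
    | .inl (.inr i) => .evader i
    | .inr (.inl ψ) => .site ψ
    | .inr (.inr ()) => .sink
  left_inv v := by cases v <;> rfl
  right_inv v := by rcases v with (_ | _) | (_ | _) <;> rfl

theorem sum_node [Fintype Ψ] (f : Node n Ψ → ℝ) :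
    ∑ v, f v = f .source + ∑ i, f (.evader i) + (∑ ψ, f (.site ψ) + f .sink) := by
  rw [← (nodeEquiv n Ψ).symm.sum_comp f, Fintype.sum_sum_type, Fintype.sum_sum_type,
    Fintype.sum_sum_type]
  simp [nodeEquiv]

theorem resCap_evader_site_pos {i : Fin n} {ψ : Ψ} :
    0 < G.resCap x (.evader i) (.site ψ) ↔ G.Active x i ψ ∧ x i.succ ψ < G.lim i.succ ψ := by
  simp only [resCap]
  split_ifs with h <;> simp [h]

theorem resCap_site_evader_pos {i : Fin n} {ψ : Ψ} :
    0 < G.resCap x (.site ψ) (.evader i) ↔ G.Active x i ψ ∧ 0 < x i.succ ψ := by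
  simp only [resCap]
  split_ifs with h <;> simp [h]

/-- A residual edge joins an evader and a site. -/
theorem resCap_pos_cases {v w : Node n Ψ} (h : 0 < G.resCap x v w) :
    ∃ i ψ, (v = .evader i ∧ w = .site ψ) ∨ (v = .site ψ ∧ w = .evader i) := by
  rcases v with _ | i | ψ | _ <;> rcases w with _ | j | φ | _ <;>
    first
    | exact ⟨_, _, .inl ⟨rfl, rfl⟩⟩
    | exact ⟨_, _, .inr ⟨rfl, rfl⟩⟩
    | exact (lt_irrefl _ h).elim

theorem sum_single_row [Fintype Ψ] [DecidableEq Ψ] (i a : Fin n) (ψ : Ψ) :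
    ∑ b, (if a = i ∧ b = ψ then (1 : ℝ) else 0) = if a = i then 1 else 0 := by
  by_cases h : a = i <;> simp [h]

theorem sum_single_col [DecidableEq Ψ] (i : Fin n) (ψ b : Ψ) :
    ∑ a, (if a = i ∧ b = ψ then (1 : ℝ) else 0) = if b = ψ then 1 else 0 := by
  by_cases h : b = ψ <;> simp [h]

theorem sum_single_mul [Fintype Ψ] [DecidableEq Ψ] (i : Fin n) (ψ : Ψ) (w : Fin n → Ψ → ℝ) :
    ∑ a, ∑ b, (if a = i ∧ b = ψ then (1 : ℝ) else 0) * w a b = w i ψ := by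
  simp [ite_and]

/-- The matrix `N` of net changes has residual capacity for all its entries. -/
def Pushable (G : CEGame n Ψ) (x : Profile n Ψ) (N : Fin n → Ψ → ℝ) : Prop :=
  ∀ i ψ, (0 < N i ψ → 0 < G.resCap x (.evader i) (.site ψ)) ∧
    (N i ψ < 0 → 0 < G.resCap x (.site ψ) (.evader i))

open Classical in
/-- A residual walk, which may repeat edges, gives a matrix of net changes of one unit along the
walk. -/
theorem exists_matrix_of_resWalk [Fintype Ψ] {u v : Node n Ψ} {t : ℝ} (h : ResWalk G x u v t) :
    ∃ N : Fin n → Ψ → ℝ, Pushable G x N ∧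
      (∀ i, ∑ ψ, N i ψ =
        (if u = .evader i then 1 else 0) - (if v = .evader i then 1 else 0)) ∧
      (∀ ψ, ∑ i, N i ψ =
        (if v = .site ψ then 1 else 0) - (if u = .site ψ then 1 else 0)) ∧
      ∑ i, ∑ ψ, N i ψ * Real.log (-G.d i.succ ψ) = t := by
  induction h with
  | nil => exact ⟨0, fun i ψ => by simp, fun i => by simp, fun ψ => by simp, by simp⟩
  | @step v w t h e ih =>
    obtain ⟨N, h1, h2, h3, h4⟩ := ih
    obtain ⟨i, ψ, ⟨rfl, rfl⟩ | ⟨rfl, rfl⟩⟩ := resCap_pos_cases e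
    · refine ⟨fun a b => N a b + if a = i ∧ b = ψ then 1 else 0, fun a b => ?_, fun a => ?_,
        fun b => ?_, ?_⟩
      · by_cases hab : a = i ∧ b = ψ
        · obtain ⟨rfl, rfl⟩ := hab
          refine ⟨fun _ => e, fun hneg => (h1 a b).2 ?_⟩
          simp only [and_self, if_true] at hneg
          linarith
        · simp only [hab, if_false, add_zero]
          exact h1 a b
      · rw [Finset.sum_add_distrib, h2, sum_single_row]
        simp only [Node.evader.injEq, reduceCtorEq, if_false, eq_comm]
        ring
      · rw [Finset.sum_add_distrib, h3, sum_single_col]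
        simp only [Node.site.injEq, reduceCtorEq, if_false, eq_comm]
        ring
      · simp only [add_mul, Finset.sum_add_distrib, h4, sum_single_mul]
        rfl
    · refine ⟨fun a b => N a b - if a = i ∧ b = ψ then 1 else 0, fun a b => ?_, fun a => ?_,
        fun b => ?_, ?_⟩
      · by_cases hab : a = i ∧ b = ψ
        · obtain ⟨rfl, rfl⟩ := hab
          refine ⟨fun hpos => (h1 a b).1 ?_, fun _ => e⟩
          simp only [and_self, if_true] at hpos
          linarith
        · simp only [hab, if_false, sub_zero]
          exact h1 a b
      · rw [Finset.sum_sub_distrib, h2, sum_single_row]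
        simp only [Node.evader.injEq, reduceCtorEq, if_false, eq_comm]
        ring
      · rw [Finset.sum_sub_distrib, h3, sum_single_col]
        simp only [Node.site.injEq, reduceCtorEq, if_false, eq_comm]
        ring
      · simp only [sub_mul, Finset.sum_sub_distrib, h4, sum_single_mul]
        rfl

theorem Pushable.eq_zero {N : Fin n → Ψ → ℝ} (hN : Pushable G x N) {i : Fin n} {ψ : Ψ}
    (h : ¬ G.Active x i ψ) : N i ψ = 0 := by
  by_contra hne
  rcases lt_or_gt_of_ne hne with hlt | hlt
  · exact h (resCap_site_evader_pos.1 ((hN i ψ).2 hlt)).1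
  · exact h (resCap_evader_site_pos.1 ((hN i ψ).1 hlt)).1

/-- Some positive multiple of a pushable matrix respects the limits. -/
theorem Pushable.exists_pos [Fintype Ψ] {N : Fin n → Ψ → ℝ} (hN : Pushable G x N)
    (hx : Invariant G x) :
    ∃ ε > 0, ∀ δ, 0 ≤ δ → δ ≤ ε → ∀ i ψ,
      0 ≤ x i.succ ψ + δ * N i ψ ∧ x i.succ ψ + δ * N i ψ ≤ G.lim i.succ ψ := by
  obtain ⟨ε, hε, h⟩ := exists_pos_forall_le
    (fun p : Fin n × Ψ => if 0 < N p.1 p.2 then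
        (G.lim p.1.succ p.2 - x p.1.succ p.2) / N p.1 p.2
      else if N p.1 p.2 < 0 then x p.1.succ p.2 / -N p.1 p.2 else 1)
    (by
      rintro ⟨i, ψ⟩
      dsimp only
      split_ifs with h1 h2
      · exact div_pos (sub_pos.2 (resCap_evader_site_pos.1 ((hN i ψ).1 h1)).2) h1
      · exact div_pos (resCap_site_evader_pos.1 ((hN i ψ).2 h2)).2 (neg_pos.2 h2)
      · exact one_pos)
  refine ⟨ε, hε, fun δ hδ0 hδ i ψ => ?_⟩
  have h0 := hx.nonneg i.succ ψ
  have h1 := hx.le_lim i.succ ψ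
  have := hδ.trans (h (i, ψ))
  dsimp only at this
  split_ifs at this with hp hq
  · rw [le_div_iff₀ hp] at this
    have := mul_nonneg hδ0 hp.le
    constructor <;> linarith
  · rw [le_div_iff₀ (neg_pos.2 hq)] at this
    have := mul_nonneg hδ0 (neg_pos.2 hq).le
    constructor <;> linarith
  · have : N i ψ = 0 := le_antisymm (not_lt.1 hp) (not_lt.1 hq)
    simp [this, h0, h1]

/-! ### Reallocation -/

theorem FlowNetwork.IsFlow.eq_zero {V : Type*} [Fintype V] {N : FlowNetwork V} {f : V → V → ℝ}
    (hf : N.IsFlow f) {u v : V} (h : N.cap u v = 0) : f u v = 0 :=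
  le_antisymm (by have := (hf.1 u v).2; rw [h] at this; exact_mod_cast this) (hf.1 u v).1

/-- With finite capacities, minimum-cost maximum flows exist by compactness. -/
theorem FlowNetwork.exists_isMinCostMaxFlow {V : Type*} [Fintype V] (N : FlowNetwork V)
    (c : V → V → ℝ) (hc : ∀ u v, N.cap u v = c u v) (hc0 : ∀ u v, 0 ≤ c u v) (w : V → V → ℝ) :
    ∃ f, N.IsMinCostMaxFlow w f := by
  have hset : {f | N.IsFlow f} = Set.Icc 0 c ∩
      ⋂ v : V, {f | v ≠ N.source → v ≠ N.sink → ∑ u, f u v = ∑ u, f v u} := by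
    ext f
    simp only [FlowNetwork.IsFlow, hc, EReal.coe_le_coe_iff, Set.mem_ofPred_eq, Set.mem_inter_iff,
      Set.mem_Icc, Set.mem_iInter, Pi.le_def, Pi.zero_apply, forall_and]
  have hK : IsCompact {f | N.IsFlow f} := by
    rw [hset]
    refine isCompact_Icc.inter_right (isClosed_iInter fun v => ?_)
    by_cases h1 : v = N.source
    · simp [h1]
    by_cases h2 : v = N.sink
    · simp [h2]
    simp only [ne_eq, h1, h2, not_false_eq_true, forall_true_left]
    exact isClosed_eq (by fun_prop) (by fun_prop)
  have hval : Continuous N.value := by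
    unfold FlowNetwork.value
    fun_prop
  obtain ⟨f, hf, hmax⟩ := hK.exists_isMaxOn
    ⟨0, ⟨fun u v => ⟨le_rfl, by simpa [hc] using hc0 u v⟩, by simp⟩⟩ hval.continuousOn
  have hK' : IsCompact ({f | N.IsFlow f} ∩ {g | N.value f ≤ N.value g}) :=
    hK.inter_right (isClosed_le continuous_const hval)
  obtain ⟨g, hg, hmin⟩ := hK'.exists_isMinOn (f := fun f => ∑ u, ∑ v, w u v * f u v)
    ⟨f, hf, le_refl (N.value f)⟩ (Continuous.continuousOn (by fun_prop))
  refine ⟨g, ⟨hg.1, fun h hh => (hmax hh).trans hg.2⟩, fun h hh => hmin ⟨hh.1, hh.2 f hf⟩⟩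

/-- The flow from the source through the evaders and sites to the sink with the values `m` on the
edges between evaders and sites. -/
def matrixFlow [Fintype Ψ] (m : Fin n → Ψ → ℝ) : Node n Ψ → Node n Ψ → ℝ
  | .source, .evader i => ∑ ψ, m i ψ
  | .evader i, .site ψ => m i ψ
  | .site ψ, .sink => ∑ i, m i ψ
  | _, _ => 0

open Classical in
/-- The allocation on active edges, `0` on the others. -/
noncomputable def activePart (G : CEGame n Ψ) (x : Profile n Ψ) (i : Fin n) (ψ : Ψ) : ℝ :=
  if G.Active x i ψ then x i.succ ψ else 0

section Realloc

variable [Fintype Ψ]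

/-- The matrices that carry the allocation on active edges with the same row and column sums. -/
structure IsActiveMatrix (G : CEGame n Ψ) (x : Profile n Ψ) (m : Fin n → Ψ → ℝ) : Prop where
  nonneg : ∀ i ψ, 0 ≤ m i ψ
  le_lim : ∀ i ψ, m i ψ ≤ G.lim i.succ ψ
  inactive : ∀ i ψ, ¬ G.Active x i ψ → m i ψ = 0
  row : ∀ i, ∑ ψ, m i ψ = ∑ ψ, activePart G x i ψ
  col : ∀ ψ, ∑ i, m i ψ = ∑ i, activePart G x i ψ

theorem Invariant.isActiveMatrix_activePart (hx : Invariant G x) :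
    IsActiveMatrix G x (activePart G x) where
  nonneg i ψ := by
    unfold activePart
    split_ifs
    exacts [hx.nonneg _ _, le_rfl]
  le_lim i ψ := by
    unfold activePart
    split_ifs
    exacts [hx.le_lim _ _, (hx.nonneg _ _).trans (hx.le_lim _ _)]
  inactive i ψ h := if_neg h
  row _ := rfl
  col _ := rfl

theorem activeNetwork_value {f : Node n Ψ → Node n Ψ → ℝ} (hf : (G.activeNetwork x).IsFlow f) :
    (G.activeNetwork x).value f = ∑ i, f .source (.evader i) := by
  have h1 : ∀ u, f u .source = 0 := fun u => hf.eq_zero (by cases u <;> rfl)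
  have h2 : ∀ ψ, f .source (.site ψ) = 0 := fun ψ => hf.eq_zero rfl
  have h3 : f .source .sink = 0 := hf.eq_zero rfl
  simp only [FlowNetwork.value, activeNetwork, h1, sum_node, h2, h3]
  simp

theorem activeNetwork_row {f : Node n Ψ → Node n Ψ → ℝ} (hf : (G.activeNetwork x).IsFlow f)
    (i : Fin n) : ∑ ψ, f (.evader i) (.site ψ) = f .source (.evader i) := by
  have h := hf.2 (.evader i) nofun nofun
  have h1 : ∀ j, f (.evader j) (.evader i) = 0 := fun j => hf.eq_zero rfl
  have h2 : ∀ ψ, f (.site ψ) (.evader i) = 0 := fun j => hf.eq_zero rfl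
  have h3 : f .sink (.evader i) = 0 := hf.eq_zero rfl
  have h4 : ∀ j, f (.evader i) (.evader j) = 0 := fun j => hf.eq_zero rfl
  have h5 : f (.evader i) .sink = 0 := hf.eq_zero rfl
  have h6 : f (.evader i) .source = 0 := hf.eq_zero rfl
  simp only [sum_node, h1, h2, h3, h4, h5, h6] at h
  simpa using h.symm

theorem activeNetwork_col {f : Node n Ψ → Node n Ψ → ℝ} (hf : (G.activeNetwork x).IsFlow f)
    (ψ : Ψ) : ∑ i, f (.evader i) (.site ψ) = f (.site ψ) .sink := by
  have h := hf.2 (.site ψ) nofun nofun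
  have h1 : ∀ φ, f (.site φ) (.site ψ) = 0 := fun j => hf.eq_zero rfl
  have h2 : f .source (.site ψ) = 0 := hf.eq_zero rfl
  have h3 : f .sink (.site ψ) = 0 := hf.eq_zero rfl
  have h4 : ∀ j, f (.site ψ) (.evader j) = 0 := fun j => hf.eq_zero rfl
  have h5 : ∀ φ, f (.site ψ) (.site φ) = 0 := fun j => hf.eq_zero rfl
  have h6 : f (.site ψ) .source = 0 := hf.eq_zero rfl
  simp only [sum_node, h1, h2, h3, h4, h5, h6] at h
  simpa using h

theorem activeCap_source (i : Fin n) :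
    (G.activeNetwork x).cap .source (.evader i) = (∑ ψ, activePart G x i ψ : ℝ) := rfl

theorem activeCap_sink (ψ : Ψ) :
    (G.activeNetwork x).cap (.site ψ) .sink = (∑ i, activePart G x i ψ : ℝ) := rfl

theorem activeNetwork_value_le {f : Node n Ψ → Node n Ψ → ℝ}
    (hf : (G.activeNetwork x).IsFlow f) :
    (G.activeNetwork x).value f ≤ ∑ i, ∑ ψ, activePart G x i ψ := by
  rw [activeNetwork_value hf]
  refine Finset.sum_le_sum fun i _ => ?_
  have := (hf.1 .source (.evader i)).2
  rw [activeCap_source] at this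
  exact_mod_cast this

/-- A matrix with the prescribed row sums saturates all edges at the source. -/
theorem IsActiveMatrix.isMaxFlow {m : Fin n → Ψ → ℝ} (hm : IsActiveMatrix G x m) :
    (G.activeNetwork x).IsMaxFlow (matrixFlow m) := by
  have hflow : (G.activeNetwork x).IsFlow (matrixFlow m) := by
    refine ⟨fun u v => ?_, fun v h1 h2 => ?_⟩
    · have key : 0 ≤ matrixFlow m u v ∧ matrixFlow m u v ≤ G.activeCap x u v := by
        rcases u with _ | i | ψ | _ <;> rcases v with _ | j | φ | _ <;>
          simp only [matrixFlow, activeCap, le_refl, and_self]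
        · exact ⟨Finset.sum_nonneg fun ψ _ => hm.nonneg _ _, (hm.row j).le⟩
        · refine ⟨hm.nonneg _ _, ?_⟩
          split_ifs with h
          · exact hm.le_lim _ _
          · exact (hm.inactive _ _ h).le
        · exact ⟨Finset.sum_nonneg fun ψ _ => hm.nonneg _ _, (hm.col ψ).le⟩
      exact ⟨key.1, EReal.coe_le_coe_iff.2 key.2⟩
    · rcases v with _ | i | ψ | _
      · exact (h1 rfl).elim
      · simp [sum_node, matrixFlow]
      · simp [sum_node, matrixFlow]
      · exact (h2 rfl).elim
  refine ⟨hflow, fun g hg => (activeNetwork_value_le hg).trans ?_⟩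
  rw [activeNetwork_value hflow]
  exact (Finset.sum_congr rfl fun i _ => hm.row i).ge

/-- A maximum flow saturates all edges at the source and at the sink. -/
theorem isActiveMatrix_of_isMaxFlow (hx : Invariant G x) {f : Node n Ψ → Node n Ψ → ℝ}
    (hf : (G.activeNetwork x).IsMaxFlow f) :
    IsActiveMatrix G x fun i ψ => f (.evader i) (.site ψ) := by
  have hmat := hx.isActiveMatrix_activePart
  have hval := hf.2 _ hmat.isMaxFlow.1
  rw [activeNetwork_value hf.1, activeNetwork_value hmat.isMaxFlow.1] at hval
  have hsrc : ∀ i, f .source (.evader i) ≤ ∑ ψ, activePart G x i ψ := fun i => by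
    have := (hf.1.1 .source (.evader i)).2
    rw [activeCap_source] at this
    exact_mod_cast this
  have hsnk : ∀ ψ, f (.site ψ) .sink ≤ ∑ i, activePart G x i ψ := fun ψ => by
    have := (hf.1.1 (.site ψ) .sink).2
    rw [activeCap_sink] at this
    exact_mod_cast this
  have hsrc' := (Finset.sum_eq_sum_iff_of_le fun i _ => hsrc i).1
    (le_antisymm (Finset.sum_le_sum fun i _ => hsrc i) hval)
  have hcap : ∀ i ψ, (f (.evader i) (.site ψ) : EReal) ≤ G.activeCap x (.evader i) (.site ψ) :=
    fun i ψ => (hf.1.1 (.evader i) (.site ψ)).2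
  have hrow : ∀ i, ∑ ψ, f (.evader i) (.site ψ) = ∑ ψ, activePart G x i ψ := fun i => by
    rw [activeNetwork_row hf.1, hsrc' i (Finset.mem_univ _)]
  refine ⟨fun i ψ => (hf.1.1 _ _).1, fun i ψ => ?_, fun i ψ h => ?_, hrow, fun ψ => ?_⟩
  · have := EReal.coe_le_coe_iff.1 (hcap i ψ)
    simp only [activeCap] at this
    split_ifs at this
    · exact this
    · exact this.trans ((hx.nonneg _ _).trans (hx.le_lim _ _))
  · refine hf.1.eq_zero ?_
    change ((G.activeCap x (.evader i) (.site ψ) : ℝ) : EReal) = 0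
    simp [activeCap, h]
  · rw [activeNetwork_col hf.1]
    refine (Finset.sum_eq_sum_iff_of_le fun ψ _ => hsnk ψ).1 ?_ ψ (Finset.mem_univ _)
    rw [Finset.sum_comm, ← Finset.sum_congr rfl fun i _ => hrow i, Finset.sum_comm]
    exact Finset.sum_congr rfl fun ψ _ => (activeNetwork_col hf.1 ψ).symm

theorem exists_reallocates (hx : Invariant G x) : ∃ y, G.Reallocates x y := by
  classical
  have hpart := hx.isActiveMatrix_activePart
  obtain ⟨f, hf⟩ := (G.activeNetwork x).exists_isMinCostMaxFlow (G.activeCap x)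
    (fun _ _ => rfl) (fun u v => by
      have := hpart.isMaxFlow.1.1 u v
      exact this.1.trans (EReal.coe_le_coe_iff.1 this.2)) G.edgeCost
  refine ⟨Fin.cons (x 0) fun i ψ =>
    if G.Active x i ψ then f (.evader i) (.site ψ) else x i.succ ψ, f, hf, rfl, fun i ψ => ?_⟩
  simp only [Fin.cons_succ]
  exact ⟨fun h => if_pos h, fun h => if_neg h⟩

theorem sum_edgeCost_mul (f : Node n Ψ → Node n Ψ → ℝ) :
    ∑ u, ∑ v, G.edgeCost u v * f u v =
      ∑ i, ∑ ψ, Real.log (-G.d i.succ ψ) * f (.evader i) (.site ψ) := by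
  simp [sum_node, edgeCost]

/-- What the later steps need to know about a reallocation: it moves resource along active edges,
does not change the load of any site, and leaves no negative cycle. -/
structure Realloc (G : CEGame n Ψ) (x y : Profile n Ψ) : Prop where
  move : ActiveMove G x y
  load_eq : load y = load x
  noNegativeCycle : NoNegativeCycle G y

/-- A closed residual walk of negative length would allow a small push along it, which is again a
maximum flow and has lower cost. -/
theorem Reallocates.realloc (hx : Invariant G x) (h : G.Reallocates x y) : Realloc G x y := by
  obtain ⟨f, hf, h0, hy⟩ := h
  have hm := isActiveMatrix_of_isMaxFlow hx hf.1
  have hyf : ∀ i ψ, y i.succ ψ = x i.succ ψ + (f (.evader i) (.site ψ) - activePart G x i ψ) := by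
    intro i ψ
    by_cases ha : G.Active x i ψ
    · rw [(hy i ψ).1 ha, activePart, if_pos ha]
      ring
    · rw [(hy i ψ).2 ha, activePart, if_neg ha, hm.inactive i ψ ha]
      ring
  have hmove : ActiveMove G x y := by
    refine ⟨h0, fun i ψ => ?_, fun i ψ => ?_, fun i ψ => (hy i ψ).2, fun i => ?_⟩
    · by_cases ha : G.Active x i ψ
      · rw [(hy i ψ).1 ha]; exact hm.nonneg i ψ
      · rw [(hy i ψ).2 ha]; exact hx.nonneg _ _
    · by_cases ha : G.Active x i ψ
      · rw [(hy i ψ).1 ha]; exact hm.le_lim i ψ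
      · rw [(hy i ψ).2 ha]; exact hx.le_lim _ _
    · simp only [hyf, Finset.sum_add_distrib, Finset.sum_sub_distrib, hm.row i]
      ring
  have hload : load y = load x := by
    funext ψ
    simp only [load, hyf, Finset.sum_add_distrib, Finset.sum_sub_distrib, hm.col ψ]
    ring
  refine ⟨hmove, hload, fun u t hwalk => ?_⟩
  obtain ⟨N, hN, hrow, hcol, hcost⟩ := exists_matrix_of_resWalk hwalk
  have hact : ∀ i ψ, G.Active y i ψ ↔ G.Active x i ψ := fun i ψ => by
    rw [active_iff_edgeState, active_iff_edgeState, hmove.edgeState_eq hx]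
  have hy' : Invariant G y := hmove.invariant hx fun ψ φ h1 h2 => by
    rw [mu_zero, mu_zero, hload, ← mu_zero, ← mu_zero]
    exact hx.exchange 0 ψ φ h1 h2
  obtain ⟨ε, hε, hbound⟩ := hN.exists_pos hy'
  have hmat : IsActiveMatrix G x fun i ψ => f (.evader i) (.site ψ) + ε * N i ψ := by
    have hzero : ∀ i ψ, ¬ G.Active x i ψ → f (.evader i) (.site ψ) + ε * N i ψ = 0 :=
      fun i ψ ha => by
        rw [hm.inactive i ψ ha, hN.eq_zero (mt (hact i ψ).1 ha)]
        ring
    refine ⟨fun i ψ => ?_, fun i ψ => ?_, hzero, fun i => ?_, fun ψ => ?_⟩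
    · by_cases ha : G.Active x i ψ
      · rw [← (hy i ψ).1 ha]
        exact (hbound ε hε.le le_rfl i ψ).1
      · exact (hzero i ψ ha).ge
    · by_cases ha : G.Active x i ψ
      · rw [← (hy i ψ).1 ha]
        exact (hbound ε hε.le le_rfl i ψ).2
      · exact (hzero i ψ ha).trans_le ((hx.nonneg _ _).trans (hx.le_lim _ _))
    · rw [Finset.sum_add_distrib, hm.row i, ← Finset.mul_sum, hrow]
      ring
    · rw [Finset.sum_add_distrib, hm.col ψ, ← Finset.mul_sum, hcol]
      ring
  have := hf.2 _ hmat.isMaxFlow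
  rw [sum_edgeCost_mul, sum_edgeCost_mul] at this
  simp only [matrixFlow, mul_add, Finset.sum_add_distrib] at this
  have hεt : ∑ i, ∑ ψ, Real.log (-G.d i.succ ψ) * (ε * N i ψ) = ε * t := by
    rw [← hcost]
    simp only [Finset.mul_sum]
    exact Finset.sum_congr rfl fun i _ => Finset.sum_congr rfl fun ψ _ => by ring
  rw [hεt] at this
  exact nonneg_of_mul_nonneg_right (by linarith) hε

theorem Realloc.invariant (h : Realloc G x y) (hx : Invariant G x) : Invariant G y :=
  h.move.invariant hx fun ψ φ h1 h2 => by
    rw [mu_zero, mu_zero, h.load_eq, ← mu_zero, ← mu_zero]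
    exact hx.exchange 0 ψ φ h1 h2

end Realloc

end CEGame

/-! ### Increasing the catcher's allocation -/

namespace CEGame

variable {n : ℕ} {Ψ : Type*} {G : CEGame n Ψ} {x y z : Profile n Ψ} {ψ₀ : Ψ}

theorem exp_resLength_evader (hG : ∀ (i : Fin n) ψ, G.d i.succ ψ < 0) (i : Fin n) (ψ : Ψ) :
    Real.exp (G.resLength (.evader i) (.site ψ)) = -G.d i.succ ψ :=
  Real.exp_log (neg_pos.2 (hG i ψ))

theorem exp_neg_resLength_site (hG : ∀ (i : Fin n) ψ, G.d i.succ ψ < 0) (i : Fin n) (ψ : Ψ) :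
    Real.exp (-G.resLength (.site ψ) (.evader i)) = -G.d i.succ ψ := by
  simp only [resLength, neg_neg]
  exact Real.exp_log (neg_pos.2 (hG i ψ))

theorem rate_evader_le [Finite Ψ] (hG : ∀ (i : Fin n) ψ, G.d i.succ ψ < 0)
    (hx : NoNegativeCycle G x) {i : Fin n} {ψ : Ψ} (ha : G.Active x i ψ)
    (h : x i.succ ψ < G.lim i.succ ψ) :
    G.rate x ψ₀ (.evader i) ≤ G.rate x ψ₀ (.site ψ) * -G.d i.succ ψ := by
  have := rate_mul_exp_le hx (ψ₀ := ψ₀) (resCap_evader_site_pos.2 ⟨ha, h⟩)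
  rwa [Real.exp_neg, exp_resLength_evader hG, ← div_eq_mul_inv,
    div_le_iff₀ (neg_pos.2 (hG i ψ))] at this

theorem le_rate_evader [Finite Ψ] (hG : ∀ (i : Fin n) ψ, G.d i.succ ψ < 0)
    (hx : NoNegativeCycle G x) {i : Fin n} {ψ : Ψ} (ha : G.Active x i ψ)
    (h : 0 < x i.succ ψ) :
    G.rate x ψ₀ (.site ψ) * -G.d i.succ ψ ≤ G.rate x ψ₀ (.evader i) := by
  have := rate_mul_exp_le hx (ψ₀ := ψ₀) (resCap_site_evader_pos.2 ⟨ha, h⟩)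
  rwa [exp_neg_resLength_site hG] at this

/-- A tight edge joins an evader and a site at which the evader's per-resource utility and its
threshold fall at the same speed. -/
theorem TightEdge.cases (hG : ∀ (i : Fin n) ψ, G.d i.succ ψ < 0) {v w : Node n Ψ}
    (h : TightEdge G x ψ₀ v w) :
    ∃ i ψ, ((v = .evader i ∧ w = .site ψ ∧ x i.succ ψ < G.lim i.succ ψ) ∨
        (v = .site ψ ∧ w = .evader i ∧ 0 < x i.succ ψ)) ∧ G.Active x i ψ ∧
      G.rate x ψ₀ (.site ψ) * -G.d i.succ ψ = G.rate x ψ₀ (.evader i) := by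
  obtain ⟨hc, he⟩ := h
  obtain ⟨i, ψ, ⟨rfl, rfl⟩ | ⟨rfl, rfl⟩⟩ := resCap_pos_cases hc
  · rw [resCap_evader_site_pos] at hc
    refine ⟨i, ψ, .inl ⟨rfl, rfl, hc.2⟩, hc.1, ?_⟩
    rw [Real.exp_neg, exp_resLength_evader hG, ← div_eq_mul_inv,
      div_eq_iff (neg_pos.2 (hG i ψ)).ne'] at he
    exact he.symm
  · rw [resCap_site_evader_pos] at hc
    rw [exp_neg_resLength_site hG] at he
    exact ⟨i, ψ, .inr ⟨rfl, rfl, hc.2⟩, hc.1, he⟩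

theorem exists_tight_of_rate_pos [Finite Ψ] (hG : ∀ (i : Fin n) ψ, G.d i.succ ψ < 0)
    (hx : NoNegativeCycle G x) {i : Fin n} (h : 0 < G.rate x ψ₀ (.evader i)) :
    ∃ ψ, G.Active x i ψ ∧ 0 < x i.succ ψ ∧
      G.rate x ψ₀ (.site ψ) * -G.d i.succ ψ = G.rate x ψ₀ (.evader i) := by
  have hr := reach_reflTransGen_tightEdge hx ((rate_pos_iff hx).1 h)
  rcases hr.cases_tail with heq | ⟨v, _, e⟩
  · simp at heq
  · obtain ⟨j, ψ, ⟨_, h2, _⟩ | ⟨_, h2, h3⟩, ha, he⟩ := e.cases hG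
    · simp at h2
    · obtain rfl : i = j := by simpa using h2
      exact ⟨ψ, ha, h3, he⟩

/-- At some active site with positive allocation, the evader's per-resource utility falls exactly
as fast as its threshold. -/
theorem exists_tight [Finite Ψ] (hG : ∀ (i : Fin n) ψ, G.d i.succ ψ < 0)
    (hx : NoNegativeCycle G x) {i : Fin n} (h : ∃ ψ, 0 < x i.succ ψ) :
    ∃ ψ, G.Active x i ψ ∧ 0 < x i.succ ψ ∧
      G.rate x ψ₀ (.site ψ) * -G.d i.succ ψ = G.rate x ψ₀ (.evader i) := by
  rcases rate_nonneg (G := G) (x := x) (ψ₀ := ψ₀) (v := .evader i) |>.lt_or_eq with hpos | h0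
  · exact exists_tight_of_rate_pos hG hx hpos
  · obtain ⟨ψ, hψ, hmu⟩ := exists_mu_eq_thr (G := G) h
    have ha : G.Active x i ψ := active_iff.2 ⟨h, hmu⟩
    refine ⟨ψ, ha, hψ, le_antisymm (le_rate_evader hG hx ha hψ) ?_⟩
    rw [← h0]
    exact mul_nonneg rate_nonneg (neg_pos.2 (hG i ψ)).le

section

variable [Fintype Ψ]

theorem finite_stepBound : {t : ℝ | StepBound G x ψ₀ t}.Finite := by
  refine ((Set.finite_singleton ((G.r 0 - ∑ ψ, x 0 ψ) / ∑ ψ, G.rate x ψ₀ (.site ψ))).union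
    ((Set.finite_range fun ψ => (G.lim 0 ψ - x 0 ψ) / G.rate x ψ₀ (.site ψ)).union
    (Set.finite_range fun p : Fin n × Ψ => (G.mu x p.1.succ p.2 - G.thr x p.1) /
      (G.rate x ψ₀ (.site p.2) * (-G.d p.1.succ p.2) - G.rate x ψ₀ (.evader p.1))))).subset ?_
  rintro _ (_ | ⟨ψ, _⟩ | ⟨i, ψ, t, ht, _, _⟩)
  · exact .inl rfl
  · exact .inr (.inl ⟨ψ, rfl⟩)
  · obtain ⟨_, rfl⟩ := isEvaderThreshold_iff.1 ht
    exact .inr (.inr ⟨(i, ψ), rfl⟩)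

theorem sum_rate_pos (hx : NoNegativeCycle G x) : 0 < ∑ ψ, G.rate x ψ₀ (.site ψ) :=
  Finset.sum_pos' (fun _ _ => rate_nonneg)
    ⟨ψ₀, Finset.mem_univ _, by rw [rate_self hx]; exact one_pos⟩

theorem GoodSite.openBoundary_of_rate_pos (h : G.GoodSite x ψ₀) (hx : NoNegativeCycle G x)
    {ψ : Ψ} (hψ : 0 < G.rate x ψ₀ (.site ψ)) : G.OpenBoundary x ψ :=
  h.2 ψ (dist_lt_top_iff.2 ((rate_pos_iff hx).1 hψ))

theorem StepBound.pos (hgood : G.GoodSite x ψ₀) (hx : NoNegativeCycle G x)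
    (hloop : G.LoopCondition x) {t : ℝ} (h : StepBound G x ψ₀ t) : 0 < t := by
  rcases h with _ | ⟨ψ, hψ⟩ | ⟨_, _, _, _, _, h⟩
  · exact div_pos (sub_pos.2 hloop) (sum_rate_pos hx)
  · exact div_pos (sub_pos.2 (hgood.openBoundary_of_rate_pos hx hψ).2) hψ
  · exact h

/-- A step of length `Δ` from the good site `ψ₀`. -/
structure IncreaseStep (G : CEGame n Ψ) (y z : Profile n Ψ) (ψ₀ : Ψ) (Δ : ℝ) : Prop where
  good : G.GoodSite y ψ₀
  pos : 0 < Δ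
  least : IsLeast {t : ℝ | StepBound G y ψ₀ t} Δ
  catcher : ∀ ψ, z 0 ψ = y 0 ψ + Δ * G.rate y ψ₀ (.site ψ)
  evader : ∀ i : Fin n, z i.succ = y i.succ

theorem exists_increases [LinearOrder Ψ] (h : ¬ G.IncreaseFails y) : ∃ z, G.Increases y z := by
  simp only [IncreaseFails, not_forall, not_not] at h
  obtain ⟨ψ₀, hψ₀, hfirst⟩ := Set.exists_min_image {ψ | G.GoodSite y ψ} id (Set.toFinite _) h
  obtain ⟨Δ, hΔ, hmin⟩ := Set.exists_min_image {t : ℝ | StepBound G y ψ₀ t} id finite_stepBound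
    ⟨_, .resource⟩
  exact ⟨Fin.cons (fun ψ => y 0 ψ + Δ * G.rate y ψ₀ (.site ψ)) fun i => y i.succ, ψ₀, Δ,
    ⟨hψ₀, fun φ hφ hg => (hfirst φ hg).not_gt hφ⟩, ⟨hΔ, hmin⟩, fun ψ => rfl, fun i => rfl⟩

theorem Increases.exists_step [LinearOrder Ψ] (hy : NoNegativeCycle G y)
    (hloop : G.LoopCondition y) (h : G.Increases y z) :
    ∃ ψ₀ Δ, IncreaseStep G y z ψ₀ Δ ∧ ∀ φ < ψ₀, ¬ G.GoodSite y φ := by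
  obtain ⟨ψ₀, Δ, ⟨hg, hfirst⟩, hleast, h0, hev⟩ := h
  exact ⟨ψ₀, Δ, ⟨hg, hleast.1.pos hg hy hloop, hleast, h0, hev⟩, hfirst⟩

namespace IncreaseStep

variable {Δ : ℝ}

theorem load_eq (h : IncreaseStep G y z ψ₀ Δ) : load z = load y := by
  funext ψ
  simp [load, h.evader]

theorem mu_zero_eq (h : IncreaseStep G y z ψ₀ Δ) (ψ : Ψ) : G.mu z 0 ψ = G.mu y 0 ψ := by
  rw [mu_zero, mu_zero, h.load_eq]

theorem mu_succ_eq (h : IncreaseStep G y z ψ₀ Δ) (i : Fin n) (ψ : Ψ) :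
    G.mu z i.succ ψ = G.mu y i.succ ψ - Δ * (G.rate y ψ₀ (.site ψ) * -G.d i.succ ψ) := by
  rw [mu_succ, mu_succ, h.catcher]
  ring

theorem le_catcher (h : IncreaseStep G y z ψ₀ Δ) (ψ : Ψ) : y 0 ψ ≤ z 0 ψ := by
  rw [h.catcher]
  have := mul_nonneg h.pos.le (rate_nonneg (G := G) (x := y) (ψ₀ := ψ₀) (v := .site ψ))
  linarith

/-- The step length does not let an inactive edge cross the threshold. -/
theorem inactive_bound (h : IncreaseStep G y z ψ₀ Δ) {i : Fin n} (hp : ∃ ψ, 0 < y i.succ ψ)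
    (ψ : Ψ) :
    (G.thr y i < G.mu y i.succ ψ → Δ * (G.rate y ψ₀ (.site ψ) * -G.d i.succ ψ -
      G.rate y ψ₀ (.evader i)) ≤ G.mu y i.succ ψ - G.thr y i) ∧
    (G.mu y i.succ ψ < G.thr y i → G.mu y i.succ ψ - G.thr y i ≤
      Δ * (G.rate y ψ₀ (.site ψ) * -G.d i.succ ψ - G.rate y ψ₀ (.evader i))) := by
  set q := G.rate y ψ₀ (.site ψ) * -G.d i.succ ψ - G.rate y ψ₀ (.evader i) with hq
  have hb : G.mu y i.succ ψ ≠ G.thr y i → 0 < (G.mu y i.succ ψ - G.thr y i) / q →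
      Δ ≤ (G.mu y i.succ ψ - G.thr y i) / q := fun h1 h2 =>
    h.least.2 (.inactive i ψ _ (isEvaderThreshold_thr hp) h1 h2)
  have hΔ := h.pos
  constructor
  · intro hlt
    rcases le_or_gt q 0 with hq0 | hq0
    · nlinarith
    · rw [← le_div_iff₀ hq0]
      exact hb hlt.ne' (div_pos (sub_pos.2 hlt) hq0)
  · intro hlt
    rcases lt_or_ge q 0 with hq0 | hq0
    · rw [← le_div_iff_of_neg hq0]
      exact hb hlt.ne (div_pos_of_neg_of_neg (sub_neg.2 hlt) hq0)
    · nlinarith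

theorem thr_sub_le (h : IncreaseStep G y z ψ₀ Δ) (hG : ∀ (i : Fin n) ψ, G.d i.succ ψ < 0)
    (hc : NoNegativeCycle G y) {i : Fin n} {ψ : Ψ} (hpos : 0 < y i.succ ψ) :
    G.thr y i - Δ * G.rate y ψ₀ (.evader i) ≤ G.mu z i.succ ψ := by
  rw [h.mu_succ_eq]
  rcases (thr_le_mu (G := G) hpos).lt_or_eq with hlt | heq
  · have := (h.inactive_bound ⟨ψ, hpos⟩ ψ).1 hlt
    linarith
  · have := le_rate_evader (ψ₀ := ψ₀) hG hc (active_iff.2 ⟨⟨ψ, hpos⟩, heq.symm⟩) hpos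
    have := mul_le_mul_of_nonneg_left this h.pos.le
    linarith

theorem le_thr_sub (h : IncreaseStep G y z ψ₀ Δ) (hG : ∀ (i : Fin n) ψ, G.d i.succ ψ < 0)
    (hc : NoNegativeCycle G y) (hy : Invariant G y) {i : Fin n} {ψ : Ψ}
    (hp : ∃ ψ, 0 < y i.succ ψ) (hlim : y i.succ ψ < G.lim i.succ ψ) :
    G.mu z i.succ ψ ≤ G.thr y i - Δ * G.rate y ψ₀ (.evader i) := by
  rw [h.mu_succ_eq]
  rcases (hy.mu_le_thr hp hlim).lt_or_eq with hlt | heq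
  · have := (h.inactive_bound hp ψ).2 hlt
    linarith
  · have := rate_evader_le (ψ₀ := ψ₀) hG hc (active_iff.2 ⟨hp, heq⟩) hlim
    have := mul_le_mul_of_nonneg_left this h.pos.le
    linarith

/-- The thresholds fall with the speeds `γ_i`. -/
theorem thr_eq (h : IncreaseStep G y z ψ₀ Δ) (hG : ∀ (i : Fin n) ψ, G.d i.succ ψ < 0)
    (hc : NoNegativeCycle G y) (i : Fin n) :
    G.thr z i = G.thr y i - Δ * G.rate y ψ₀ (.evader i) := by
  by_cases hp : ∃ ψ, 0 < y i.succ ψ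
  · obtain ⟨ψ, ha, hpos, he⟩ := exists_tight (ψ₀ := ψ₀) hG hc hp
    refine ((isEvaderThreshold_iff (t := G.thr y i - Δ * G.rate y ψ₀ (.evader i))).1
      ⟨⟨ψ, ?_, ?_⟩, ?_⟩).2.symm
    · rwa [h.evader]
    · rw [h.mu_succ_eq, he, (active_iff.1 ha).2]
    · rintro _ ⟨φ, hφ, rfl⟩
      rw [h.evader] at hφ
      exact h.thr_sub_le hG hc hφ
  · have h0 : G.rate y ψ₀ (.evader i) = 0 := by
      by_contra hne
      obtain ⟨ψ, -, hpos, -⟩ :=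
        exists_tight_of_rate_pos hG hc (lt_of_le_of_ne rate_nonneg (Ne.symm hne))
      exact hp ⟨ψ, hpos⟩
    rw [not_exists] at hp
    simp [thr, h.evader, hp, h0]

/-- Edges along which utility and threshold fall at the same speed stay active. -/
theorem active_of_tight (h : IncreaseStep G y z ψ₀ Δ) (hG : ∀ (i : Fin n) ψ, G.d i.succ ψ < 0)
    (hc : NoNegativeCycle G y) {i : Fin n} {ψ : Ψ} (ha : G.Active y i ψ)
    (he : G.rate y ψ₀ (.site ψ) * -G.d i.succ ψ = G.rate y ψ₀ (.evader i)) :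
    G.Active z i ψ := by
  rw [active_iff] at ha ⊢
  rw [h.evader, h.mu_succ_eq, h.thr_eq hG hc, he, ha.2]
  exact ⟨ha.1, rfl⟩

theorem catcher_le_lim (h : IncreaseStep G y z ψ₀ Δ)
    (hy : Invariant G y) (ψ : Ψ) : z 0 ψ ≤ G.lim 0 ψ := by
  rw [h.catcher]
  rcases rate_nonneg (G := G) (x := y) (ψ₀ := ψ₀) (v := .site ψ) |>.lt_or_eq with hpos | h0
  · have := h.least.2 (.limit ψ hpos)
    rw [le_div_iff₀ hpos] at this
    linarith
  · rw [← h0, mul_zero, add_zero]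
    exact hy.le_lim 0 ψ

theorem sum_catcher_eq (h : IncreaseStep G y z ψ₀ Δ) :
    ∑ ψ, z 0 ψ = ∑ ψ, y 0 ψ + Δ * ∑ ψ, G.rate y ψ₀ (.site ψ) := by
  simp only [h.catcher, Finset.sum_add_distrib, Finset.mul_sum]

/-- The catcher's conditions are kept because only open boundary sites are raised, those of the
evaders because the falling threshold still separates the sites. -/
theorem invariant (h : IncreaseStep G y z ψ₀ Δ) (hG : ∀ (i : Fin n) ψ, G.d i.succ ψ < 0)
    (hc : NoNegativeCycle G y) (hy : Invariant G y) : Invariant G z where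
  nonneg i ψ := Fin.cases ((hy.nonneg 0 ψ).trans (h.le_catcher ψ))
    (fun j => (hy.nonneg j.succ ψ).trans_eq (congrFun (h.evader j) ψ).symm) i
  le_lim i ψ := Fin.cases (h.catcher_le_lim hy ψ)
    (fun j => (congrFun (h.evader j) ψ).trans_le (hy.le_lim j.succ ψ)) i
  sum_evader i := by rw [h.evader]; exact hy.sum_evader i
  sum_catcher := by
    have := h.least.2 .resource
    rw [le_div_iff₀ (sum_rate_pos hc)] at this
    rw [h.sum_catcher_eq]
    linarith
  exchange i ψ φ := by
    refine Fin.cases (fun hψ hφ => ?_) (fun j hψ hφ => ?_) i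
    · rw [h.mu_zero_eq, h.mu_zero_eq]
      have hφ' := (h.le_catcher φ).trans_lt hφ
      rcases (hy.nonneg 0 ψ).lt_or_eq with hpos | h0
      · exact hy.exchange 0 ψ φ hpos hφ'
      · rw [h.catcher, ← h0, zero_add] at hψ
        have hopen := h.good.openBoundary_of_rate_pos hc (pos_of_mul_pos_right hψ h.pos.le)
        exact hopen.1.2 ⟨φ, hφ', rfl⟩
    · rw [h.evader] at hψ hφ
      exact (h.le_thr_sub hG hc hy ⟨ψ, hψ⟩ hφ).trans (h.thr_sub_le hG hc hψ)

/-- If a step neither exhausts the catcher's resource nor fills a site, it ends when an inactive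
edge becomes active. -/
theorem exists_blocking_edge (h : IncreaseStep G y z ψ₀ Δ) (hc : NoNegativeCycle G y)
    (hloop : G.LoopCondition z) (hfill : ∀ ψ, y 0 ψ < G.lim 0 ψ → z 0 ψ < G.lim 0 ψ) :
    ∃ i ψ, (∃ ψ, 0 < y i.succ ψ) ∧ G.mu y i.succ ψ ≠ G.thr y i ∧
      G.mu y i.succ ψ - G.thr y i =
        Δ * (G.rate y ψ₀ (.site ψ) * -G.d i.succ ψ - G.rate y ψ₀ (.evader i)) := by
  have hpos := h.pos
  obtain ⟨t, ht⟩ : ∃ t, t = Δ := ⟨_, rfl⟩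
  have hb : StepBound G y ψ₀ t := ht ▸ h.least.1
  rcases hb with _ | ⟨ψ, hψ⟩ | ⟨i, ψ, t, hthr, hne, hq⟩
  · rw [div_eq_iff (sum_rate_pos hc).ne'] at ht
    have : ∑ ψ, z 0 ψ < G.r 0 := hloop
    rw [h.sum_catcher_eq] at this
    linarith
  · rw [div_eq_iff hψ.ne'] at ht
    have := hfill ψ (h.good.openBoundary_of_rate_pos hc hψ).2
    rw [h.catcher] at this
    linarith
  · obtain ⟨hp, rfl⟩ := isEvaderThreshold_iff.1 hthr
    refine ⟨i, ψ, hp, hne, ?_⟩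
    have hq0 : G.rate y ψ₀ (.site ψ) * -G.d i.succ ψ - G.rate y ψ₀ (.evader i) ≠ 0 := by
      intro h0
      rw [h0, div_zero] at hq
      exact lt_irrefl _ hq
    exact (div_eq_iff hq0).1 ht

end IncreaseStep

end

end CEGame

/-! ### Rerouting -/

namespace CEGame

variable {n : ℕ} {Ψ : Type*} {G : CEGame n Ψ} {x y z : Profile n Ψ} {t Δ : ℝ}

theorem OpenBoundary.mu_eq {ψ : Ψ} (h : G.OpenBoundary x ψ) (ht : G.IsCatcherThreshold x t) :
    G.mu x 0 ψ = t :=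
  h.1.unique ht

theorem openBoundary_iff (ht : G.IsCatcherThreshold x t) {ψ : Ψ} :
    G.OpenBoundary x ψ ↔ t ≤ G.mu x 0 ψ ∧ x 0 ψ < G.lim 0 ψ := by
  refine ⟨fun h => ⟨(h.mu_eq ht).ge, h.2⟩, fun h => ⟨?_, h.2⟩⟩
  rwa [le_antisymm (ht.2 ⟨ψ, h.2, rfl⟩) h.1]

theorem exists_openBoundary (ht : G.IsCatcherThreshold x t) : ∃ ψ, G.OpenBoundary x ψ := by
  obtain ⟨ψ, hψ, he⟩ := ht.1
  exact ⟨ψ, (openBoundary_iff ht).2 ⟨he.le, hψ⟩⟩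

theorem exists_isCatcherThreshold [Fintype Ψ] (hG : G.Valid) (hloop : G.LoopCondition x) :
    ∃ t, G.IsCatcherThreshold x t := by
  have hopen : ∃ ψ, x 0 ψ < G.lim 0 ψ := by
    by_contra! h
    exact (hloop.trans_le (hG.r_le 0)).not_ge (Finset.sum_le_sum fun ψ _ => h ψ)
  obtain ⟨φ, hφ, hmax⟩ := Set.exists_max_image {ψ | x 0 ψ < G.lim 0 ψ} (G.mu x 0)
    (Set.toFinite _) hopen
  refine ⟨G.mu x 0 φ, ⟨φ, hφ, rfl⟩, ?_⟩
  rintro _ ⟨ψ, hψ, rfl⟩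
  exact hmax ψ hψ

open Classical in
/-- The flow with the net changes `m` between evaders and sites. -/
noncomputable def rerouteFlow (G : CEGame n Ψ) (x : Profile n Ψ) (Δ : ℝ) (m : Fin n → Ψ → ℝ) :
    Node n Ψ → Node n Ψ → ℝ
  | .source, .site ψ => if G.OpenBoundary x ψ then Δ / G.d 0 ψ else 0
  | .evader i, .site ψ => max (m i ψ) 0
  | .site ψ, .evader i => max (-m i ψ) 0
  | .site ψ, .sink => if G.OpenBoundary x ψ then 0 else ∑ i, m i ψ
  | _, _ => 0

theorem rerouteFlow_saturatesSource (m : Fin n → Ψ → ℝ) :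
    (G.rerouteNetwork x t Δ).SaturatesSource (rerouteFlow G x Δ m) := by
  intro v
  rcases v with _ | i | ψ | _
  · rfl
  · rfl
  · simp only [rerouteFlow, rerouteNetwork, rerouteCap]
    split_ifs <;> rfl
  · rfl

section

variable [Fintype Ψ]

/-- The net changes `m` of the evaders' allocation that come from flows of the rerouting network
which saturate all edges at the source. -/
structure RerouteMove (G : CEGame n Ψ) (x : Profile n Ψ) (t Δ : ℝ) (m : Fin n → Ψ → ℝ) :
    Prop where
  nonneg : ∀ i ψ, 0 ≤ x i.succ ψ + m i ψ
  le_lim : ∀ i ψ, x i.succ ψ + m i ψ ≤ G.lim i.succ ψ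
  inactive : ∀ i ψ, ¬ G.Active x i ψ → m i ψ = 0
  row : ∀ i, ∑ ψ, m i ψ = 0
  col_open : ∀ ψ, G.OpenBoundary x ψ → ∑ i, m i ψ = -(Δ / G.d 0 ψ)
  col_nonneg : ∀ ψ, ¬ G.OpenBoundary x ψ → 0 ≤ ∑ i, m i ψ
  col_le : ∀ ψ, ¬ G.OpenBoundary x ψ → G.mu x 0 ψ < t →
    ∑ i, m i ψ ≤ (t - Δ - G.mu x 0 ψ) / G.d 0 ψ

theorem rerouteNetwork_value {f : Node n Ψ → Node n Ψ → ℝ}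
    (hf : (G.rerouteNetwork x t Δ).IsFlow f) :
    (G.rerouteNetwork x t Δ).value f = ∑ ψ, f .source (.site ψ) := by
  have h1 : ∀ u, f u .source = 0 := fun u => hf.eq_zero (by cases u <;> rfl)
  have h2 : ∀ i, f .source (.evader i) = 0 := fun ψ => hf.eq_zero rfl
  have h3 : f .source .sink = 0 := hf.eq_zero rfl
  simp only [FlowNetwork.value, rerouteNetwork, h1, sum_node, h2, h3]
  simp

theorem isMaxFlow_of_saturatesSource {f : Node n Ψ → Node n Ψ → ℝ}
    (hf : (G.rerouteNetwork x t Δ).IsFlow f)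
    (hs : (G.rerouteNetwork x t Δ).SaturatesSource f) : (G.rerouteNetwork x t Δ).IsMaxFlow f := by
  refine ⟨hf, fun g hg => ?_⟩
  rw [rerouteNetwork_value hf, rerouteNetwork_value hg]
  refine Finset.sum_le_sum fun ψ _ => EReal.coe_le_coe_iff.1 ?_
  exact ((hg.1 _ _).2).trans_eq (hs (.site ψ)).symm

theorem saturatesSource_of_isMaxFlow {f g : Node n Ψ → Node n Ψ → ℝ}
    (hg : (G.rerouteNetwork x t Δ).IsFlow g)
    (hs : (G.rerouteNetwork x t Δ).SaturatesSource g)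
    (hf : (G.rerouteNetwork x t Δ).IsMaxFlow f) (ψ : Ψ) :
    (f .source (.site ψ) : EReal) = (G.rerouteNetwork x t Δ).cap .source (.site ψ) := by
  have hle : ∀ ψ, f .source (.site ψ) ≤ g .source (.site ψ) := fun ψ =>
    EReal.coe_le_coe_iff.1 (((hf.1.1 _ _).2).trans_eq (hs (.site ψ)).symm)
  have hval := hf.2 g hg
  rw [rerouteNetwork_value hf.1, rerouteNetwork_value hg] at hval
  rw [(Finset.sum_eq_sum_iff_of_le fun ψ _ => hle ψ).1
    (le_antisymm (Finset.sum_le_sum fun ψ _ => hle ψ) hval) ψ (Finset.mem_univ _)]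
  exact hs (.site ψ)

theorem rerouteMove_of_isFlow (hx : Invariant G x) {f : Node n Ψ → Node n Ψ → ℝ}
    (hf : (G.rerouteNetwork x t Δ).IsFlow f)
    (hs : ∀ ψ, (f .source (.site ψ) : EReal) = (G.rerouteNetwork x t Δ).cap .source (.site ψ)) :
    RerouteMove G x t Δ fun i ψ => f (.evader i) (.site ψ) - f (.site ψ) (.evader i) := by
  have hfwd : ∀ i ψ, f (.evader i) (.site ψ) ≤ G.resCap x (.evader i) (.site ψ) := fun i ψ =>
    EReal.coe_le_coe_iff.1 (hf.1 (.evader i) (.site ψ)).2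
  have hbwd : ∀ i ψ, f (.site ψ) (.evader i) ≤ G.resCap x (.site ψ) (.evader i) := fun i ψ =>
    EReal.coe_le_coe_iff.1 (hf.1 (.site ψ) (.evader i)).2
  have hnn := fun u v => (hf.1 u v).1
  have hcol : ∀ ψ, ∑ i, (f (.evader i) (.site ψ) - f (.site ψ) (.evader i)) =
      f (.site ψ) .sink - f .source (.site ψ) := by
    intro ψ
    have h := hf.2 (.site ψ) nofun nofun
    have h1 : ∀ φ, f (.site φ) (.site ψ) = 0 := fun j => hf.eq_zero rfl
    have h3 : f .sink (.site ψ) = 0 := hf.eq_zero rfl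
    have h5 : ∀ φ, f (.site ψ) (.site φ) = 0 := fun j => hf.eq_zero rfl
    have h6 : f (.site ψ) .source = 0 := hf.eq_zero rfl
    simp only [sum_node, h1, h3, h5, h6, Finset.sum_const_zero] at h
    rw [Finset.sum_sub_distrib]
    linarith
  have hopen : ∀ ψ, G.OpenBoundary x ψ → f .source (.site ψ) = Δ / G.d 0 ψ := by
    intro ψ h
    have := hs ψ
    simp only [rerouteNetwork, rerouteCap, if_pos h] at this
    exact_mod_cast this
  have hclosed : ∀ ψ, ¬ G.OpenBoundary x ψ → f .source (.site ψ) = 0 := by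
    intro ψ h
    have := hs ψ
    simp only [rerouteNetwork, rerouteCap, if_neg h] at this
    exact_mod_cast this
  refine ⟨fun i ψ => ?_, fun i ψ => ?_, fun i ψ ha => ?_, fun i => ?_, fun ψ h => ?_,
    fun ψ h => ?_, fun ψ h hmu => ?_⟩
  · have h1 := hbwd i ψ
    have h2 := hnn (.evader i) (.site ψ)
    simp only [resCap] at h1
    split_ifs at h1
    · linarith
    · linarith [hx.nonneg i.succ ψ]
  · have h1 := hfwd i ψ
    have h2 := hnn (.site ψ) (.evader i)
    simp only [resCap] at h1
    split_ifs at h1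
    · linarith
    · linarith [hx.le_lim i.succ ψ]
  · have h1 := hfwd i ψ
    have h2 := hbwd i ψ
    simp only [resCap, if_neg ha] at h1 h2
    linarith [hnn (.evader i) (.site ψ), hnn (.site ψ) (.evader i)]
  · have h := hf.2 (.evader i) nofun nofun
    have h1 : ∀ j, f (.evader j) (.evader i) = 0 := fun j => hf.eq_zero rfl
    have h2 : f .source (.evader i) = 0 := hf.eq_zero rfl
    have h3 : f .sink (.evader i) = 0 := hf.eq_zero rfl
    have h4 : ∀ j, f (.evader i) (.evader j) = 0 := fun j => hf.eq_zero rfl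
    have h5 : f (.evader i) .sink = 0 := hf.eq_zero rfl
    have h6 : f (.evader i) .source = 0 := hf.eq_zero rfl
    simp only [sum_node, h1, h2, h3, h4, h5, h6, Finset.sum_const_zero] at h
    rw [Finset.sum_sub_distrib]
    linarith
  · have h0 : f (.site ψ) .sink = 0 := hf.eq_zero (by simp [rerouteNetwork, rerouteCap, h])
    rw [hcol, hopen ψ h, h0]
    ring
  · rw [hcol, hclosed ψ h, sub_zero]
    exact hnn _ _
  · rw [hcol, hclosed ψ h, sub_zero]
    have := (hf.1 (.site ψ) .sink).2
    simp only [rerouteNetwork, rerouteCap, if_neg h, if_neg hmu.not_ge] at this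
    exact EReal.coe_le_coe_iff.1 this

/-- Conservation at a site is its column sum, conservation at an evader its row sum. -/
theorem RerouteMove.isFlow (hG : G.Valid) (hx : Invariant G x) (hΔ : 0 ≤ Δ)
    {m : Fin n → Ψ → ℝ} (hm : RerouteMove G x t Δ m) :
    (G.rerouteNetwork x t Δ).IsFlow (rerouteFlow G x Δ m) := by
  have hmax : ∀ a : ℝ, max a 0 = a + max (-a) 0 := fun a => by
    rcases le_total a 0 with h | h
    · rw [max_eq_right h, max_eq_left (neg_nonneg.2 h)]; ring
    · rw [max_eq_left h, max_eq_right (neg_nonpos.2 h)]; ring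
  refine ⟨fun u v => ?_, fun v h1 h2 => ?_⟩
  · rcases u with _ | i | ψ | _ <;> rcases v with _ | j | φ | _
    case source.site =>
      simp only [rerouteFlow, rerouteNetwork, rerouteCap]
      split_ifs
      · exact ⟨div_nonneg hΔ (hG.d_catcher φ).le, le_rfl⟩
      · exact ⟨le_rfl, le_rfl⟩
    case evader.site =>
      refine ⟨le_max_right _ _, EReal.coe_le_coe_iff.2 (max_le ?_ ?_)⟩ <;> simp only [resCap] <;>
        split_ifs with h
      · linarith [hm.le_lim i φ]
      · exact (hm.inactive i φ h).le
      · linarith [hx.le_lim i.succ φ]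
      · exact le_rfl
    case site.evader =>
      refine ⟨le_max_right _ _, EReal.coe_le_coe_iff.2 (max_le ?_ ?_)⟩ <;> simp only [resCap] <;>
        split_ifs with h
      · linarith [hm.nonneg j ψ]
      · rw [hm.inactive j ψ h, neg_zero]
      · exact hx.nonneg j.succ ψ
      · exact le_rfl
    case site.sink =>
      simp only [rerouteFlow, rerouteNetwork, rerouteCap]
      split_ifs with h h'
      · exact ⟨le_rfl, le_rfl⟩
      · exact ⟨hm.col_nonneg ψ h, le_top⟩
      · exact ⟨hm.col_nonneg ψ h, EReal.coe_le_coe_iff.2 (hm.col_le ψ h (not_le.1 h'))⟩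
    all_goals exact ⟨le_rfl, le_rfl⟩
  · rcases v with _ | i | ψ | _
    · exact (h1 rfl).elim
    · have := hm.row i
      simp only [sum_node, rerouteFlow, Finset.sum_const_zero, hmax (m i _),
        Finset.sum_add_distrib, this]
      ring
    · simp only [sum_node, rerouteFlow, Finset.sum_const_zero, hmax (m _ ψ),
        Finset.sum_add_distrib]
      split_ifs with h
      · rw [hm.col_open ψ h]; ring
      · ring
    · exact (h2 rfl).elim

/-- The search for `Δ` in terms of net changes of the allocation. A flow that saturates the edges
at the source is a maximum flow, so maximality can be dropped. -/
theorem mem_rerouteSet_iff (hG : G.Valid) (hx : Invariant G x) :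
    Δ ∈ G.rerouteSet x t ↔ 0 ≤ Δ ∧ (∀ ψ, G.mu x 0 ψ < t → Δ ≤ t - G.mu x 0 ψ) ∧
      ∃ m, RerouteMove G x t Δ m := by
  refine and_congr_right fun hΔ => and_congr_right fun _ => ⟨?_, ?_⟩
  · rintro ⟨f, hf, hs⟩
    exact ⟨_, rerouteMove_of_isFlow hx hf.1 fun ψ => hs _⟩
  · rintro ⟨m, hm⟩
    exact ⟨_, isMaxFlow_of_saturatesSource (hm.isFlow hG hx hΔ) (rerouteFlow_saturatesSource m),
      rerouteFlow_saturatesSource m⟩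

theorem Invariant.rerouteMove_zero (hx : Invariant G x) (hG : G.Valid) :
    RerouteMove G x t 0 0 where
  nonneg i ψ := by simpa using hx.nonneg i.succ ψ
  le_lim i ψ := by simpa using hx.le_lim i.succ ψ
  inactive _ _ _ := rfl
  row i := by simp
  col_open ψ _ := by simp
  col_nonneg ψ _ := by simp
  col_le ψ _ h := by
    simp only [Pi.zero_apply, Finset.sum_const_zero, sub_zero]
    exact div_nonneg (sub_nonneg.2 h.le) (hG.d_catcher ψ).le

/-- The largest decrease `Δ` exists by compactness; the evaders' resource on an open boundary
site bounds it. -/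
theorem exists_isGreatest_rerouteSet (hG : G.Valid) (hx : Invariant G x)
    (ht : G.IsCatcherThreshold x t) : ∃ Δ, IsGreatest (G.rerouteSet x t) Δ := by
  obtain ⟨φ, hφ⟩ := exists_openBoundary ht
  set S : Set (ℝ × (Fin n → Ψ → ℝ)) := {p | 0 ≤ p.1 ∧
    (∀ ψ, G.mu x 0 ψ < t → p.1 ≤ t - G.mu x 0 ψ) ∧ RerouteMove G x t p.1 p.2} with hS
  have himage : G.rerouteSet x t = Prod.fst '' S := by
    ext Δ
    rw [mem_rerouteSet_iff hG hx]
    constructor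
    · rintro ⟨h1, h2, m, h3⟩
      exact ⟨(Δ, m), ⟨h1, h2, h3⟩, rfl⟩
    · rintro ⟨⟨_, m⟩, ⟨h1, h2, h3⟩, rfl⟩
      exact ⟨h1, h2, m, h3⟩
  have hsub : S ⊆ Set.Icc (0, fun i ψ => -x i.succ ψ)
      (G.d 0 φ * load x φ, fun i ψ => G.lim i.succ ψ - x i.succ ψ) := by
    rintro ⟨Δ, m⟩ ⟨h1, -, h3⟩
    refine ⟨⟨h1, fun i ψ => ?_⟩, ⟨?_, fun i ψ => ?_⟩⟩
    · dsimp only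
      linarith [h3.nonneg i ψ]
    · have hsum : 0 ≤ ∑ i, (x i.succ φ + m i φ) := Finset.sum_nonneg fun i _ => h3.nonneg i φ
      rw [Finset.sum_add_distrib, h3.col_open φ hφ] at hsum
      have : Δ / G.d 0 φ ≤ load x φ := by
        unfold load
        linarith
      rw [div_le_iff₀ (hG.d_catcher φ)] at this
      dsimp only
      linarith
    · dsimp only
      linarith [h3.le_lim i ψ]
  have hclosed : IsClosed S := by
    have : S = {p | 0 ≤ p.1} ∩ ((⋂ ψ, ⋂ (_ : G.mu x 0 ψ < t), {p | p.1 ≤ t - G.mu x 0 ψ}) ∩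
        ((⋂ i, ⋂ ψ, {p | 0 ≤ x i.succ ψ + p.2 i ψ}) ∩
        ((⋂ i, ⋂ ψ, {p | x i.succ ψ + p.2 i ψ ≤ G.lim i.succ ψ}) ∩
        ((⋂ i, ⋂ ψ, ⋂ (_ : ¬ G.Active x i ψ), {p | p.2 i ψ = 0}) ∩
        ((⋂ i, {p | ∑ ψ, p.2 i ψ = 0}) ∩
        ((⋂ ψ, ⋂ (_ : G.OpenBoundary x ψ), {p | ∑ i, p.2 i ψ = -(p.1 / G.d 0 ψ)}) ∩
        ((⋂ ψ, ⋂ (_ : ¬ G.OpenBoundary x ψ), {p | 0 ≤ ∑ i, p.2 i ψ}) ∩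
        (⋂ ψ, ⋂ (_ : ¬ G.OpenBoundary x ψ), ⋂ (_ : G.mu x 0 ψ < t),
          {p | ∑ i, p.2 i ψ ≤ (t - p.1 - G.mu x 0 ψ) / G.d 0 ψ})))))))) := by
      ext p
      simp only [hS, Set.mem_ofPred_eq, Set.mem_inter_iff, Set.mem_iInter]
      exact ⟨fun ⟨h1, h2, h3⟩ => ⟨h1, h2, h3.1, h3.2, h3.3, h3.4, h3.5, h3.6, h3.7⟩,
        fun ⟨h1, h2, h3, h4, h5, h6, h7, h8, h9⟩ => ⟨h1, h2, h3, h4, h5, h6, h7, h8, h9⟩⟩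
    rw [this]
    refine IsClosed.inter ?_ (IsClosed.inter ?_ (IsClosed.inter ?_ (IsClosed.inter ?_
      (IsClosed.inter ?_ (IsClosed.inter ?_ (IsClosed.inter ?_ (IsClosed.inter ?_ ?_)))))))
    · exact isClosed_le (by fun_prop) (by fun_prop)
    · exact isClosed_iInter fun _ => isClosed_iInter fun _ =>
        isClosed_le (by fun_prop) (by fun_prop)
    · exact isClosed_iInter fun _ => isClosed_iInter fun _ =>
        isClosed_le (by fun_prop) (by fun_prop)
    · exact isClosed_iInter fun _ => isClosed_iInter fun _ =>
        isClosed_le (by fun_prop) (by fun_prop)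
    · exact isClosed_iInter fun _ => isClosed_iInter fun _ => isClosed_iInter fun _ =>
        isClosed_eq (by fun_prop) (by fun_prop)
    · exact isClosed_iInter fun _ => isClosed_eq (by fun_prop) (by fun_prop)
    · exact isClosed_iInter fun _ => isClosed_iInter fun _ =>
        isClosed_eq (by fun_prop) (by fun_prop)
    · exact isClosed_iInter fun _ => isClosed_iInter fun _ =>
        isClosed_le (by fun_prop) (by fun_prop)
    · exact isClosed_iInter fun _ => isClosed_iInter fun _ => isClosed_iInter fun _ =>
        isClosed_le (by fun_prop) (by fun_prop)
  rw [himage]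
  refine ((isCompact_Icc.of_isClosed_subset hclosed hsub).image continuous_fst).exists_isGreatest
    ⟨0, (0, 0), ⟨le_rfl, fun ψ h => sub_nonneg.2 h.le, hx.rerouteMove_zero hG⟩, rfl⟩

theorem exists_reroutes (hG : G.Valid) (hx : Invariant G x) (hloop : G.LoopCondition x) :
    ∃ y, G.Reroutes x y := by
  obtain ⟨t, ht⟩ := exists_isCatcherThreshold hG hloop
  obtain ⟨Δ, hΔ⟩ := exists_isGreatest_rerouteSet hG hx ht
  obtain ⟨f, hf, _⟩ := hΔ.1.2.2
  exact ⟨Fin.cons (x 0) fun i ψ =>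
    x i.succ ψ + (f (.evader i) (.site ψ) - f (.site ψ) (.evader i)), t, Δ, f, ht, hΔ, hf, rfl,
    fun i ψ => rfl⟩

/-- If no good site exists at `w`, every open boundary site has a residual walk to some site that
is not on the open boundary. Pushing a little along all these walks lowers the threshold further,
provided that no site below the threshold has reached it. -/
theorem exists_mem_rerouteSet_of_increaseFails (hG : G.Valid) (hx : Invariant G x)
    (ht : G.IsCatcherThreshold x t) (hΔ : 0 ≤ Δ) {w : Profile n Ψ} (hw : Invariant G w)
    (hm : RerouteMove G x t Δ fun i ψ => w i.succ ψ - x i.succ ψ)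
    (hact : ∀ i ψ, G.Active w i ψ ↔ G.Active x i ψ)
    (hopen : ∀ ψ, G.OpenBoundary w ψ ↔ G.OpenBoundary x ψ)
    (hslack : ∀ ψ, G.mu x 0 ψ < t → G.mu w 0 ψ < t - Δ) (hfail : G.IncreaseFails w) :
    ∃ ε > 0, Δ + ε ∈ G.rerouteSet x t := by
  classical
  have hesc : ∀ ψ, G.OpenBoundary w ψ → ∃ φ, ¬ G.OpenBoundary w φ ∧
      ∃ s, ResWalk G w (.site ψ) (.site φ) s := by
    intro ψ hψ
    by_contra! hno
    refine hfail ψ ⟨hψ, fun φ hφ => ?_⟩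
    by_contra hφ'
    obtain ⟨s, hs⟩ := dist_lt_top_iff.1 hφ
    exact hno φ hφ' s hs
  choose! φ hφ s hwalk using hesc
  have hmat := fun ψ (h : G.OpenBoundary w ψ) => exists_matrix_of_resWalk (hwalk ψ h)
  choose! N hN hrow hcol _ using hmat
  set B : Finset Ψ := Finset.univ.filter fun ψ => G.OpenBoundary w ψ with hB
  have hmemB : ∀ {ψ}, ψ ∈ B ↔ G.OpenBoundary w ψ := by simp [hB]
  -- The combination of the unit walks lowers `μ_0` by one on every open boundary site.
  set M : Fin n → Ψ → ℝ := fun i ψ => ∑ β ∈ B, (G.d 0 β)⁻¹ * N β i ψ with hM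
  have hd := fun β => inv_pos.2 (hG.d_catcher β)
  have hMpush : Pushable G w M := by
    intro i ψ
    constructor
    · intro hpos
      by_contra hno
      refine hpos.not_ge (Finset.sum_nonpos fun β hβ => ?_)
      exact mul_nonpos_of_nonneg_of_nonpos (hd β).le
        (not_lt.1 fun h => hno ((hN β (hmemB.1 hβ) i ψ).1 h))
    · intro hneg
      by_contra hno
      refine hneg.not_ge (Finset.sum_nonneg fun β hβ => ?_)
      exact mul_nonneg (hd β).le (not_lt.1 fun h => hno ((hN β (hmemB.1 hβ) i ψ).2 h))
  have hMrow : ∀ i, ∑ ψ, M i ψ = 0 := by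
    intro i
    rw [Finset.sum_comm]
    refine Finset.sum_eq_zero fun β hβ => ?_
    rw [← Finset.mul_sum, hrow β (hmemB.1 hβ)]
    simp
  have hMcol : ∀ ψ, ∑ i, M i ψ = ∑ β ∈ B, (G.d 0 β)⁻¹ *
      ((if φ β = ψ then 1 else 0) - (if β = ψ then 1 else 0)) := by
    intro ψ
    rw [Finset.sum_comm]
    refine Finset.sum_congr rfl fun β hβ => ?_
    rw [← Finset.mul_sum, hcol β (hmemB.1 hβ)]
    simp only [Node.site.injEq]
  have hMopen : ∀ ψ, G.OpenBoundary w ψ → ∑ i, M i ψ = -(G.d 0 ψ)⁻¹ := by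
    intro ψ hψ
    rw [hMcol, Finset.sum_eq_single_of_mem ψ (hmemB.2 hψ)]
    · rw [if_neg (fun h : φ ψ = ψ => hφ ψ hψ (h.symm ▸ hψ)), if_pos rfl]
      ring
    · intro β hβ hne
      rw [if_neg (fun h : φ β = ψ => hφ β (hmemB.1 hβ) (h.symm ▸ hψ)), if_neg hne]
      ring
  have hMnonneg : ∀ ψ, ¬ G.OpenBoundary w ψ → 0 ≤ ∑ i, M i ψ := by
    intro ψ hψ
    rw [hMcol]
    refine Finset.sum_nonneg fun β hβ => mul_nonneg (hd β).le ?_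
    rw [if_neg (fun h : β = ψ => hψ (h ▸ hmemB.1 hβ))]
    split_ifs <;> simp
  obtain ⟨ε₁, hε₁, hbound⟩ := hMpush.exists_pos hw
  obtain ⟨ε₂, hε₂, hsl⟩ := exists_pos_forall_le
    (fun ψ => if G.mu x 0 ψ < t ∧ ¬ G.OpenBoundary w ψ then
      (t - Δ - G.mu w 0 ψ) / (1 + G.d 0 ψ * ∑ i, M i ψ) else 1) (by
    intro ψ
    split_ifs with h
    · refine div_pos (sub_pos.2 (hslack ψ h.1)) ?_
      have := mul_nonneg (hG.d_catcher ψ).le (hMnonneg ψ h.2)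
      linarith
    · exact one_pos)
  set ε := min ε₁ ε₂ with hε
  have hε0 : 0 < ε := lt_min hε₁ hε₂
  have hmu : ∀ ψ, G.mu w 0 ψ - G.mu x 0 ψ = G.d 0 ψ * ∑ i : Fin n, (w i.succ ψ - x i.succ ψ) :=
    fun ψ => by
      rw [mu_zero, mu_zero, sum_sub_eq_load_sub]
      ring
  have hnotopen : ∀ {ψ}, ¬ G.OpenBoundary x ψ → ¬ G.OpenBoundary w ψ := fun h => mt (hopen _).1 h
  have hkey : ∀ ψ, ¬ G.OpenBoundary x ψ → G.mu x 0 ψ < t →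
      G.mu w 0 ψ + G.d 0 ψ * (ε * ∑ i, M i ψ) ≤ t - (Δ + ε) := by
    intro ψ hψ hlt
    have h1 := hsl ψ
    rw [if_pos ⟨hlt, hnotopen hψ⟩, le_div_iff₀ (by
      have := mul_nonneg (hG.d_catcher ψ).le (hMnonneg ψ (hnotopen hψ))
      linarith)] at h1
    have h2 : ε * (1 + G.d 0 ψ * ∑ i, M i ψ) ≤ ε₂ * (1 + G.d 0 ψ * ∑ i, M i ψ) := by
      refine mul_le_mul_of_nonneg_right (min_le_right _ _) ?_
      have := mul_nonneg (hG.d_catcher ψ).le (hMnonneg ψ (hnotopen hψ))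
      linarith
    linarith
  have hsum : ∀ ψ, ∑ i : Fin n, (w i.succ ψ - x i.succ ψ + ε * M i ψ) =
      ∑ i : Fin n, (w i.succ ψ - x i.succ ψ) + ε * ∑ i, M i ψ := fun ψ => by
    rw [Finset.sum_add_distrib, Finset.mul_sum]
  refine ⟨ε, hε0, (mem_rerouteSet_iff hG hx).2 ⟨by linarith, fun ψ hlt => ?_,
    fun i ψ => w i.succ ψ - x i.succ ψ + ε * M i ψ, ?_⟩⟩
  · by_cases hψ : G.OpenBoundary x ψ
    · exact absurd (hψ.mu_eq ht) hlt.ne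
    · have h1 := hkey ψ hψ hlt
      have h2 := hmu ψ
      have h3 := mul_nonneg (hG.d_catcher ψ).le (hm.col_nonneg ψ hψ)
      have h4 := mul_nonneg (hG.d_catcher ψ).le (mul_nonneg hε0.le (hMnonneg ψ (hnotopen hψ)))
      linarith
  · refine ⟨fun i ψ => ?_, fun i ψ => ?_, fun i ψ ha => ?_, fun i => ?_, fun ψ h => ?_,
      fun ψ h => ?_, fun ψ h hlt => ?_⟩
    · have := (hbound ε hε0.le (min_le_left _ _) i ψ).1
      linarith
    · have := (hbound ε hε0.le (min_le_left _ _) i ψ).2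
      linarith
    · rw [hm.inactive i ψ ha, hMpush.eq_zero (mt (hact i ψ).1 ha)]
      ring
    · rw [Finset.sum_add_distrib, hm.row i, ← Finset.mul_sum, hMrow]
      ring
    · rw [hsum, hm.col_open ψ h, hMopen ψ ((hopen ψ).2 h)]
      ring
    · rw [hsum]
      exact add_nonneg (hm.col_nonneg ψ h) (mul_nonneg hε0.le (hMnonneg ψ (hnotopen h)))
    · rw [hsum, le_div_iff₀ (hG.d_catcher ψ)]
      have h1 := hkey ψ h hlt
      have h2 := hmu ψ
      linarith

end

end CEGame

namespace CEGame

variable {n : ℕ} {Ψ : Type*} {G : CEGame n Ψ} {x y z : Profile n Ψ} {t Δ : ℝ} {ψ₀ : Ψ}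

section

variable [Fintype Ψ]

/-- A rerouting step that lowers the catcher's threshold from `t` to `t - Δ`. -/
structure RerouteStep (G : CEGame n Ψ) (y z : Profile n Ψ) (t Δ : ℝ) : Prop where
  threshold : G.IsCatcherThreshold y t
  pos : 0 < Δ
  greatest : IsGreatest (G.rerouteSet y t) Δ
  catcher : z 0 = y 0
  move : RerouteMove G y t Δ fun i ψ => z i.succ ψ - y i.succ ψ

/-- Rerouting after a failed increase lowers the threshold strictly. -/
theorem Reroutes.exists_step (hG : G.Valid) (hy : Invariant G y) (hfail : G.IncreaseFails y)
    (h : G.Reroutes y z) : ∃ t Δ, RerouteStep G y z t Δ := by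
  obtain ⟨t, Δ, f, ht, hΔ, hf, h0, hev⟩ := h
  obtain ⟨g, hg, hgs⟩ := hΔ.1.2.2
  refine ⟨t, Δ, ht, ?_, hΔ, h0, ?_⟩
  · obtain ⟨ε, hε, hmem⟩ := exists_mem_rerouteSet_of_increaseFails hG hy ht le_rfl hy
      (by simp only [sub_self]; exact hy.rerouteMove_zero hG) (fun _ _ => Iff.rfl)
      (fun _ => Iff.rfl) (fun ψ h => by simpa using h) hfail
    have := hΔ.2 hmem
    linarith
  · simpa only [hev, add_sub_cancel_left] using
      rerouteMove_of_isFlow hy hf.1 (saturatesSource_of_isMaxFlow hg.1 hgs hf)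

namespace RerouteStep

theorem activeMove (h : RerouteStep G y z t Δ) : ActiveMove G y z where
  catcher := h.catcher
  nonneg i ψ := by simpa using h.move.nonneg i ψ
  le_lim i ψ := by simpa using h.move.le_lim i ψ
  inactive i ψ ha := sub_eq_zero.1 (h.move.inactive i ψ ha)
  sum_eq i := by simpa [sub_eq_zero] using h.move.row i

theorem load_lt (h : RerouteStep G y z t Δ) (hG : G.Valid) {ψ : Ψ} (hψ : G.OpenBoundary y ψ) :
    load z ψ < load y ψ := by
  have := h.move.col_open ψ hψ
  rw [sum_sub_eq_load_sub] at this
  have := div_pos h.pos (hG.d_catcher ψ)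
  linarith

theorem mu_open (h : RerouteStep G y z t Δ) (hG : G.Valid) {ψ : Ψ} (hψ : G.OpenBoundary y ψ) :
    G.mu z 0 ψ = t - Δ := by
  have h1 := h.move.col_open ψ hψ
  rw [sum_sub_eq_load_sub, ← neg_div, eq_div_iff (hG.d_catcher ψ).ne'] at h1
  have h2 := hψ.mu_eq h.threshold
  rw [mu_zero] at h2 ⊢
  linarith

theorem mu_le (h : RerouteStep G y z t Δ) (hG : G.Valid) {ψ : Ψ}
    (hψ : ¬ G.OpenBoundary y ψ) : G.mu y 0 ψ ≤ G.mu z 0 ψ := by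
  have h1 := h.move.col_nonneg ψ hψ
  rw [sum_sub_eq_load_sub] at h1
  rw [mu_zero, mu_zero]
  have := mul_nonneg (hG.d_catcher ψ).le h1
  linarith

theorem mu_le_of_lt (h : RerouteStep G y z t Δ) (hG : G.Valid) {ψ : Ψ}
    (hψ : y 0 ψ < G.lim 0 ψ) : G.mu z 0 ψ ≤ t - Δ := by
  by_cases ho : G.OpenBoundary y ψ
  · exact (h.mu_open hG ho).le
  · have hlt : G.mu y 0 ψ < t :=
      not_le.1 fun hle => ho ((openBoundary_iff h.threshold).2 ⟨hle, hψ⟩)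
    have h1 := h.move.col_le ψ ho hlt
    rw [sum_sub_eq_load_sub, le_div_iff₀ (hG.d_catcher ψ)] at h1
    rw [mu_zero] at h1 ⊢
    linarith

theorem le_mu (h : RerouteStep G y z t Δ) (hG : G.Valid) {ψ : Ψ}
    (hψ : t ≤ G.mu y 0 ψ) : t - Δ ≤ G.mu z 0 ψ := by
  by_cases ho : G.OpenBoundary y ψ
  · exact (h.mu_open hG ho).ge
  · linarith [h.mu_le hG ho, h.pos]

theorem isCatcherThreshold (h : RerouteStep G y z t Δ) (hG : G.Valid) :
    G.IsCatcherThreshold z (t - Δ) := by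
  obtain ⟨φ, hφ⟩ := exists_openBoundary h.threshold
  refine ⟨⟨φ, by rw [h.catcher]; exact hφ.2, (h.mu_open hG hφ).symm⟩, ?_⟩
  rintro _ ⟨ψ, hψ, rfl⟩
  rw [h.catcher] at hψ
  exact h.mu_le_of_lt hG hψ

theorem invariant (h : RerouteStep G y z t Δ) (hG : G.Valid) (hy : Invariant G y) :
    Invariant G z := by
  refine h.activeMove.invariant hy fun ψ φ hψ hφ => ?_
  obtain ⟨β, hβ⟩ := exists_openBoundary h.threshold
  refine (h.mu_le_of_lt hG hφ).trans (h.le_mu hG ?_)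
  rw [← hβ.mu_eq h.threshold]
  exact hy.exchange 0 ψ β hψ hβ.2

end RerouteStep

end

/-! ### Cuts and reachability -/

/-- `K` is closed under residual edges. -/
def ResClosed (G : CEGame n Ψ) (x : Profile n Ψ) (K : Set (Node n Ψ)) : Prop :=
  ∀ u ∈ K, ∀ v, 0 < G.resCap x u v → v ∈ K

theorem resClosed_reach : ResClosed G x (Reach G x ψ₀) := fun _ hu _ e => reach_step hu e

theorem reach_subset_of_resClosed {K : Set (Node n Ψ)} (hK : ResClosed G x K)
    (h : Node.site ψ₀ ∈ K) : Reach G x ψ₀ ⊆ K := by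
  rintro v ⟨s, hs⟩
  induction hs with
  | nil => exact h
  | step _ e ih => exact hK _ ih _ e

section

variable [Fintype Ψ]

open Classical in
/-- If `K` is closed, the evaders in `K` have as much resource outside `K`, and the other evaders
as little in `K`, as the edge states allow. -/
theorem sum_filter_nonneg (hx : Invariant G x) (hy : Invariant G y)
    (hS : G.edgeState x = G.edgeState y) {K : Set (Node n Ψ)} (hK : ResClosed G x K) (i : Fin n) :
    0 ≤ ∑ ψ with Node.site ψ ∈ K, (y i.succ ψ - x i.succ ψ) ∧
      (∑ ψ with Node.site ψ ∈ K, (y i.succ ψ - x i.succ ψ) = 0 →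
        ∀ ψ, ¬ (Node.evader i ∈ K ↔ Node.site ψ ∈ K) → y i.succ ψ = x i.succ ψ) := by
  by_cases hi : Node.evader i ∈ K
  · have hle : ∀ ψ ∈ Finset.univ.filter (fun ψ => ¬ Node.site ψ ∈ K),
        y i.succ ψ ≤ x i.succ ψ := by
      intro ψ hψ
      by_cases ha : G.Active x i ψ
      · refine (hy.le_lim _ _).trans (not_lt.1 fun hlt => ?_)
        exact (Finset.mem_filter.1 hψ).2 (hK _ hi _ (resCap_evader_site_pos.2 ⟨ha, hlt⟩))
      · exact (hx.eq_of_edgeState hy hS ha).ge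
    have hsum : ∑ ψ with Node.site ψ ∈ K, (y i.succ ψ - x i.succ ψ) =
        ∑ ψ with ¬ Node.site ψ ∈ K, (x i.succ ψ - y i.succ ψ) := by
      have h1 := Finset.sum_filter_add_sum_filter_not Finset.univ (fun ψ => Node.site ψ ∈ K)
        (fun ψ => y i.succ ψ - x i.succ ψ)
      rw [Finset.sum_sub_distrib (s := Finset.univ), hx.sum_evader, hy.sum_evader, sub_self] at h1
      rw [← sub_eq_zero, ← h1, sub_eq_add_neg, ← Finset.sum_neg_distrib]
      simp only [neg_sub]
    rw [hsum]
    refine ⟨Finset.sum_nonneg fun ψ hψ => sub_nonneg.2 (hle ψ hψ), fun h0 ψ hψ => ?_⟩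
    have hψ' : ψ ∈ Finset.univ.filter (fun ψ => ¬ Node.site ψ ∈ K) := by
      simpa [hi] using hψ
    exact (sub_eq_zero.1 ((Finset.sum_eq_zero_iff_of_nonneg
      fun ψ hψ => sub_nonneg.2 (hle ψ hψ)).1 h0 ψ hψ')).symm
  · have hle : ∀ ψ ∈ Finset.univ.filter (fun ψ => Node.site ψ ∈ K),
        x i.succ ψ ≤ y i.succ ψ := by
      intro ψ hψ
      by_cases ha : G.Active x i ψ
      · refine le_trans (not_lt.1 fun hlt => hi ?_) (hy.nonneg _ _)
        exact hK _ (Finset.mem_filter.1 hψ).2 _ (resCap_site_evader_pos.2 ⟨ha, hlt⟩)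
      · exact (hx.eq_of_edgeState hy hS ha).le
    refine ⟨Finset.sum_nonneg fun ψ hψ => sub_nonneg.2 (hle ψ hψ), fun h0 ψ hψ => ?_⟩
    have hψ' : ψ ∈ Finset.univ.filter (fun ψ => Node.site ψ ∈ K) := by
      simpa [hi] using hψ
    exact sub_eq_zero.1 ((Finset.sum_eq_zero_iff_of_nonneg
      fun ψ hψ => sub_nonneg.2 (hle ψ hψ)).1 h0 ψ hψ')

open Classical in
theorem sum_load_sub (K : Set (Node n Ψ)) :
    ∑ ψ with Node.site ψ ∈ K, (load y ψ - load x ψ) =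
      ∑ i : Fin n, ∑ ψ with Node.site ψ ∈ K, (y i.succ ψ - x i.succ ψ) := by
  rw [Finset.sum_comm]
  exact Finset.sum_congr rfl fun ψ _ => (sum_sub_eq_load_sub x y ψ).symm

open Classical in
/-- A closed set has the smallest load among all profiles with the same edge states. -/
theorem sum_load_le_of_resClosed (hx : Invariant G x) (hy : Invariant G y)
    (hS : G.edgeState x = G.edgeState y) {K : Set (Node n Ψ)} (hK : ResClosed G x K) :
    ∑ ψ with Node.site ψ ∈ K, load x ψ ≤ ∑ ψ with Node.site ψ ∈ K, load y ψ := by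
  rw [← sub_nonneg, ← Finset.sum_sub_distrib, sum_load_sub]
  exact Finset.sum_nonneg fun i _ => (sum_filter_nonneg hx hy hS hK i).1

/-- Whether a set is closed depends on the edge states and the loads only. -/
theorem ResClosed.congr (hx : Invariant G x) (hy : Invariant G y)
    (hS : G.edgeState x = G.edgeState y) (hl : load x = load y) {K : Set (Node n Ψ)}
    (hK : ResClosed G x K) : ResClosed G y K := by
  classical
  have h0 := sum_load_sub (x := x) (y := y) K
  simp only [hl, sub_self, Finset.sum_const_zero] at h0
  have h1 := (Finset.sum_eq_zero_iff_of_nonneg fun i _ =>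
    (sum_filter_nonneg hx hy hS hK i).1).1 h0.symm
  have hact : ∀ i ψ, G.Active y i ψ ↔ G.Active x i ψ := fun i ψ => by
    rw [active_iff_edgeState, active_iff_edgeState, hS]
  have heq : ∀ i ψ, ¬ (Node.evader i ∈ K ↔ Node.site ψ ∈ K) → y i.succ ψ = x i.succ ψ :=
    fun i => (sum_filter_nonneg hx hy hS hK i).2 (h1 i (Finset.mem_univ _))
  intro u hu v e
  obtain ⟨i, ψ, ⟨rfl, rfl⟩ | ⟨rfl, rfl⟩⟩ := resCap_pos_cases e
  · by_contra hv
    rw [resCap_evader_site_pos, hact, heq i ψ (by simp [hu, hv])] at e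
    exact hv (hK _ hu _ (resCap_evader_site_pos.2 e))
  · by_contra hv
    rw [resCap_site_evader_pos, hact, heq i ψ (by simp [hu, hv])] at e
    exact hv (hK _ hu _ (resCap_site_evader_pos.2 e))

/-- Reachability depends on the edge states and the loads only: by symmetry the two sets are
equal. -/
theorem reach_subset (hx : Invariant G x) (hy : Invariant G y)
    (hS : G.edgeState x = G.edgeState y) (hl : load x = load y) (ψ : Ψ) :
    Reach G x ψ ⊆ Reach G y ψ :=
  reach_subset_of_resClosed (resClosed_reach.congr hy hx hS.symm hl.symm) (mem_reach_self ψ)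

namespace IncreaseStep

/-- A residual edge survives an increase if the evader's utility on it falls as fast as the
threshold, because the evaders' allocation does not change. -/
theorem resCap_pos (h : IncreaseStep G y z ψ₀ Δ) (hG : ∀ (i : Fin n) ψ, G.d i.succ ψ < 0)
    (hc : NoNegativeCycle G y) {u v : Node n Ψ} (e : 0 < G.resCap y u v)
    (hr : ∀ i ψ, (u = .evader i ∧ v = .site ψ) ∨ (u = .site ψ ∧ v = .evader i) →
      G.rate y ψ₀ (.site ψ) * -G.d i.succ ψ = G.rate y ψ₀ (.evader i)) :
    0 < G.resCap z u v := by
  obtain ⟨i, ψ, ⟨rfl, rfl⟩ | ⟨rfl, rfl⟩⟩ := resCap_pos_cases e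
  · rw [resCap_evader_site_pos] at e ⊢
    rw [h.evader]
    exact ⟨h.active_of_tight hG hc e.1 (hr i ψ (.inl ⟨rfl, rfl⟩)), e.2⟩
  · rw [resCap_site_evader_pos] at e ⊢
    rw [h.evader]
    exact ⟨h.active_of_tight hG hc e.1 (hr i ψ (.inr ⟨rfl, rfl⟩)), e.2⟩

/-- The tight paths from `ψ₀` survive an increase. -/
theorem reach_subset (h : IncreaseStep G y z ψ₀ Δ) (hG : ∀ (i : Fin n) ψ, G.d i.succ ψ < 0)
    (hc : NoNegativeCycle G y) : Reach G y ψ₀ ⊆ Reach G z ψ₀ := by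
  intro v hv
  have hp := reach_reflTransGen_tightEdge hc hv
  clear hv
  induction hp with
  | refl => exact mem_reach_self ψ₀
  | @tail u v _ e ih =>
    refine reach_step ih (h.resCap_pos hG hc e.1 fun i ψ hcase => ?_)
    obtain ⟨j, φ, hcase', -, he⟩ := e.cases hG
    rcases hcase with ⟨rfl, rfl⟩ | ⟨rfl, rfl⟩ <;> rcases hcase' with ⟨h1, h2, -⟩ | ⟨h1, h2, -⟩ <;>
      simp_all

/-- Residual edges outside the set that is reachable from `ψ₀` survive an increase, because
nothing moves there. -/
theorem reach_subset_union (h : IncreaseStep G y z ψ₀ Δ)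
    (hG : ∀ (i : Fin n) ψ, G.d i.succ ψ < 0) (hc : NoNegativeCycle G y) (ψ : Ψ) :
    Reach G y ψ ⊆ Reach G y ψ₀ ∪ Reach G z ψ := by
  rintro v ⟨s, hs⟩
  induction hs with
  | nil => exact .inr (mem_reach_self ψ)
  | @step u v s _ e ih =>
    by_cases hu : u ∈ Reach G y ψ₀
    · exact .inl (reach_step hu e)
    by_cases hv : v ∈ Reach G y ψ₀
    · exact .inl hv
    refine .inr (reach_step (ih.resolve_left hu) (h.resCap_pos hG hc e fun i φ hcase => ?_))
    rcases hcase with ⟨rfl, rfl⟩ | ⟨rfl, rfl⟩ <;> simp [rate_of_notMem hu, rate_of_notMem hv]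

end IncreaseStep

end

end CEGame

/-! ### Progress of the boundary -/

namespace CEGame

variable {n : ℕ} {Ψ : Type*} {G : CEGame n Ψ} {x y z : Profile n Ψ} {t Δ : ℝ} {ψ₀ : Ψ}

/-- The sites at which `μ_0` has at least reached the catcher's threshold. -/
def Upper (G : CEGame n Ψ) (x : Profile n Ψ) : Set Ψ :=
  {ψ | ∃ t, G.IsCatcherThreshold x t ∧ t ≤ G.mu x 0 ψ}

/-- The sites at which the catcher's limit is exhausted. -/
def Filled (G : CEGame n Ψ) (x : Profile n Ψ) : Set Ψ := {ψ | G.lim 0 ψ ≤ x 0 ψ}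

/-- A potential that never decreases during a run; while it stays constant, so does the set of
open boundary sites. -/
noncomputable def boundaryProgress (G : CEGame n Ψ) (x : Profile n Ψ) : ℕ :=
  (G.Upper x).ncard + (G.Filled x).ncard

theorem openBoundary_iff_upper {ψ : Ψ} :
    G.OpenBoundary x ψ ↔ ψ ∈ G.Upper x ∧ ψ ∉ G.Filled x := by
  constructor
  · exact fun h => ⟨⟨_, h.1, le_rfl⟩, not_le.2 h.2⟩
  · rintro ⟨⟨t, ht, hle⟩, hf⟩
    exact (openBoundary_iff ht).2 ⟨hle, not_le.1 hf⟩

theorem mem_upper_iff (ht : G.IsCatcherThreshold x t) {ψ : Ψ} :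
    ψ ∈ G.Upper x ↔ t ≤ G.mu x 0 ψ := by
  refine ⟨?_, fun h => ⟨t, ht, h⟩⟩
  rintro ⟨s, hs, h⟩
  rwa [ht.unique hs]

theorem filled_mono (h : ∀ ψ, x 0 ψ ≤ y 0 ψ) : G.Filled x ⊆ G.Filled y :=
  fun ψ hψ => le_trans (b := x 0 ψ) hψ (h ψ)

theorem upper_congr (h0 : x 0 = y 0) (hl : load x = load y) : G.Upper x = G.Upper y := by
  have hmu : G.mu x 0 = G.mu y 0 := funext fun ψ => by rw [mu_zero, mu_zero, hl]
  unfold Upper IsCatcherThreshold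
  rw [h0, hmu]

theorem filled_congr (h0 : x 0 = y 0) : G.Filled x = G.Filled y := by
  unfold Filled
  rw [h0]

/-- The allocation of the catcher at the sites and the negative thresholds at the evaders; an
increase adds `Δ γ_v` at each vertex `v`. -/
noncomputable def nodePotential (G : CEGame n Ψ) (x : Profile n Ψ) : Node n Ψ → ℝ
  | .site ψ => x 0 ψ
  | .evader i => -G.thr x i
  | _ => 0

theorem notMem_reach_source : Node.source ∉ Reach G x ψ₀ := by
  rintro ⟨s, hs⟩
  cases hs with
  | step _ e =>
    obtain ⟨i, ψ, ⟨_, h⟩ | ⟨_, h⟩⟩ := resCap_pos_cases e <;> simp at h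

theorem notMem_reach_sink : Node.sink ∉ Reach G x ψ₀ := by
  rintro ⟨s, hs⟩
  cases hs with
  | step _ e =>
    obtain ⟨i, ψ, ⟨_, h⟩ | ⟨_, h⟩⟩ := resCap_pos_cases e <;> simp at h

/-- The position of an edge relative to the threshold is an affine function of the potentials. -/
theorem mu_sub_thr (i : Fin n) (ψ : Ψ) : G.mu x i.succ ψ - G.thr x i =
    G.b i.succ ψ + G.d i.succ ψ * nodePotential G x (.site ψ) + nodePotential G x (.evader i) := by
  rw [mu_succ]
  simp only [nodePotential]
  ring

section

variable [Fintype Ψ]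

theorem IncreaseStep.nodePotential_eq (h : IncreaseStep G y z ψ₀ Δ)
    (hG : ∀ (i : Fin n) ψ, G.d i.succ ψ < 0) (hc : NoNegativeCycle G y) (v : Node n Ψ) :
    nodePotential G z v = nodePotential G y v + Δ * G.rate y ψ₀ v := by
  rcases v with _ | i | ψ | _
  · simp [nodePotential, rate_of_notMem notMem_reach_source]
  · simp only [nodePotential, h.thr_eq hG hc]
    ring
  · exact h.catcher ψ
  · simp [nodePotential, rate_of_notMem notMem_reach_sink]

theorem Realloc.nodePotential_eq (h : Realloc G x y) (hx : Invariant G x) :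
    nodePotential G y = nodePotential G x := by
  funext v
  rcases v with _ | i | ψ | _
  · rfl
  · simp only [nodePotential, h.move.thr_eq hx]
  · exact congrFun h.move.catcher ψ
  · rfl

/-- An increase leaves `μ_0` unchanged and closes sites at most, so the threshold cannot rise. -/
theorem IncreaseStep.upper_subset (h : IncreaseStep G y z ψ₀ Δ)
    (ht : G.IsCatcherThreshold z t) : G.Upper y ⊆ G.Upper z := by
  rintro ψ ⟨s, hs, hle⟩
  refine ⟨t, ht, ?_⟩
  obtain ⟨φ, hφ, rfl⟩ := ht.1
  rw [h.mu_zero_eq, h.mu_zero_eq]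
  exact (hs.2 ⟨φ, (h.le_catcher φ).trans_lt hφ, rfl⟩).trans hle

theorem RerouteStep.upper_subset (h : RerouteStep G y z t Δ) (hG : G.Valid) :
    G.Upper y ⊆ G.Upper z := fun _ hψ =>
  ⟨t - Δ, h.isCatcherThreshold hG, h.le_mu hG ((mem_upper_iff h.threshold).1 hψ)⟩

/-- While the catcher has resource left, some site is not filled; hence there are an open boundary
site and at most `|Ψ| - 1` filled sites. -/
theorem boundaryProgress_mem (hG : G.Valid) (hloop : G.LoopCondition x) :
    G.boundaryProgress x ∈ Finset.Icc 1 (2 * Fintype.card Ψ - 1) := by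
  obtain ⟨t, ht⟩ := exists_isCatcherThreshold hG hloop
  obtain ⟨φ, hφ⟩ := exists_openBoundary ht
  rw [openBoundary_iff_upper] at hφ
  have h1 : 0 < (G.Upper x).ncard := (Set.ncard_pos (Set.toFinite _)).2 ⟨φ, hφ.1⟩
  have h2 : (G.Upper x).ncard ≤ Fintype.card Ψ := by
    rw [← Nat.card_eq_fintype_card]; exact Set.ncard_le_card _
  have h3 : (G.Filled x).ncard < Fintype.card Ψ := by
    rw [← Nat.card_eq_fintype_card]
    exact Set.ncard_lt_card fun h => hφ.2 (h ▸ Set.mem_univ φ)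
  rw [Finset.mem_Icc, boundaryProgress]
  omega

/-! ### Runs -/

/-- The properties of a run that bound its length: `X j` is the profile at the loop head and
`Y j` the one after the reallocation. -/
structure Trace [LinearOrder Ψ] (G : CEGame n Ψ) (X Y : ℕ → Profile n Ψ) (k : ℕ) : Prop where
  invariant : ∀ j < k, Invariant G (X j)
  realloc : ∀ j < k, Realloc G (X j) (Y j)
  loop : ∀ j < k, G.LoopCondition (X j)
  step : ∀ j < k,
    (∃ ψ₀ Δ, IncreaseStep G (Y j) (X (j + 1)) ψ₀ Δ ∧ ∀ φ < ψ₀, ¬ G.GoodSite (Y j) φ) ∨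
      (G.IncreaseFails (Y j) ∧ ∃ t Δ, RerouteStep G (Y j) (X (j + 1)) t Δ)

variable [LinearOrder Ψ] {X Y : ℕ → Profile n Ψ} {k : ℕ}

namespace Trace

theorem invariant_realloc (h : Trace G X Y k) {j : ℕ} (hj : j < k) : Invariant G (Y j) :=
  (h.realloc j hj).invariant (h.invariant j hj)

theorem upper_eq (h : Trace G X Y k) {j : ℕ} (hj : j < k) : G.Upper (Y j) = G.Upper (X j) :=
  upper_congr (h.realloc j hj).move.catcher (h.realloc j hj).load_eq

theorem filled_eq (h : Trace G X Y k) {j : ℕ} (hj : j < k) : G.Filled (Y j) = G.Filled (X j) :=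
  filled_congr (h.realloc j hj).move.catcher

theorem subset_succ (h : Trace G X Y k) (hG : G.Valid) {j : ℕ} (hj : j + 1 < k) :
    G.Upper (X j) ⊆ G.Upper (X (j + 1)) ∧ G.Filled (X j) ⊆ G.Filled (X (j + 1)) := by
  rw [← h.upper_eq (by omega : j < k), ← h.filled_eq (by omega : j < k)]
  rcases h.step j (by omega) with ⟨ψ₀, Δ, hs, -⟩ | ⟨-, t, Δ, hs⟩
  · obtain ⟨t, ht⟩ := exists_isCatcherThreshold hG (h.loop (j + 1) hj)
    exact ⟨hs.upper_subset ht, filled_mono hs.le_catcher⟩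
  · exact ⟨hs.upper_subset hG, (filled_congr hs.catcher).ge⟩

theorem subset_of_le (h : Trace G X Y k) (hG : G.Valid) {i j : ℕ} (hij : i ≤ j) (hj : j < k) :
    G.Upper (X i) ⊆ G.Upper (X j) ∧ G.Filled (X i) ⊆ G.Filled (X j) := by
  induction j, hij using Nat.le_induction with
  | base => exact ⟨subset_rfl, subset_rfl⟩
  | succ j hij ih =>
    have h1 := ih (by omega)
    have h2 := h.subset_succ hG hj
    exact ⟨h1.1.trans h2.1, h1.2.trans h2.2⟩

/-- Between two loop heads with the same progress, the boundary does not change. -/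
theorem eq_of_progress_eq (h : Trace G X Y k) (hG : G.Valid) {i j l : ℕ} (hij : i ≤ j)
    (hjl : j ≤ l) (hl : l < k) (hp : G.boundaryProgress (X i) = G.boundaryProgress (X l)) :
    G.Upper (Y j) = G.Upper (Y i) ∧ G.Filled (Y j) = G.Filled (Y i) := by
  rw [h.upper_eq (by omega), h.upper_eq (by omega), h.filled_eq (by omega),
    h.filled_eq (by omega)]
  have h1 := h.subset_of_le hG hij (by omega)
  have h2 := h.subset_of_le hG hjl hl
  have hU := Set.ncard_le_ncard h1.1 (Set.toFinite _)
  have hF := Set.ncard_le_ncard h1.2 (Set.toFinite _)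
  have hU' := Set.ncard_le_ncard h2.1 (Set.toFinite _)
  have hF' := Set.ncard_le_ncard h2.2 (Set.toFinite _)
  unfold boundaryProgress at hp
  exact ⟨(Set.eq_of_subset_of_ncard_le h1.1 (by omega) (Set.toFinite _)).symm,
    (Set.eq_of_subset_of_ncard_le h1.2 (by omega) (Set.toFinite _)).symm⟩

theorem progress_eq (h : Trace G X Y k) (hG : G.Valid) {i j l : ℕ} (hij : i ≤ j)
    (hjl : j ≤ l) (hl : l < k) (hp : G.boundaryProgress (X i) = G.boundaryProgress (X l)) :
    G.boundaryProgress (X j) = G.boundaryProgress (X i) := by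
  have := h.eq_of_progress_eq hG hij hjl hl hp
  rw [h.upper_eq (by omega), h.filled_eq (by omega), h.upper_eq (by omega),
    h.filled_eq (by omega)] at this
  rw [boundaryProgress, boundaryProgress, this.1, this.2]

theorem openBoundary_iff_of_progress_eq (h : Trace G X Y k) (hG : G.Valid) {i j l : ℕ}
    (hij : i ≤ j) (hjl : j ≤ l) (hl : l < k)
    (hp : G.boundaryProgress (X i) = G.boundaryProgress (X l)) (ψ : Ψ) :
    G.OpenBoundary (Y j) ψ ↔ G.OpenBoundary (Y i) ψ := by
  have := h.eq_of_progress_eq hG hij hjl hl hp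
  rw [openBoundary_iff_upper, openBoundary_iff_upper, this.1, this.2]

/-- If rerouting does not extend the boundary, it has stopped at a saturated cut, so that a good
site exists in the next iteration. -/
theorem not_increaseFails_succ (h : Trace G X Y k) (hG : G.Valid) {j : ℕ} (hj : j + 1 < k)
    (hp : G.boundaryProgress (X j) = G.boundaryProgress (X (j + 1)))
    (hs : RerouteStep G (Y j) (X (j + 1)) t Δ) : ¬ G.IncreaseFails (Y (j + 1)) := by
  intro hfail
  have hre := h.realloc (j + 1) hj
  have hX := h.invariant (j + 1) hj
  have hY := h.invariant_realloc (by omega : j < k)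
  have hopen := h.openBoundary_iff_of_progress_eq hG (Nat.le_succ j) le_rfl hj hp
  have hU := (h.eq_of_progress_eq hG (Nat.le_succ j) le_rfl hj hp).1
  have hact : ∀ i ψ, G.Active (X (j + 1)) i ψ ↔ G.Active (Y j) i ψ := fun i ψ => by
    rw [active_iff_edgeState, active_iff_edgeState, hs.activeMove.edgeState_eq hY]
  have hact' : ∀ i ψ, G.Active (Y (j + 1)) i ψ ↔ G.Active (X (j + 1)) i ψ := fun i ψ => by
    rw [active_iff_edgeState, active_iff_edgeState, hre.move.edgeState_eq hX]
  have hmu : ∀ ψ, G.mu (Y (j + 1)) 0 ψ = G.mu (X (j + 1)) 0 ψ := fun ψ => by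
    rw [mu_zero, mu_zero, hre.load_eq]
  have hcol : ∀ ψ, ∑ i : Fin n, (Y (j + 1) i.succ ψ - Y j i.succ ψ) =
      ∑ i : Fin n, (X (j + 1) i.succ ψ - Y j i.succ ψ) := fun ψ => by
    rw [sum_sub_eq_load_sub, sum_sub_eq_load_sub, hre.load_eq]
  obtain ⟨ε, hε, hmem⟩ := exists_mem_rerouteSet_of_increaseFails hG hY hs.threshold hs.pos.le
    (h.invariant_realloc hj) (w := Y (j + 1)) (Δ := Δ)
    { nonneg := fun i ψ => by simpa using hre.move.nonneg i ψ
      le_lim := fun i ψ => by simpa using hre.move.le_lim i ψ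
      inactive := fun i ψ ha => by
        rw [hre.move.inactive i ψ (mt (hact i ψ).1 ha)]
        exact hs.move.inactive i ψ ha
      row := fun i => by
        rw [Finset.sum_sub_distrib, hre.move.sum_eq, ← Finset.sum_sub_distrib]
        exact hs.move.row i
      col_open := fun ψ hψ => (hcol ψ).trans (hs.move.col_open ψ hψ)
      col_nonneg := fun ψ hψ => (hs.move.col_nonneg ψ hψ).trans_eq (hcol ψ).symm
      col_le := fun ψ hψ hlt => (hcol ψ).trans_le (hs.move.col_le ψ hψ hlt) }
    (fun i ψ => (hact' i ψ).trans (hact i ψ)) hopen (fun ψ hlt => by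
      have h1 : ψ ∉ G.Upper (Y (j + 1)) := by
        rw [hU, mem_upper_iff hs.threshold]
        exact not_le.2 hlt
      rw [h.upper_eq hj, mem_upper_iff (hs.isCatcherThreshold hG)] at h1
      rw [hmu]
      exact not_le.1 h1) hfail
  have := hs.greatest.2 hmem
  linarith

/-- Rerouting strictly lowers the load of the closed set that is reachable from a good site,
which edge states do not allow, so no rerouting takes place between two occurrences of the same
edge states. -/
theorem exists_increaseStep_of_edgeState_eq (h : Trace G X Y k) (hG : G.Valid) {i l : ℕ}
    (hil : i ≤ l) (hl : l < k) (hp : G.boundaryProgress (X i) = G.boundaryProgress (X l))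
    (hS : G.edgeState (Y i) = G.edgeState (Y l)) (hgood : G.GoodSite (Y i) ψ₀) {j : ℕ}
    (hij : i ≤ j) (hjl : j < l) :
    ∃ ψ₀ Δ, IncreaseStep G (Y j) (X (j + 1)) ψ₀ Δ ∧ ∀ φ < ψ₀, ¬ G.GoodSite (Y j) φ := by
  classical
  have hB := fun {j} (hij : i ≤ j) (hjl : j ≤ l) =>
    h.openBoundary_iff_of_progress_eq hG hij hjl hl hp
  have hstep : ∀ j, i ≤ j → j < l → ∀ ψ, G.OpenBoundary (Y i) ψ →
      load (Y (j + 1)) ψ ≤ load (Y j) ψ := by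
    intro j hij hjl ψ hψ
    rw [(h.realloc (j + 1) (by omega)).load_eq]
    rcases h.step j (by omega) with ⟨ψ₀, Δ, hs, -⟩ | ⟨-, t, Δ, hs⟩
    · rw [hs.load_eq]
    · exact (hs.load_lt hG ((hB hij hjl.le ψ).2 hψ)).le
  have hle : ∀ a b, i ≤ a → a ≤ b → b ≤ l → ∀ ψ, G.OpenBoundary (Y i) ψ →
      load (Y b) ψ ≤ load (Y a) ψ := by
    intro a b hia hab hbl ψ hψ
    induction b, hab using Nat.le_induction with
    | base => exact le_rfl
    | succ b hab ih => exact (hstep b (by omega) (by omega) ψ hψ).trans (ih (by omega))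
  rcases h.step j (by omega) with hs | ⟨-, t, Δ, hs⟩
  · exact hs
  exfalso
  have hsub : ∀ ψ ∈ Finset.univ.filter (fun ψ => Node.site ψ ∈ Reach G (Y i) ψ₀),
      G.OpenBoundary (Y i) ψ := fun ψ hψ =>
    hgood.2 ψ (dist_lt_top_iff.2 (Finset.mem_filter.1 hψ).2)
  have hcut := sum_load_le_of_resClosed (h.invariant_realloc (by omega)) (h.invariant_realloc hl) hS
    (resClosed_reach (ψ₀ := ψ₀))
  refine hcut.not_gt (Finset.sum_lt_sum
    (fun ψ hψ => hle i l le_rfl hil le_rfl ψ (hsub ψ hψ)) ⟨ψ₀, ?_, ?_⟩)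
  · exact Finset.mem_filter.2 ⟨Finset.mem_univ _, mem_reach_self ψ₀⟩
  · have h1 := hle i j le_rfl hij hjl.le ψ₀ hgood.1
    have h2 := hle (j + 1) l (by omega) hjl le_rfl ψ₀ hgood.1
    have h3 := hs.load_lt hG ((hB hij hjl.le ψ₀).2 hgood.1)
    rw [(h.realloc (j + 1) (by omega)).load_eq] at h2
    linarith

/-- A site that is not good does not become good while only increases take place. -/
theorem goodSite_of_succ (h : Trace G X Y k) (hG : G.Valid) {j : ℕ} (hj : j + 1 < k)
    (hp : G.boundaryProgress (X j) = G.boundaryProgress (X (j + 1)))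
    (hs : IncreaseStep G (Y j) (X (j + 1)) ψ₀ Δ) {ψ : Ψ} (hψ : G.GoodSite (Y (j + 1)) ψ) :
    G.GoodSite (Y j) ψ := by
  have hopen := h.openBoundary_iff_of_progress_eq hG (Nat.le_succ j) le_rfl hj hp
  have hre := h.realloc (j + 1) hj
  have hX := h.invariant (j + 1) hj
  refine ⟨(hopen ψ).1 hψ.1, fun φ hφ => ?_⟩
  rw [dist_lt_top_iff] at hφ
  rcases hs.reach_subset_union hG.d_evader (h.realloc j (by omega)).noNegativeCycle ψ hφ with
    h1 | h1
  · exact hs.good.2 φ (dist_lt_top_iff.2 h1)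
  · have h2 := reach_subset hX (h.invariant_realloc hj) (hre.move.edgeState_eq hX).symm
      hre.load_eq.symm ψ h1
    exact (hopen φ).1 (hψ.2 φ (dist_lt_top_iff.2 h2))

/-- While the boundary does not change, no two increases start with the same edge states. -/
theorem edgeState_ne (h : Trace G X Y k) (hG : G.Valid) {i l : ℕ} (hil : i < l) (hl : l < k)
    (hp : G.boundaryProgress (X i) = G.boundaryProgress (X l))
    (hi : ¬ G.IncreaseFails (Y i)) : G.edgeState (Y i) ≠ G.edgeState (Y l) := by
  intro hS
  have hB := fun {j} (hij : i ≤ j) (hjl : j ≤ l) =>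
    h.openBoundary_iff_of_progress_eq hG hij hjl hl hp
  have hinv := fun {j} (hjl : j ≤ l) => h.invariant_realloc (hjl.trans_lt hl)
  have hcyc := fun {j} (hjl : j ≤ l) => (h.realloc j (hjl.trans_lt hl)).noNegativeCycle
  obtain ⟨ψ₁, Δ₁, hs₁, hfirst₁⟩ := (h.step i (by omega)).resolve_right fun hf => hi hf.1
  have hinc := fun {j} (hij : i ≤ j) (hjl : j < l) =>
    h.exists_increaseStep_of_edgeState_eq hG hil.le hl hp hS hs₁.good hij hjl
  have hload : ∀ j, i ≤ j → j ≤ l → load (Y j) = load (Y i) := by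
    intro j hij hjl
    induction j, hij using Nat.le_induction with
    | base => rfl
    | succ j hij ih =>
      obtain ⟨ψ₀, Δ, hs, -⟩ := hinc hij (by omega)
      rw [(h.realloc (j + 1) (by omega)).load_eq, hs.load_eq]
      exact ih (by omega)
  -- The good sites at the two ends agree, and good sites only get lost in between.
  have hgood_anti : ∀ a b, i ≤ a → a ≤ b → b ≤ l → ∀ ψ, G.GoodSite (Y b) ψ →
      G.GoodSite (Y a) ψ := by
    intro a b hia hab hbl ψ hψ
    induction b, hab using Nat.le_induction with
    | base => exact hψ
    | succ b hab ih =>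
      obtain ⟨ψ₀, Δ, hs, -⟩ := hinc (by omega : i ≤ b) (by omega)
      have hpb : G.boundaryProgress (X b) = G.boundaryProgress (X (b + 1)) :=
        (h.progress_eq hG (by omega) (by omega) hl hp).trans
          (h.progress_eq hG (by omega) (by omega) hl hp).symm
      exact ih (by omega) (h.goodSite_of_succ hG (by omega) hpb hs hψ)
  have hgood_end : ∀ ψ, G.GoodSite (Y i) ψ → G.GoodSite (Y l) ψ := by
    intro ψ hψ
    refine ⟨(hB hil.le le_rfl ψ).2 hψ.1, fun φ hφ => (hB hil.le le_rfl φ).2 (hψ.2 φ ?_)⟩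
    rw [dist_lt_top_iff] at hφ ⊢
    exact reach_subset (hinv le_rfl) (hinv hil.le) hS.symm (hload l hil.le le_rfl) ψ hφ
  -- Hence all increases in between start at the same site.
  have hinc₁ : ∀ j, i ≤ j → j < l → ∃ Δ, IncreaseStep G (Y j) (X (j + 1)) ψ₁ Δ := by
    intro j hij hjl
    obtain ⟨ψ₀, Δ, hs, hfirst⟩ := hinc hij hjl
    have hg : G.GoodSite (Y j) ψ₁ := hgood_anti j l hij hjl.le le_rfl ψ₁ (hgood_end ψ₁ hs₁.good)
    rcases lt_trichotomy ψ₀ ψ₁ with hlt | rfl | hlt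
    · exact (hfirst₁ ψ₀ hlt (hgood_anti i j le_rfl hij hjl.le ψ₀ hs.good)).elim
    · exact ⟨Δ, hs⟩
    · exact (hfirst ψ₁ hlt hg).elim
  -- The set that is reachable from it only grows, so it is constant as well.
  have hreach_mono : ∀ a b, i ≤ a → a ≤ b → b ≤ l → Reach G (Y a) ψ₁ ⊆ Reach G (Y b) ψ₁ := by
    intro a b hia hab hbl
    induction b, hab using Nat.le_induction with
    | base => exact subset_rfl
    | succ b hab ih =>
      obtain ⟨Δ, hs⟩ := hinc₁ b (by omega) (by omega)
      have hre := h.realloc (b + 1) (by omega)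
      have hX := h.invariant (b + 1) (by omega)
      exact (ih (by omega)).trans ((hs.reach_subset hG.d_evader (hcyc (by omega))).trans
        (reach_subset hX (hinv hbl) (hre.move.edgeState_eq hX).symm hre.load_eq.symm ψ₁))
  have hreach : ∀ j, i ≤ j → j ≤ l → Reach G (Y j) ψ₁ ⊆ Reach G (Y i) ψ₁ := fun j hij hjl =>
    (hreach_mono j l hij hjl le_rfl).trans
      (reach_subset (hinv le_rfl) (hinv hil.le) hS.symm (hload l hil.le le_rfl) ψ₁)
  have hpot : ∀ j, i ≤ j → j < l → ∃ Δ > 0, ∀ v,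
      nodePotential G (Y (j + 1)) v = nodePotential G (Y j) v + Δ * G.rate (Y j) ψ₁ v := by
    intro j hij hjl
    obtain ⟨Δ, hs⟩ := hinc₁ j hij hjl
    refine ⟨Δ, hs.pos, fun v => ?_⟩
    rw [(h.realloc (j + 1) (by omega)).nodePotential_eq (h.invariant (j + 1) (by omega)),
      hs.nodePotential_eq hG.d_evader (hcyc hjl.le)]
  -- The total change of the potentials is the multiple `c` of the first rates.
  set c := nodePotential G (Y l) (.site ψ₁) - nodePotential G (Y i) (.site ψ₁) with hc
  have hcΔ : Δ₁ ≤ c := by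
    have h1 : nodePotential G (Y (i + 1)) (.site ψ₁) =
        nodePotential G (Y i) (.site ψ₁) + Δ₁ := by
      rw [(h.realloc (i + 1) (by omega)).nodePotential_eq (h.invariant (i + 1) (by omega)),
        hs₁.nodePotential_eq hG.d_evader (hcyc hil.le), rate_self (hcyc hil.le), mul_one]
    have h2 : ∀ b, i + 1 ≤ b → b ≤ l → nodePotential G (Y (i + 1)) (.site ψ₁) ≤
        nodePotential G (Y b) (.site ψ₁) := by
      intro b hb hbl
      induction b, hb using Nat.le_induction with
      | base => exact le_rfl
      | succ b hb ih =>
        obtain ⟨Δ, hΔ, he⟩ := hpot b (by omega) (by omega)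
        rw [he]
        have := mul_nonneg hΔ.le (rate_nonneg (G := G) (x := Y b) (ψ₀ := ψ₁) (v := .site ψ₁))
        linarith [ih (by omega)]
    linarith [h2 l hil le_rfl]
  have hactive : ∀ a ψ, G.Active (Y i) a ψ →
      nodePotential G (Y l) (.evader a) - nodePotential G (Y i) (.evader a) =
        -G.d a.succ ψ * (nodePotential G (Y l) (.site ψ) - nodePotential G (Y i) (.site ψ)) := by
    intro a ψ ha
    have ha' : G.Active (Y l) a ψ := by rwa [active_iff_edgeState, ← hS, ← active_iff_edgeState]
    have e1 := mu_sub_thr (G := G) (x := Y i) a ψ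
    have e2 := mu_sub_thr (G := G) (x := Y l) a ψ
    rw [(active_iff.1 ha).2, sub_self] at e1
    rw [(active_iff.1 ha').2, sub_self] at e2
    linarith
  have hdelta : ∀ v, nodePotential G (Y l) v - nodePotential G (Y i) v =
      c * G.rate (Y i) ψ₁ v := by
    intro v
    by_cases hv : v ∈ Reach G (Y i) ψ₁
    · have hpath := reach_reflTransGen_tightEdge (hcyc hil.le) hv
      clear hv
      induction hpath with
      | refl => rw [rate_self (hcyc hil.le), mul_one]
      | @tail u v _ e ih =>
        obtain ⟨a, ψ, hcase, ha, he⟩ := e.cases hG.d_evader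
        have hd := hG.d_evader a ψ
        have hrel := hactive a ψ ha
        rcases hcase with ⟨rfl, rfl, -⟩ | ⟨rfl, rfl, -⟩
        · rw [hrel, ← he] at ih
          refine mul_left_cancel₀ (neg_pos.2 hd).ne' ?_
          linarith
        · rw [hrel, ih, ← he]
          ring
    · have hconst : ∀ j, i ≤ j → j ≤ l → nodePotential G (Y j) v = nodePotential G (Y i) v := by
        intro j hij hjl
        induction j, hij using Nat.le_induction with
        | base => rfl
        | succ j hij ih =>
          obtain ⟨Δ, -, he⟩ := hpot j hij (by omega)
          rw [he, rate_of_notMem fun hm => hv (hreach j hij (by omega) hm), mul_zero, add_zero]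
          exact ih (by omega)
      rw [hconst l hil.le le_rfl, rate_of_notMem hv]
      ring
  -- The edge that ended the first increase has crossed the threshold at the second occurrence.
  have hfilled : G.Filled (X (i + 1)) = G.Filled (Y i) := by
    rw [← h.filled_eq (by omega)]
    exact (h.eq_of_progress_eq hG (Nat.le_succ i) hil hl hp).2
  obtain ⟨a, ψ, hpos, hne, hblock⟩ := hs₁.exists_blocking_edge (hcyc hil.le)
    (h.loop (i + 1) (by omega)) fun ψ hlt => not_le.1 fun hle => by
      have : ψ ∈ G.Filled (X (i + 1)) := hle
      rw [hfilled] at this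
      exact hlt.not_ge this
  set q := G.rate (Y i) ψ₁ (.site ψ) * -G.d a.succ ψ - G.rate (Y i) ψ₁ (.evader a) with hq
  have hend : G.mu (Y l) a.succ ψ - G.thr (Y l) a = (Δ₁ - c) * q := by
    have h1 := hdelta (.site ψ)
    have h2 := hdelta (.evader a)
    have h3 := mu_sub_thr (G := G) (x := Y i) a ψ
    rw [mu_sub_thr]
    rw [hblock] at h3
    rw [sub_mul, h3, eq_add_of_sub_eq h1, eq_add_of_sub_eq h2]
    simp only [hq]
    ring
  have hpos' : ∃ ψ, 0 < Y l a.succ ψ := by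
    rw [(hinv le_rfl).exists_pos_iff, ← (hinv hil.le).exists_pos_iff]
    exact hpos
  have hsign := congrFun (congrFun hS a) ψ
  rw [edgeState, edgeState, if_pos hpos, if_pos hpos', hend, hblock] at hsign
  have hΔ₁ := hs₁.pos
  have hq0 : q ≠ 0 := by
    intro h0
    rw [h0, mul_zero] at hblock
    exact hne (sub_eq_zero.1 hblock)
  rcases lt_or_gt_of_ne hq0 with hlt | hlt
  · rw [sign_neg (mul_neg_of_pos_of_neg hΔ₁ hlt), eq_comm, sign_eq_neg_one_iff] at hsign
    nlinarith
  · rw [sign_pos (mul_pos hΔ₁ hlt), eq_comm, sign_eq_one_iff] at hsign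
    nlinarith

end Trace

end

end CEGame

/-! ### The length of a run -/

namespace CEGame

variable {n : ℕ} {Ψ : Type*} [Fintype Ψ] [LinearOrder Ψ] {G : CEGame n Ψ}
  {X Y : ℕ → Profile n Ψ} {k : ℕ}

open Classical in
/-- A label of the iteration `j` of a run of length `k`. Besides the boundary progress it holds
the edge states of an increase, or, for rerouting, those of the following increase if the
boundary stays unchanged until then. -/
noncomputable def iterationLabel (G : CEGame n Ψ) (X Y : ℕ → Profile n Ψ) (k j : ℕ) :
    ℕ × (((Fin n → Ψ → SignType) ⊕ (Fin n → Ψ → SignType)) ⊕ Unit) :=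
  (G.boundaryProgress (X j),
    if G.IncreaseFails (Y j) then
      if j + 1 < k ∧ G.boundaryProgress (X j) = G.boundaryProgress (X (j + 1)) then
        .inl (.inr (G.edgeState (Y (j + 1))))
      else .inr ()
    else .inl (.inl (G.edgeState (Y j))))

/-- A rerouting after which the boundary stays the same can be identified by the increase that
follows it, and all others are the last iteration with their value of the progress. -/
theorem Trace.iterationLabel_ne (h : Trace G X Y k) (hG : G.Valid) {i l : ℕ} (hil : i < l)
    (hl : l < k) : iterationLabel G X Y k i ≠ iterationLabel G X Y k l := by
  intro heq
  obtain ⟨hp, heq⟩ := Prod.ext_iff.1 heq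
  simp only [iterationLabel] at hp heq
  have hsucc := h.progress_eq hG (Nat.le_succ i) hil hl hp
  by_cases h1 : G.IncreaseFails (Y i)
  · by_cases h2 : i + 1 < k ∧ G.boundaryProgress (X i) = G.boundaryProgress (X (i + 1))
    · rw [if_pos h1, if_pos h2] at heq
      split_ifs at heq with h3 h4
      · obtain ⟨t, Δ, hs⟩ : ∃ t Δ, RerouteStep G (Y i) (X (i + 1)) t Δ := by
          rcases h.step i (by omega) with ⟨ψ₀, Δ, hs, -⟩ | ⟨-, hs⟩
          · exact (h1 ψ₀ hs.good).elim
          · exact hs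
        refine h.edgeState_ne hG (Nat.succ_lt_succ hil) h4.1 ?_
          (h.not_increaseFails_succ hG h2.1 h2.2 hs) (by simpa using heq)
        rw [Nat.succ_eq_add_one, ← h2.2, hp, h4.2]
      all_goals simp at heq
    · exact h2 ⟨by omega, hsucc.symm⟩
  · rw [if_neg h1] at heq
    split_ifs at heq with h3 h4
    · simp at heq
    · exact h.edgeState_ne hG hil hl hp h1 (by simpa using heq)

theorem card_edgeStates :
    Fintype.card (Fin n → Ψ → SignType) = 3 ^ (n * Fintype.card Ψ) := by
  have h3 : Fintype.card SignType = 3 := rfl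
  rw [Fintype.card_fun, Fintype.card_fun, h3, Fintype.card_fin, ← pow_mul, mul_comm]

theorem Trace.length_le (h : Trace G X Y k) (hG : G.Valid) :
    k ≤ 2 * Fintype.card Ψ + 4 * Fintype.card Ψ * 3 ^ (n * Fintype.card Ψ) := by
  classical
  have hinj : Set.InjOn (iterationLabel G X Y k) (Finset.range k) := by
    intro i hi l hl heq
    rw [Finset.coe_range, Set.mem_Iio] at hi hl
    by_contra hne
    rcases lt_or_gt_of_ne hne with hlt | hlt
    · exact h.iterationLabel_ne hG hlt hl heq
    · exact h.iterationLabel_ne hG hlt hi heq.symm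
  have hmaps : Set.MapsTo (iterationLabel G X Y k) (Finset.range k)
      ↑(Finset.Icc 1 (2 * Fintype.card Ψ - 1) ×ˢ (Finset.univ :
        Finset (((Fin n → Ψ → SignType) ⊕ (Fin n → Ψ → SignType)) ⊕ Unit))) := by
    intro j hj
    rw [Finset.coe_range, Set.mem_Iio] at hj
    exact Finset.mem_coe.2 (Finset.mem_product.2
      ⟨boundaryProgress_mem hG (h.loop j hj), Finset.mem_univ _⟩)
  have hcard := Finset.card_le_card_of_injOn _ hmaps hinj
  rw [Finset.card_range, Finset.card_product, Nat.card_Icc, Finset.card_univ,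
    Fintype.card_sum, Fintype.card_sum, card_edgeStates, Fintype.card_unit] at hcard
  refine hcard.trans ((Nat.mul_le_mul_right _
    (by omega : 2 * Fintype.card Ψ - 1 + 1 - 1 ≤ 2 * Fintype.card Ψ)).trans_eq (by ring))

/-! ### Correctness of the algorithm -/

theorem Iteration.exists_step {x z : Profile n Ψ} (hG : G.Valid) (hx : Invariant G x)
    (hloop : G.LoopCondition x) (h : G.Iteration x z) :
    ∃ y, Realloc G x y ∧
      ((∃ ψ₀ Δ, IncreaseStep G y z ψ₀ Δ ∧ ∀ φ < ψ₀, ¬ G.GoodSite y φ) ∨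
        (G.IncreaseFails y ∧ ∃ t Δ, RerouteStep G y z t Δ)) ∧ Invariant G z := by
  obtain ⟨y, hy, h⟩ := h
  have hre := hy.realloc hx
  have hy' := hre.invariant hx
  have hloop' : G.LoopCondition y := by
    unfold LoopCondition
    rwa [hre.move.catcher]
  rcases h with h | ⟨hf, h⟩
  · obtain ⟨ψ₀, Δ, hs, hfirst⟩ := h.exists_step hre.noNegativeCycle hloop'
    exact ⟨y, hre, .inl ⟨ψ₀, Δ, hs, hfirst⟩, hs.invariant hG.d_evader hre.noNegativeCycle hy'⟩
  · obtain ⟨t, Δ, hs⟩ := h.exists_step hG hy' hf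
    exact ⟨y, hre, .inr ⟨hf, t, Δ, hs⟩, hs.invariant hG hy'⟩

theorem IsRun.invariant (hG : G.Valid) (h : G.IsRun X k) : ∀ j ≤ k, Invariant G (X j) := by
  intro j
  induction j with
  | zero => exact fun _ => h.1.invariant hG
  | succ j ih =>
    intro hj
    obtain ⟨hloop, hit⟩ := h.2 j hj
    obtain ⟨y, -, -, hz⟩ := hit.exists_step hG (ih (by omega)) hloop
    exact hz

theorem IsRun.exists_trace (hG : G.Valid) (h : G.IsRun X k) : ∃ Y, Trace G X Y k := by
  have hinv := h.invariant hG
  have hstep : ∀ j, j < k → ∃ y, Realloc G (X j) y ∧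
      ((∃ ψ₀ Δ, IncreaseStep G y (X (j + 1)) ψ₀ Δ ∧ ∀ φ < ψ₀, ¬ G.GoodSite y φ) ∨
        (G.IncreaseFails y ∧ ∃ t Δ, RerouteStep G y (X (j + 1)) t Δ)) := by
    intro j hj
    obtain ⟨y, h1, h2, -⟩ := (h.2 j hj).2.exists_step hG (hinv j hj.le) (h.2 j hj).1
    exact ⟨y, h1, h2⟩
  choose! Y h1 h2 using hstep
  exact ⟨Y, fun j hj => hinv j hj.le, h1, fun j hj => (h.2 j hj).1, h2⟩

theorem IsRun.length_le (hG : G.Valid) (h : G.IsRun X k) :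
    k ≤ 2 * Fintype.card Ψ + 4 * Fintype.card Ψ * 3 ^ (n * Fintype.card Ψ) := by
  obtain ⟨Y, hY⟩ := h.exists_trace hG
  exact hY.length_le hG

/-- The subroutines do not get stuck. -/
theorem progress_of_loopCondition {x : Profile n Ψ} (hG : G.Valid) (hx : Invariant G x)
    (hloop : G.LoopCondition x) :
    (∃ y, G.Reallocates x y) ∧ ∀ y, G.Reallocates x y →
      G.IsCurrentNash y ∧ (¬ G.IncreaseFails y → ∃ z, G.Increases y z) ∧
        (G.IncreaseFails y → ∃ z, G.Reroutes y z) := by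
  refine ⟨exists_reallocates hx, fun y hy => ?_⟩
  have hre := hy.realloc hx
  have hy' := hre.invariant hx
  refine ⟨hy'.isCurrentNash, exists_increases, fun _ => exists_reroutes hG hy' ?_⟩
  unfold LoopCondition
  rwa [hre.move.catcher]

theorem IsRun.extend (hG : G.Valid) (h : G.IsRun X k) (hloop : G.LoopCondition (X k)) :
    ∃ X', G.IsRun X' (k + 1) := by
  obtain ⟨⟨y, hy⟩, hnext⟩ := progress_of_loopCondition hG (h.invariant hG k le_rfl) hloop
  obtain ⟨-, hinc, hre⟩ := hnext y hy
  obtain ⟨z, hz⟩ : ∃ z, G.Iteration (X k) z := by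
    by_cases hf : G.IncreaseFails y
    · exact (hre hf).imp fun z hz => ⟨y, hy, .inr ⟨hf, hz⟩⟩
    · exact (hinc hf).imp fun z hz => ⟨y, hy, .inl hz⟩
  refine ⟨fun j => if j ≤ k then X j else z, by simpa using h.1, fun j hj => ?_⟩
  rcases Nat.lt_succ_iff_lt_or_eq.1 hj with hlt | rfl
  · simpa [hlt.le, Nat.succ_le_iff.2 hlt] using h.2 j hlt
  · simpa using ⟨hloop, hz⟩

theorem exists_isRun_not_loopCondition (hG : G.Valid) :
    ∃ (X : ℕ → Profile n Ψ) (k : ℕ), G.IsRun X k ∧ ¬ G.LoopCondition (X k) := by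
  by_contra! hno
  have hall : ∀ k, ∃ X, G.IsRun X k := by
    intro k
    induction k with
    | zero =>
      obtain ⟨x, hx⟩ := exists_isInitial G
      exact ⟨fun _ => x, hx, by simp⟩
    | succ k ih =>
      obtain ⟨X, hX⟩ := ih
      exact hX.extend hG (hno X k hX)
  obtain ⟨X, hX⟩ := hall (2 * Fintype.card Ψ + 4 * Fintype.card Ψ * 3 ^ (n * Fintype.card Ψ) + 1)
  exact (hX.length_le hG).not_gt (Nat.lt_succ_self _)

end CEGame

theorem mainTheorem4 {n : ℕ} {Ψ : Type*} [Fintype Ψ] [LinearOrder Ψ]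
    (G : CEGame n Ψ) (hG : G.Valid) :
    -- the algorithm can be started
    (∃ x, G.IsInitial x) ∧
    (∀ (X : ℕ → CEGame.Profile n Ψ) (k : ℕ), G.IsRun X k →
      -- no run has more iterations than the bound
      k ≤ 2 * Fintype.card Ψ + 4 * Fintype.card Ψ * 3 ^ (n * Fintype.card Ψ) ∧
      -- equilibrium is maintained at the loop head
      (∀ j ≤ k, G.IsCurrentNash (X j)) ∧
      -- when the loop is left, the profile is an equilibrium of the given game
      (¬ G.LoopCondition (X k) → G.IsNash (X k)) ∧
      -- while the loop condition holds, no subroutine gets stuck, whatever the outcomes of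
      -- the earlier ones, and equilibrium is maintained after the reallocation as well
      (G.LoopCondition (X k) →
        (∃ y, G.Reallocates (X k) y) ∧
        ∀ y, G.Reallocates (X k) y →
          G.IsCurrentNash y ∧
          (¬ G.IncreaseFails y → ∃ z, G.Increases y z) ∧
          (G.IncreaseFails y → ∃ z, G.Reroutes y z))) ∧
    -- some run reaches the end of the loop
    (∃ (X : ℕ → CEGame.Profile n Ψ) (k : ℕ), G.IsRun X k ∧ ¬ G.LoopCondition (X k)) ∧
    -- in particular the game has an equilibrium
    (∃ x, G.IsNash x) := by
  have hterm := CEGame.exists_isRun_not_loopCondition hG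
  refine ⟨CEGame.exists_isInitial G, fun X k h => ?_, hterm, ?_⟩
  · have hinv := h.invariant hG
    exact ⟨h.length_le hG, fun j hj => (hinv j hj).isCurrentNash, (hinv k le_rfl).isNash,
      CEGame.progress_of_loopCondition hG (hinv k le_rfl)⟩
  · obtain ⟨X, k, h, hend⟩ := hterm
    exact ⟨X k, (h.invariant hG k le_rfl).isNash hend⟩
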